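/- Let $k$ be a local field of characteristic $0$ (a non-discrete locally compact valued field) and let $K$ be an algebraic closure of $k$. Let $\mathbb H\le GL_n(K)$ be a linear algebraic group defined over $k$, and let $H=\mathbb H(k)=\mathbb H\cap GL_n(k)$ be its group of $k$-points, with the topology inherited from $k$. Let $D$ be a finitely presented group. A homomorphism $\rho:D\to\mathbb H$ is called completely reducible if the linear representation of $D$ on $K^n$ obtained from $\rho$ and the inclusion $\mathbb H\le GL_n(K)$ is completely reducible, i.e. every $D$-invariant subspace has a $D$-invariant complement. For any finite generating family $g_1,\dots,g_m$ of $D$, evaluation $\rho\mapsto(\rho(g_1),\dots,\rho(g_m))$ identifies $\mathrm{Hom}(D,\mathbb H)$ with a subvariety of $\mathbb H^m$ and $\mathrm{Hom}(D,H)$ with a subset of $H^m$; give $\mathrm{Hom}(D,\mathbb H)$ the Zariski topology induced from $\mathbb H^m$, and $\mathrm{Hom}(D,H)$ the (Hausdorff) topology induced from the product topology on $H^m$. The groups $\mathbb H$ and $H$ act on $\mathrm{Hom}(D,\mathbb H)$ and $\mathrm{Hom}(D,H)$ by conjugation. **Theorem.** Let $\pi:D\to H$ be a homomorphism that is completely reducible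 (as a homomorphism to $\mathbb H$). Then, for every finite generating family of $D$: 1. the $\mathbb H$-orbit of $\pi$ in $\mathrm{Hom}(D,\mathbb H)$ is Zariski closed; 2. the $H$-orbit of $\pi$ in $\mathrm{Hom}(D,H)$ is closed in the Hausdorff topology. -/

import Mathlib

open Matrix MvPolynomial

/-- The matrix coordinates of an element of `GL n K`, as a point of affine `n * n`-space. -/
def glCoords {K : Type*} [Field K] {n : ℕ} (x : GL (Fin n) K) : Fin n × Fin n → K :=
  fun ij => (x : Matrix (Fin n) (Fin n) K) ij.1 ij.2

/-- A subgroup `H` of `GL n K` is a (linear) algebraic group over the subfield `k` if it is the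
intersection of `GL n K` with the zero locus of a family of polynomials in the matrix entries with
coefficients in `k`. The inverse of the determinant is not needed among the variables, since
denominators can be cleared. When `K` is an algebraic closure of a field `k` of characteristic
zero, this is the same as being an algebraic group defined over `k`. -/
def IsAlgebraicOver (k : Type*) {K : Type*} [Field k] [Field K] [Algebra k K] {n : ℕ}
    (H : Subgroup (GL (Fin n) K)) : Prop :=
  ∃ I : Ideal (MvPolynomial (Fin n × Fin n) k),
    ∀ x : GL (Fin n) K, x ∈ H ↔ glCoords x ∈ zeroLocus K I

/-- The group `H(k)` of `k`-points of `H`, as a subgroup of `GL n k`. -/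
def kPoints (k : Type*) {K : Type*} [Field k] [Field K] [Algebra k K] {n : ℕ}
    (H : Subgroup (GL (Fin n) K)) : Subgroup (GL (Fin n) k) :=
  H.comap (GeneralLinearGroup.map (algebraMap k K))

/-- The inclusion of `H(k)` into `H`. -/
def kPointsIncl (k : Type*) {K : Type*} [Field k] [Field K] [Algebra k K] {n : ℕ}
    (H : Subgroup (GL (Fin n) K)) : kPoints k H →* H :=
  (GeneralLinearGroup.map (n := Fin n) (algebraMap k K)).subgroupComap H

/-- The linear representation of `D` on `K ^ n` given by a homomorphism from `D` to a subgroup of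
`GL n K`. -/
noncomputable def linearRep {D K : Type*} [Group D] [Field K] {n : ℕ}
    {H : Subgroup (GL (Fin n) K)} (ρ : D →* H) : Representation K D (Fin n → K) where
  toFun d := Matrix.toLin' ((ρ d : GL (Fin n) K) : Matrix (Fin n) (Fin n) K)
  map_one' := by simp [Module.End.one_eq_id]
  map_mul' a b := by simp [Matrix.toLin'_mul, Module.End.mul_eq_comp]

/-- `ρ : D → H < GL n K` is completely reducible if `K ^ n` is, as a representation of `D`: every
invariant subspace has an invariant complement. -/
def IsCompletelyReducible {D K : Type*} [Group D] [Field K] {n : ℕ}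
    {H : Subgroup (GL (Fin n) K)} (ρ : D →* H) : Prop :=
  (linearRep ρ).IsSemisimpleRepresentation

/-- The orbit of `π` in `Hom(D, G)` under conjugation by elements of `G`. -/
def conjOrbit {D G : Type*} [Group D] [Group G] (π : D →* G) : Set (D →* G) :=
  Set.range fun h : G => (MulAut.conj h).toMonoidHom.comp π

/-- A subset of `Hom(D, H)` is Zariski closed if, when `Hom(D, H)` is viewed inside `H ^ m` by
evaluation at the generators `g 1, …, g m` of `D`, it is cut out by polynomials (with coefficients
in `K`) in the matrix entries of the `m` components. -/
def IsZariskiClosed {D K : Type*} [Group D] [Field K] {n m : ℕ} {H : Subgroup (GL (Fin n) K)}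
    (g : Fin m → D) (S : Set (D →* H)) : Prop :=
  ∃ I : Ideal (MvPolynomial (Fin m × Fin n × Fin n) K),
    ∀ ρ : D →* H, ρ ∈ S ↔
      (fun q : Fin m × Fin n × Fin n => glCoords (ρ (g q.1) : GL (Fin n) K) q.2) ∈ zeroLocus K I

/-- The topology on `Hom(D, H)`, for a topological group `H`, induced from the product topology
on `H ^ m` by evaluation at the generators `g 1, …, g m` of `D`. -/
abbrev homTopology {D : Type*} (H : Type*) [Group D] [Group H] [TopologicalSpace H] {m : ℕ}
    (g : Fin m → D) : TopologicalSpace (D →* H) :=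
  TopologicalSpace.induced (fun ρ : D →* H => fun l => ρ (g l)) inferInstance

/-!
Let `x = (x₁, …, x_m)` be the images of the generators under a completely reducible homomorphism.
The theorem says that the orbit of `x` under simultaneous conjugation by an algebraic group `Γ` is
closed among the tuples in `Γ ^ m`. The proof rests on three facts: the conjugacy class of `x` under
the full linear group is closed, conjugation by the `x l` is completely reducible on the space of
matrices, and, because of this, near `x` the class meets `Γ ^ m` only in the orbit under `Γ`.

*Closed classes.* The algebra generated by `x` over an algebraically closed field is semisimple, so
it has a separability idempotent `∑ a ⊗ b`
(`IsSemisimpleTuple.exists_isSeparabilityElement`). Its coefficients descend to subfields. If `y` is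
a limit of conjugates of `x`, then evaluating `a` at a conjugate `y'` and `b` at `y` gives an
intertwiner between `y'` and `y` that depends continuously on `y'` and equals `1` at `y' = y`
(`IsSeparabilityElement.exists_intertwiner`). Hence `y` is conjugate to every nearby `y'` by a
matrix close to `1`, and the class is closed, for any Hausdorff ring topology on the field.

*Complete reducibility of conjugation.* In characteristic zero the tensor product of two completely
reducible representations is completely reducible. The proof given here for the conjugation action
on matrices over `ℂ` follows Kempf and Ness: as the class of `x` is closed, the function
`∑ l, tr (log (x l* x l)) ^ 2`, whose sublevel sets are bounded, attains its minimum on it. At a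
minimum, `∑ l, log (x l x l*) - log (x l* x l) = 0` (`sum_log_eq_zero_of_forall_le`). For a subspace
stable under conjugation by the `x l`, the trace of the commutator with this element, compressed to
the subspace, is a sum of nonnegative terms, one for each `l`, each of which vanishes only if
conjugation by `x l` preserves the orthogonal complement as well
(`sum_log_mul_normSq_starProjection`). The property is transported to any field isomorphic to `ℂ`,
and descends to a subfield in the form of equivariant projections
(`HasConjComplements.exists_projection`).

*The local argument.* Let `F` be a complete field of characteristic zero and `x` a tuple in
`Γ ^ m`. The Lie algebra of `Γ` has a complement `𝔪` in the space of matrices that is stable under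
conjugation by the `x l`. A matrix near `1` is a product `exp Y * (1 + Z)` with `Y` in the Lie
algebra and `Z ∈ 𝔪`. As `exp Y ∈ Γ`, only conjugation by `b = 1 + Z` matters. If `b * x l * b⁻¹ ∈ Γ`
for all `l`, then `b` and `x l * b * (x l)⁻¹`, which is again of the form `1 + Z'` with `Z' ∈ 𝔪`,
lie in the same coset of `Γ`; but `1 + 𝔪` is transversal to the cosets of `Γ` near `1`, so they are
equal and `b` commutes with the `x l` (`eventually_exists_mem_conj`). Applied to a limit point of
the orbit of `x`, which is conjugate to `x` by the first step, this shows that the orbit is closed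
in the topology of `F` (`exists_mem_conj_of_mem_closure`). For `F = k` this is the second claim.

*Zariski closed orbits.* An algebraic closure `K` of a local field of characteristic zero is
isomorphic to `ℂ` as an abstract field, hence is locally compact for a suitable absolute value, and
over `F = K` the orbit is closed for its topology. The orbit is the image of an affine variety under
a polynomial map, and the Zariski closure of such an image is contained in its closure for the
topology of `K` (`MvPolynomial.mem_closure_image_zeroLocus`). So the orbit is Zariski closed. The
comparison of closures follows from Chevalley's theorem on images, which lifts generic points, and
from the density of the nonvanishing locus of a function on an irreducible variety, for which
Noether normalization reduces to affine space (`AlgHom.exists_mem_of_ne_zero`).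
-/

/-! ### Singular values and stable subspaces -/

/-- Singular value decomposition of an injective endomorphism of a finite-dimensional complex
inner product space. -/
theorem exists_singularValueDecomposition {E : Type*} [NormedAddCommGroup E]
    [InnerProductSpace ℂ E] [FiniteDimensional ℂ E] (y : E →ₗ[ℂ] E) (hy : Function.Injective y) :
    ∃ (e f : OrthonormalBasis (Fin (Module.finrank ℂ E)) ℂ E)
      (σ : Fin (Module.finrank ℂ E) → ℝ),
      (∀ a, 0 < σ a) ∧ ∀ a, y (e a) = (σ a : ℂ) • f a := by
  have hT : (LinearMap.adjoint y ∘ₗ y).IsSymmetric := by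
    intro u v
    simp [LinearMap.adjoint_inner_left, LinearMap.adjoint_inner_right]
  set e := hT.eigenvectorBasis rfl with he
  have hinner : ∀ a b, inner ℂ (y (e a)) (y (e b)) =
      (hT.eigenvalues rfl b : ℂ) * inner ℂ (e a) (e b) := by
    intro a b
    rw [← LinearMap.adjoint_inner_right, ← LinearMap.comp_apply, he,
      hT.apply_eigenvectorBasis rfl b, inner_smul_right]
    rfl
  have hpos : ∀ a, 0 < ‖y (e a)‖ := fun a => by
    rw [norm_pos_iff]
    intro h
    have : e a = 0 := hy (by simpa using h)
    have h1 := e.orthonormal.1 a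
    rw [this, norm_zero] at h1
    exact zero_ne_one h1
  have hf : Orthonormal ℂ (fun a => ((‖y (e a)‖ : ℂ)⁻¹) • y (e a)) := by
    constructor
    · intro a
      rw [norm_smul, norm_inv, Complex.norm_real, norm_norm, inv_mul_cancel₀ (hpos a).ne']
    · intro a b hab
      simp only [inner_smul_left, inner_smul_right, hinner, e.orthonormal.2 hab, mul_zero]
  obtain ⟨f, hf'⟩ := Orthonormal.exists_orthonormalBasis_extension_of_card_eq (s := Set.univ)
    (v := fun a => ((‖y (e a)‖ : ℂ)⁻¹) • y (e a)) (Fintype.card_fin _).symm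
    (Orthonormal.comp hf _ Subtype.val_injective)
  refine ⟨e, f, fun a => ‖y (e a)‖, hpos, fun a => ?_⟩
  rw [hf' a trivial, smul_smul, mul_inv_cancel₀ (by exact_mod_cast (hpos a).ne'), one_smul]

theorem log_sub_log_mul_nonneg {s t : ℝ} (hs : 0 < s) (ht : 0 < t) :
    0 ≤ (Real.log s - Real.log t) * (s ^ 2 / t ^ 2 - 1) := by
  rcases le_total s t with h | h
  · exact mul_nonneg_of_nonpos_of_nonpos (sub_nonpos.2 (Real.log_le_log hs h))
      (sub_nonpos.2 (by rw [div_le_one (by positivity)]; gcongr))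
  · exact mul_nonneg (sub_nonneg.2 (Real.log_le_log ht h))
      (sub_nonneg.2 (by rw [one_le_div (by positivity)]; gcongr))

theorem eq_of_log_sub_log_mul_eq_zero {s t : ℝ} (hs : 0 < s) (ht : 0 < t)
    (h : (Real.log s - Real.log t) * (s ^ 2 / t ^ 2 - 1) = 0) : s = t := by
  rcases mul_eq_zero.1 h with h | h
  · exact Real.log_injOn_pos hs ht (sub_eq_zero.1 h)
  · rw [sub_eq_zero, div_eq_one_iff_eq (by positivity)] at h
    exact (sq_eq_sq₀ hs.le ht.le).1 h

/-- Let `y` have singular value decomposition `y (e a) = σ a • f a`, and let `U` be a `y`-stable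
subspace, with orthogonal projection `P`. Then the trace of `P ∘ (log (y y*) - log (y* y)) / 2` is
nonnegative, and if it vanishes, then the orthogonal complement of `U` is `y`-stable as well. In
terms of a singular value decomposition of the restriction of `y` to `U` the trace is a sum of
nonnegative terms. -/
theorem sum_log_mul_normSq_starProjection {E : Type*} [NormedAddCommGroup E]
    [InnerProductSpace ℂ E] [FiniteDimensional ℂ E] {ι : Type*} [Fintype ι]
    (e f : OrthonormalBasis ι ℂ E) (σ : ι → ℝ) (hσ : ∀ a, 0 < σ a) (y : E →ₗ[ℂ] E)
    (hy : ∀ a, y (e a) = (σ a : ℂ) • f a) (U : Submodule ℂ E) (hU : U ≤ U.comap y) :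
    0 ≤ ∑ a, Real.log (σ a) * (‖U.starProjection (f a)‖ ^ 2 - ‖U.starProjection (e a)‖ ^ 2) ∧
    (∑ a, Real.log (σ a) * (‖U.starProjection (f a)‖ ^ 2 - ‖U.starProjection (e a)‖ ^ 2) = 0 →
      Uᗮ ≤ Uᗮ.comap y) := by
  have hyx : ∀ x, y x = ∑ a, (inner ℂ (e a) x * σ a) • f a := fun x => by
    conv_lhs => rw [← e.sum_repr' x, map_sum]
    exact Finset.sum_congr rfl fun a _ => by rw [map_smul, hy, smul_smul]
  have hfy : ∀ a x, inner ℂ (f a) (y x) = σ a * inner ℂ (e a) x := fun a x => by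
    rw [hyx, inner_sum, Finset.sum_eq_single a]
    · rw [inner_smul_right, f.inner_eq_one, mul_one, mul_comm]
    · intro b _ hb
      rw [inner_smul_right, f.inner_eq_zero hb.symm, mul_zero]
    · simp
  have hinj : Function.Injective (y.restrict hU) := by
    intro u v huv
    have h1 : y u = y v := congrArg Subtype.val huv
    refine Subtype.ext (e.toBasis.ext_elem fun a => ?_)
    have h2 := congrArg (inner ℂ (f a)) h1
    rw [hfy, hfy, mul_right_inj' (by exact_mod_cast (hσ a).ne')] at h2
    simpa [e.repr_apply_apply] using h2
  obtain ⟨u, v, τ, hτ, huv⟩ := exists_singularValueDecomposition (y.restrict hU) hinj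
  have huv' : ∀ j, y (u j : E) = (τ j : ℂ) • (v j : E) := fun j => congrArg Subtype.val (huv j)
  have hproj : ∀ (w : OrthonormalBasis (Fin (Module.finrank ℂ U)) ℂ U) (x : E),
      ‖U.starProjection x‖ ^ 2 = ∑ j, ‖inner ℂ x (w j : E)‖ ^ 2 := by
    intro w x
    rw [Submodule.starProjection_apply, ← Submodule.coe_norm, ← w.sum_sq_norm_inner_right]
    refine Finset.sum_congr rfl fun j _ => ?_
    rw [Submodule.coe_inner, norm_inner_symm]
    congr 2
    rw [← Submodule.starProjection_apply, Submodule.inner_starProjection_left_eq_right,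
      Submodule.starProjection_eq_self_iff.2 (w j).2]
  have hsum : ∀ (b : OrthonormalBasis ι ℂ E)
      (w : OrthonormalBasis (Fin (Module.finrank ℂ U)) ℂ U) (j : Fin (Module.finrank ℂ U)),
      ∑ a, ‖inner ℂ (b a) (w j : E)‖ ^ 2 = 1 := by
    intro b w j
    rw [b.sum_sq_norm_inner_right, ← Submodule.coe_norm, w.orthonormal.1 j, one_pow]
  have hrel : ∀ a j, (τ j : ℂ) * inner ℂ (f a) (v j : E) = σ a * inner ℂ (e a) (u j : E) := by
    intro a j
    rw [← hfy, huv', inner_smul_right]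
  have hrel2 : ∀ a j, ‖inner ℂ (f a) (v j : E)‖ ^ 2 =
      σ a ^ 2 / τ j ^ 2 * ‖inner ℂ (e a) (u j : E)‖ ^ 2 := by
    intro a j
    have h := congrArg (fun z => ‖z‖ ^ 2) (hrel a j)
    simp only [norm_mul, Complex.norm_real, mul_pow, Real.norm_eq_abs, sq_abs] at h
    have := (hτ j).ne'
    field_simp
    linarith
  -- The columns of `‖⟪f a, v j⟫‖ ^ 2` and `‖⟪e a, u j⟫‖ ^ 2` have the same sum, so that
  -- `log (σ a)` may be replaced by `log (σ a) - log (τ j)`.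
  have key : ∑ a, Real.log (σ a) *
      (‖U.starProjection (f a)‖ ^ 2 - ‖U.starProjection (e a)‖ ^ 2) =
      ∑ a, ∑ j, (Real.log (σ a) - Real.log (τ j)) * (σ a ^ 2 / τ j ^ 2 - 1) *
        ‖inner ℂ (e a) (u j : E)‖ ^ 2 := by
    have h1 : ∀ a j, (Real.log (σ a) - Real.log (τ j)) * (σ a ^ 2 / τ j ^ 2 - 1) *
        ‖inner ℂ (e a) (u j : E)‖ ^ 2 = Real.log (σ a) * (‖inner ℂ (f a) (v j : E)‖ ^ 2 -
          ‖inner ℂ (e a) (u j : E)‖ ^ 2) - Real.log (τ j) * (‖inner ℂ (f a) (v j : E)‖ ^ 2 -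
          ‖inner ℂ (e a) (u j : E)‖ ^ 2) := by
      intro a j
      rw [hrel2]
      ring
    simp_rw [h1, Finset.sum_sub_distrib, hproj v (f _), hproj u (e _)]
    rw [eq_comm, sub_eq_iff_eq_add, Finset.sum_comm (f := fun a j => Real.log (τ j) * _)]
    simp_rw [← Finset.mul_sum, Finset.sum_sub_distrib, hsum]
    simp
  have hterm : ∀ a j, 0 ≤ (Real.log (σ a) - Real.log (τ j)) * (σ a ^ 2 / τ j ^ 2 - 1) *
        ‖inner ℂ (e a) (u j : E)‖ ^ 2 := fun a j =>
    mul_nonneg (log_sub_log_mul_nonneg (hσ a) (hτ j)) (by positivity)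
  refine ⟨key ▸ Finset.sum_nonneg fun a _ => Finset.sum_nonneg fun j _ => hterm a j, fun h0 => ?_⟩
  rw [key, Finset.sum_eq_zero_iff_of_nonneg
    (fun a _ => Finset.sum_nonneg fun j _ => hterm a j)] at h0
  have h2 : ∀ a j, (σ a : ℂ) * inner ℂ (e a) (u j : E) = τ j * inner ℂ (e a) (u j : E) := by
    intro a j
    have h3 := (Finset.sum_eq_zero_iff_of_nonneg (fun j _ => hterm a j)).1
      (h0 a (Finset.mem_univ _)) j (Finset.mem_univ _)
    rcases mul_eq_zero.1 h3 with h3 | h3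
    · rw [eq_of_log_sub_log_mul_eq_zero (hσ a) (hτ j) h3]
    · rw [norm_eq_zero.1 (pow_eq_zero_iff two_ne_zero |>.1 h3), mul_zero, mul_zero]
  -- when the trace vanishes, `σ a = τ j` unless `e a` and `u j` are orthogonal; hence the adjoint
  -- of `y` maps `v j` to `τ j • u j`, and `U` is stable under the adjoint
  have h4 : ∀ a j, inner ℂ (v j : E) (f a) = inner ℂ (u j : E) (e a) := by
    intro a j
    rw [← inner_conj_symm, ← inner_conj_symm (u j : E)]
    congr 1
    have h5 := (hrel a j).trans (h2 a j)
    exact mul_left_cancel₀ (by exact_mod_cast (hτ j).ne') h5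
  have h2' : ∀ a j, inner ℂ (u j : E) (e a) * (σ a : ℂ) = inner ℂ (u j : E) (e a) * τ j := by
    intro a j
    have := congrArg (starRingEnd ℂ) (h2 a j)
    simpa [inner_conj_symm, mul_comm] using this
  intro z hz
  rw [Submodule.mem_comap, Submodule.mem_orthogonal]
  have h6 : ∀ j, inner ℂ (v j : E) (y z) = 0 := by
    intro j
    have h7 : inner ℂ (v j : E) (y z) = ∑ a, (τ j : ℂ) *
        (inner ℂ (u j : E) (e a) * inner ℂ (e a) z) := by
      rw [hyx, inner_sum]
      refine Finset.sum_congr rfl fun a _ => ?_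
      rw [inner_smul_right, h4]
      linear_combination (inner ℂ (e a) z) * h2' a j
    rw [h7, ← Finset.mul_sum, e.sum_inner_mul_inner,
      (Submodule.mem_orthogonal U z).1 hz _ (u j).2, mul_zero]
  intro w hw
  have h8 : w = ∑ j, inner ℂ (v j) (⟨w, hw⟩ : U) • (v j : E) := by
    have := congrArg Subtype.val (v.sum_repr' ⟨w, hw⟩)
    simpa using this.symm
  rw [h8, sum_inner]
  exact Finset.sum_eq_zero fun j _ => by rw [inner_smul_left, h6, mul_zero]

/-! ### Second-order approximation of the trace of the squared logarithm -/

/-- The matrix with orthonormal eigenvectors the columns of `U` and eigenvalues `c`. -/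
noncomputable def unitaryDiagonal {n : ℕ} (U : Matrix (Fin n) (Fin n) ℂ) (c : Fin n → ℝ) :
    Matrix (Fin n) (Fin n) ℂ :=
  U * diagonal (fun a => (c a : ℂ)) * Uᴴ

theorem isHermitian_unitaryDiagonal {n : ℕ} (U : Matrix (Fin n) (Fin n) ℂ) (c : Fin n → ℝ) :
    (unitaryDiagonal U c)ᴴ = unitaryDiagonal U c := by
  simp only [unitaryDiagonal, conjTranspose_mul, diagonal_conjTranspose,
    conjTranspose_conjTranspose,
    Matrix.mul_assoc]
  congr 3
  ext a
  simp

theorem trace_unitaryDiagonal_mul {n : ℕ} (U U' : Matrix (Fin n) (Fin n) ℂ) (c d : Fin n → ℝ) :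
    (unitaryDiagonal U c * unitaryDiagonal U' d).trace =
      ((∑ a, ∑ j, c a * d j * ‖(Uᴴ * U') a j‖ ^ 2 : ℝ) : ℂ) := by
  have h : (unitaryDiagonal U c * unitaryDiagonal U' d).trace =
      (diagonal (fun a => (c a : ℂ)) * (Uᴴ * U') * (diagonal (fun a => (d a : ℂ)) *
        (Uᴴ * U')ᴴ)).trace := by
    rw [unitaryDiagonal, unitaryDiagonal, Matrix.mul_assoc, Matrix.mul_assoc, trace_mul_comm]
    simp only [conjTranspose_mul, conjTranspose_conjTranspose, Matrix.mul_assoc]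
  rw [h, trace]
  push_cast
  refine Finset.sum_congr rfl fun a _ => ?_
  rw [diag_apply, Matrix.mul_apply]
  refine Finset.sum_congr rfl fun j _ => ?_
  rw [diagonal_mul, diagonal_mul, conjTranspose_apply, RCLike.star_def, ← Complex.mul_conj']
  ring

theorem sum_normSq_row_eq_one {n : ℕ} {W : Matrix (Fin n) (Fin n) ℂ} (hW : W * Wᴴ = 1)
    (a : Fin n) : ∑ j, ‖W a j‖ ^ 2 = 1 := by
  have h := congrFun (congrFun hW a) a
  rw [Matrix.mul_apply, one_apply_eq] at h
  simp only [conjTranspose_apply, RCLike.star_def, Complex.mul_conj'] at h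
  exact_mod_cast h

theorem sum_normSq_col_eq_one {n : ℕ} {W : Matrix (Fin n) (Fin n) ℂ} (hW : Wᴴ * W = 1)
    (j : Fin n) : ∑ a, ‖W a j‖ ^ 2 = 1 := by
  have h := congrFun (congrFun hW j) j
  rw [Matrix.mul_apply, one_apply_eq] at h
  simp only [conjTranspose_apply, RCLike.star_def, Complex.conj_mul'] at h
  exact_mod_cast h

/-- A second-order Taylor estimate for `log ^ 2`. -/
theorem abs_sq_log_sub_le {a b ε : ℝ} (ha : 0 < a) (hε : 0 < ε) (hε1 : ε ≤ 1) (hb : ε * a ≤ b) :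
    |Real.log b ^ 2 - Real.log a ^ 2 - 2 * Real.log a / a * (b - a)| ≤
      (2 * |Real.log a| / ε + 1 / ε ^ 2) / a ^ 2 * (b - a) ^ 2 := by
  have hb0 : 0 < b := lt_of_lt_of_le (mul_pos hε ha) hb
  obtain ⟨s, rfl⟩ : ∃ s, b = s * a := ⟨b / a, by field_simp⟩
  have hs : ε ≤ s := le_of_mul_le_mul_right hb ha
  have hs0 : 0 < s := hε.trans_le hs
  have h1 : Real.log s ≤ s - 1 := Real.log_le_sub_one_of_pos hs0
  have h2 : 1 - s⁻¹ ≤ Real.log s := Real.one_sub_inv_le_log_of_pos hs0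
  have hinv : s⁻¹ ≤ ε⁻¹ := inv_anti₀ hε hs
  have hsi : s * s⁻¹ = 1 := mul_inv_cancel₀ hs0.ne'
  have hεi : ε * ε⁻¹ = 1 := mul_inv_cancel₀ hε.ne'
  have hε1' : 1 ≤ ε⁻¹ := (one_le_inv₀ hε).2 hε1
  have hsi0 : 0 < s⁻¹ := inv_pos.2 hs0
  have h3 : (s - 1) - Real.log s ≤ ε⁻¹ * (s - 1) ^ 2 := by
    have : (s - 1) - (1 - s⁻¹) = s⁻¹ * (s - 1) ^ 2 := by
      field_simp
    nlinarith [mul_le_mul_of_nonneg_right hinv (sq_nonneg (s - 1))]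
  have h4 : Real.log s ^ 2 ≤ (ε⁻¹) ^ 2 * (s - 1) ^ 2 := by
    rw [← mul_pow, sq_le_sq]
    rw [abs_mul, abs_of_pos (inv_pos.2 hε)]
    rcases abs_cases (s - 1) with h | h <;> rcases abs_cases (Real.log s) with h' | h' <;>
      rw [h.1, h'.1]
    · nlinarith
    · nlinarith
    · nlinarith
    · have : s⁻¹ - 1 = s⁻¹ * (1 - s) := by field_simp
      nlinarith
  rw [Real.log_mul hs0.ne' ha.ne']
  have h5 : (Real.log s + Real.log a) ^ 2 - Real.log a ^ 2 - 2 * Real.log a / a * (s * a - a) =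
      Real.log s ^ 2 - 2 * Real.log a * ((s - 1) - Real.log s) := by
    field_simp; ring
  have h6 : (2 * |Real.log a| / ε + 1 / ε ^ 2) / a ^ 2 * (s * a - a) ^ 2 =
      (ε⁻¹) ^ 2 * (s - 1) ^ 2 + 2 * |Real.log a| * (ε⁻¹ * (s - 1) ^ 2) := by
    field_simp; ring
  rw [h5, h6]
  refine (abs_sub _ _).trans (add_le_add ?_ ?_)
  · rwa [abs_of_nonneg (sq_nonneg _)]
  · rw [abs_mul, abs_mul, abs_two, abs_of_nonneg (sub_nonneg.2 h1)]
    gcongr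

/-- The trace of `(log S) ^ 2`, as a function of the positive definite matrix `S`, is approximated
to second order by its linearization. Both sides are expanded in eigenbases of the two matrices
that are compared. -/
theorem exists_abs_sum_sq_log_sub_le {n : ℕ} (U : Matrix (Fin n) (Fin n) ℂ) (hU : Uᴴ * U = 1)
    (lam : Fin n → ℝ) (hlam : ∀ a, 0 < lam a) :
    ∃ C η : ℝ, 0 < η ∧ ∀ (U' : Matrix (Fin n) (Fin n) ℂ) (lam' : Fin n → ℝ), U'ᴴ * U' = 1 →
      ((unitaryDiagonal U' lam' - unitaryDiagonal U lam) *
        (unitaryDiagonal U' lam' - unitaryDiagonal U lam)).trace.re < η →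
      |∑ j, Real.log (lam' j) ^ 2 - ∑ a, Real.log (lam a) ^ 2 -
        (unitaryDiagonal U (fun a => 2 * Real.log (lam a) / lam a) *
          (unitaryDiagonal U' lam' - unitaryDiagonal U lam)).trace.re| ≤
      C * ((unitaryDiagonal U' lam' - unitaryDiagonal U lam) *
        (unitaryDiagonal U' lam' - unitaryDiagonal U lam)).trace.re := by
  -- `lo` is a lower and `hi` an upper bound for the eigenvalues of the first matrix
  obtain ⟨lo, hlo, hlo'⟩ : ∃ lo : ℝ, 0 < lo ∧ ∀ a, 2 * lo ≤ lam a := by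
    rcases isEmpty_or_nonempty (Fin n) with h | h
    · exact ⟨1, one_pos, fun a => isEmptyElim a⟩
    · obtain ⟨a, ha⟩ := Finite.exists_min lam
      exact ⟨lam a / 2, half_pos (hlam a), fun b => by linarith [ha b]⟩
  obtain ⟨hi, hhi, hhi'⟩ : ∃ hi : ℝ, lo ≤ hi ∧ ∀ a, lam a ≤ hi := by
    refine ⟨lo + ∑ a, lam a, le_add_of_nonneg_right (Finset.sum_nonneg fun a _ => (hlam a).le),
      fun a => ?_⟩
    have := Finset.single_le_sum (f := lam) (fun b _ => (hlam b).le) (Finset.mem_univ a)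
    linarith
  have hhi0 : 0 < hi := hlo.trans_le hhi
  set ε := lo / hi with hε
  have hε0 : 0 < ε := div_pos hlo hhi0
  have hε1 : ε ≤ 1 := (div_le_one hhi0).2 hhi
  set c : Fin n → ℝ := fun a => (2 * |Real.log (lam a)| / ε + 1 / ε ^ 2) / lam a ^ 2 with hc
  have hc0 : ∀ a, 0 ≤ c a := fun a => by positivity
  refine ⟨∑ a, c a, lo ^ 2, by positivity, fun U' lam' hU' hη => ?_⟩
  set W := Uᴴ * U' with hWdef
  have hUU : U * Uᴴ = 1 := mul_eq_one_comm.1 hU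
  have hUU' : U' * U'ᴴ = 1 := mul_eq_one_comm.1 hU'
  have hW : W * Wᴴ = 1 := by
    rw [hWdef, conjTranspose_mul, conjTranspose_conjTranspose, Matrix.mul_assoc,
      ← Matrix.mul_assoc U', hUU', Matrix.one_mul, hU]
  have hW' : Wᴴ * W = 1 := mul_eq_one_comm.1 hW
  have hrow := sum_normSq_row_eq_one hW
  have hcol := sum_normSq_col_eq_one hW'
  have hself : ∀ (V : Matrix (Fin n) (Fin n) ℂ) (hV : Vᴴ * V = 1) (d d' : Fin n → ℝ),
      (unitaryDiagonal V d * unitaryDiagonal V d').trace.re = ∑ a, d a * d' a := by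
    intro V hV d d'
    rw [trace_unitaryDiagonal_mul, Complex.ofReal_re, hV]
    refine Finset.sum_congr rfl fun a _ => ?_
    rw [Finset.sum_eq_single a]
    · simp
    · intro b _ hb
      simp [one_apply_ne hb.symm]
    · simp
  have hmix : ∀ d d' : Fin n → ℝ, (unitaryDiagonal U d * unitaryDiagonal U' d').trace.re =
      ∑ a, ∑ j, d a * d' j * ‖W a j‖ ^ 2 := by
    intro d d'
    rw [trace_unitaryDiagonal_mul, Complex.ofReal_re]
  have hrow' : ∀ d : Fin n → ℝ, ∑ a, d a = ∑ a, ∑ j, d a * ‖W a j‖ ^ 2 := by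
    intro d
    simp_rw [← Finset.mul_sum, hrow, mul_one]
  have hcol' : ∀ d : Fin n → ℝ, ∑ j, d j = ∑ a, ∑ j, d j * ‖W a j‖ ^ 2 := by
    intro d
    rw [Finset.sum_comm]
    simp_rw [← Finset.mul_sum, hcol, mul_one]
  have hD : ((unitaryDiagonal U' lam' - unitaryDiagonal U lam) *
        (unitaryDiagonal U' lam' - unitaryDiagonal U lam)).trace.re =
      ∑ a, ∑ j, (lam' j - lam a) ^ 2 * ‖W a j‖ ^ 2 := by
    rw [sub_mul, mul_sub, mul_sub, trace_sub, trace_sub, trace_sub,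
      trace_mul_comm (unitaryDiagonal U' lam') (unitaryDiagonal U lam), Complex.sub_re,
      Complex.sub_re, Complex.sub_re, hself _ hU, hself _ hU', hmix,
      hrow' fun a => lam a * lam a, hcol' fun j => lam' j * lam' j]
    simp_rw [← Finset.sum_sub_distrib]
    exact Finset.sum_congr rfl fun a _ => Finset.sum_congr rfl fun j _ => by ring
  have hlin : (unitaryDiagonal U (fun a => 2 * Real.log (lam a) / lam a) *
          (unitaryDiagonal U' lam' - unitaryDiagonal U lam)).trace.re =
      ∑ a, ∑ j, 2 * Real.log (lam a) / lam a * (lam' j - lam a) * ‖W a j‖ ^ 2 := by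
    rw [mul_sub, trace_sub, Complex.sub_re, hself _ hU, hmix,
      hrow' fun a => 2 * Real.log (lam a) / lam a * lam a]
    simp_rw [← Finset.sum_sub_distrib]
    exact Finset.sum_congr rfl fun a _ => Finset.sum_congr rfl fun j _ => by ring
  -- every eigenvalue of the second matrix is close to some eigenvalue of the first
  have hlow : ∀ j, lo ≤ lam' j := by
    intro j
    by_contra! hj
    have h1 : lo ^ 2 ≤ ∑ a, (lam' j - lam a) ^ 2 * ‖W a j‖ ^ 2 := by
      calc lo ^ 2 = ∑ a, lo ^ 2 * ‖W a j‖ ^ 2 := by rw [← Finset.mul_sum, hcol, mul_one]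
        _ ≤ _ := Finset.sum_le_sum fun a _ => by
            have := hlo' a
            have : lo ^ 2 ≤ (lam' j - lam a) ^ 2 := by nlinarith
            gcongr
    rw [hD, Finset.sum_comm] at hη
    have h2 := Finset.single_le_sum (f := fun j => ∑ a, (lam' j - lam a) ^ 2 * ‖W a j‖ ^ 2)
      (fun i _ => Finset.sum_nonneg fun a _ => by positivity) (Finset.mem_univ j)
    linarith
  rw [hD, hlin, hcol' fun j => Real.log (lam' j) ^ 2, hrow' fun a => Real.log (lam a) ^ 2]
  simp_rw [← Finset.sum_sub_distrib, Finset.mul_sum]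
  refine (Finset.abs_sum_le_sum_abs _ _).trans (Finset.sum_le_sum fun a _ =>
    (Finset.abs_sum_le_sum_abs _ _).trans (Finset.sum_le_sum fun j _ => ?_))
  rw [← sub_mul, ← sub_mul, abs_mul, abs_of_nonneg (sq_nonneg ‖W a j‖), ← mul_assoc]
  refine mul_le_mul_of_nonneg_right ((abs_sq_log_sub_le (hlam a) hε0 hε1 ?_).trans ?_)
    (sq_nonneg _)
  · calc ε * lam a ≤ ε * hi := by gcongr; exact hhi' a
      _ = lo := by rw [hε]; field_simp
      _ ≤ lam' j := hlow j
  · exact mul_le_mul_of_nonneg_right (Finset.single_le_sum (f := c) (fun b _ => hc0 b)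
      (Finset.mem_univ a)) (sq_nonneg _)

/-! ### The sum of the squared logarithms of the singular values, and its critical points -/

/-- The trace of `(log (xᴴ * x)) ^ 2`, that is, the sum of `4 * (log s) ^ 2` over the singular
values `s` of `x`. Vanishing singular values contribute `0`, by the convention `log 0 = 0`; the
function is meaningful for invertible `x`. -/
noncomputable def logSingularSq {n : ℕ} (x : Matrix (Fin n) (Fin n) ℂ) : ℝ :=
  ∑ a, Real.log ((isHermitian_conjTranspose_mul_self x).eigenvalues a) ^ 2

open scoped ComplexOrder in
/-- The spectral theorem for `xᴴ * x`. -/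
theorem exists_logSingularSq_eq {n : ℕ} (x : Matrix (Fin n) (Fin n) ℂ) :
    ∃ (U : Matrix (Fin n) (Fin n) ℂ) (lam : Fin n → ℝ), Uᴴ * U = 1 ∧
      xᴴ * x = unitaryDiagonal U lam ∧ logSingularSq x = ∑ a, Real.log (lam a) ^ 2 ∧
      (IsUnit x → ∀ a, 0 < lam a) := by
  have hS := isHermitian_conjTranspose_mul_self x
  refine ⟨hS.eigenvectorUnitary, hS.eigenvalues, ?_, ?_, rfl, fun hx a => ?_⟩
  · exact Matrix.mem_unitaryGroup_iff'.1 hS.eigenvectorUnitary.2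
  · conv_lhs => rw [hS.spectral_theorem]
    rw [unitaryDiagonal, Unitary.conjStarAlgAut_apply]
    rfl
  · exact (Matrix.PosDef.conjTranspose_mul_self x
      (Matrix.mulVec_injective_iff_isUnit.2 hx)).eigenvalues_pos a

theorem unitaryDiagonal_mul_unitaryDiagonal {n : ℕ} {U : Matrix (Fin n) (Fin n) ℂ}
    (hU : Uᴴ * U = 1) (c d : Fin n → ℝ) :
    unitaryDiagonal U c * unitaryDiagonal U d = unitaryDiagonal U (c * d) := by
  simp only [unitaryDiagonal, Matrix.mul_assoc]
  rw [← Matrix.mul_assoc Uᴴ, hU, Matrix.one_mul, ← Matrix.mul_assoc (diagonal _) (diagonal _),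
    diagonal_mul_diagonal]
  simp

theorem unitaryDiagonal_smul {n : ℕ} (U : Matrix (Fin n) (Fin n) ℂ) (r : ℝ) (c : Fin n → ℝ) :
    unitaryDiagonal U (r • c) = (r : ℂ) • unitaryDiagonal U c := by
  rw [unitaryDiagonal, unitaryDiagonal, ← Matrix.smul_mul, ← Matrix.mul_smul, ← diagonal_smul]
  congr 3
  ext a
  simp

/-- Singular value decomposition of an invertible matrix, together with the second-order
approximation of `logSingularSq` at this matrix. -/
theorem exists_svd_abs_logSingularSq_sub_le {n : ℕ} (x : Matrix (Fin n) (Fin n) ℂ)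
    (hx : IsUnit x) :
    ∃ (U V : Matrix (Fin n) (Fin n) ℂ) (σ : Fin n → ℝ), Uᴴ * U = 1 ∧ Vᴴ * V = 1 ∧
      (∀ a, 0 < σ a) ∧ x = V * diagonal (fun a => (σ a : ℂ)) * Uᴴ ∧
      ∃ C η : ℝ, 0 < η ∧ ∀ y : Matrix (Fin n) (Fin n) ℂ,
        ((yᴴ * y - xᴴ * x) * (yᴴ * y - xᴴ * x)).trace.re < η →
        |logSingularSq y - logSingularSq x -
          (unitaryDiagonal U (fun a => 4 * Real.log (σ a) / σ a ^ 2) *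
            (yᴴ * y - xᴴ * x)).trace.re| ≤
          C * ((yᴴ * y - xᴴ * x) * (yᴴ * y - xᴴ * x)).trace.re := by
  obtain ⟨U, lam, hU, hxU, hlog, hlam⟩ := exists_logSingularSq_eq x
  replace hlam := hlam hx
  have hUU : U * Uᴴ = 1 := mul_eq_one_comm.1 hU
  have hσ : ∀ a, 0 < √(lam a) := fun a => Real.sqrt_pos.2 (hlam a)
  have hdd : diagonal (fun a => ((√(lam a))⁻¹ : ℂ)) * diagonal (fun a => (√(lam a) : ℂ)) = 1 := by
    rw [diagonal_mul_diagonal, ← diagonal_one]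
    congr 1
    ext a
    exact inv_mul_cancel₀ (by exact_mod_cast (hσ a).ne')
  have hd3 : diagonal (fun a => ((√(lam a))⁻¹ : ℂ)) * diagonal (fun a => (lam a : ℂ)) *
      diagonal (fun a => ((√(lam a))⁻¹ : ℂ)) = 1 := by
    rw [diagonal_mul_diagonal, diagonal_mul_diagonal, ← diagonal_one]
    congr 1
    ext a
    have h1 : (lam a : ℂ) = √(lam a) * √(lam a) := by
      rw [← Complex.ofReal_mul, Real.mul_self_sqrt (hlam a).le]
    have h2 : (√(lam a) : ℂ) ≠ 0 := by exact_mod_cast (hσ a).ne'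
    rw [h1]
    field_simp
  refine ⟨U, x * U * diagonal (fun a => ((√(lam a))⁻¹ : ℂ)), fun a => √(lam a), hU, ?_, hσ, ?_, ?_⟩
  · have h1 : (diagonal (fun a => ((√(lam a))⁻¹ : ℂ)))ᴴ =
        diagonal (fun a => ((√(lam a))⁻¹ : ℂ)) := by
      rw [diagonal_conjTranspose]
      congr 1
      ext a
      simp
    have h2 : Uᴴ * (xᴴ * x) * U = diagonal (fun a => (lam a : ℂ)) := by
      rw [hxU, unitaryDiagonal, ← Matrix.mul_assoc, ← Matrix.mul_assoc, hU, Matrix.one_mul,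
        Matrix.mul_assoc, hU, Matrix.mul_one]
    rw [conjTranspose_mul, conjTranspose_mul, h1, ← hd3, ← h2]
    simp only [Matrix.mul_assoc]
  · rw [Matrix.mul_assoc (x * U), hdd, Matrix.mul_one, Matrix.mul_assoc, hUU, Matrix.mul_one]
  · obtain ⟨C, η, hη, h⟩ := exists_abs_sum_sq_log_sub_le U hU lam hlam
    refine ⟨C, η, hη, fun y hy => ?_⟩
    obtain ⟨U', lam', hU', hyU', hlog', -⟩ := exists_logSingularSq_eq y
    have hc : (fun a => 4 * Real.log √(lam a) / √(lam a) ^ 2) =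
        fun a => 2 * Real.log (lam a) / lam a := by
      ext a
      rw [Real.sq_sqrt (hlam a).le, Real.log_sqrt (hlam a).le]
      ring
    rw [hc, hlog, hlog', hxU, hyU']
    rw [hxU, hyU'] at hy
    exact h U' lam' hU' hy

/-- Continuity at invertible matrices. At singular ones it fails, as `log 0 = 0`. -/
theorem continuousAt_logSingularSq {n : ℕ} (x : Matrix (Fin n) (Fin n) ℂ) (hx : IsUnit x) :
    ContinuousAt logSingularSq x := by
  obtain ⟨U, V, σ, -, -, -, -, C, η, hη, h⟩ := exists_svd_abs_logSingularSq_sub_le x hx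
  set G := unitaryDiagonal U (fun a => 4 * Real.log (σ a) / σ a ^ 2)
  have h1 : Continuous fun y : Matrix (Fin n) (Fin n) ℂ =>
      ((yᴴ * y - xᴴ * x) * (yᴴ * y - xᴴ * x)).trace.re := by fun_prop
  have h2 : Continuous fun y : Matrix (Fin n) (Fin n) ℂ =>
      (G * (yᴴ * y - xᴴ * x)).trace.re := by fun_prop
  have h3 : ∀ᶠ y in nhds x, ((yᴴ * y - xᴴ * x) * (yᴴ * y - xᴴ * x)).trace.re < η :=
    h1.continuousAt.eventually_lt continuousAt_const (by simpa using hη)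
  rw [ContinuousAt, tendsto_iff_norm_sub_tendsto_zero]
  have h4 : Continuous fun y : Matrix (Fin n) (Fin n) ℂ =>
      |(G * (yᴴ * y - xᴴ * x)).trace.re| +
        C * ((yᴴ * y - xᴴ * x) * (yᴴ * y - xᴴ * x)).trace.re := by fun_prop
  have h5 := h4.tendsto x
  simp only [sub_self, mul_zero, trace_zero, Complex.zero_re, abs_zero, add_zero] at h5
  refine squeeze_zero' (Filter.Eventually.of_forall fun y => norm_nonneg _) ?_ h5
  filter_upwards [h3] with y hy
  have h6 := h y hy
  rw [Real.norm_eq_abs]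
  have h7 := abs_sub_abs_le_abs_sub (logSingularSq y - logSingularSq x)
    (G * (yᴴ * y - xᴴ * x)).trace.re
  linarith

open scoped Matrix.Norms.Operator in
/-- The derivative of `yᴴ * y` for `y` running through the conjugates of `x` along the one-parameter
group `exp (t • Z)` with `Z` Hermitian. -/
theorem hasDerivAt_conj_exp {n : ℕ} (x Z : Matrix (Fin n) (Fin n) ℂ) (hZ : Zᴴ = Z) :
    HasDerivAt (fun t : ℝ => (NormedSpace.exp (t • Z) * x * NormedSpace.exp (t • -Z))ᴴ *
      (NormedSpace.exp (t • Z) * x * NormedSpace.exp (t • -Z)))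
      ((2 : ℂ) • (xᴴ * Z * x) - Z * (xᴴ * x) - xᴴ * x * Z) 0 := by
  have h1 : ∀ W : Matrix (Fin n) (Fin n) ℂ,
      HasDerivAt (fun t : ℝ => NormedSpace.exp (t • W)) W 0 := by
    intro W
    have h := hasDerivAt_exp_smul_const (𝕂 := ℝ) W 0
    rw [zero_smul, NormedSpace.exp_zero, one_mul] at h
    exact h
  have h2 : (fun t : ℝ => (NormedSpace.exp (t • Z) * x * NormedSpace.exp (t • -Z))ᴴ *
      (NormedSpace.exp (t • Z) * x * NormedSpace.exp (t • -Z))) = fun t : ℝ =>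
      (NormedSpace.exp (t • -Z) * xᴴ * NormedSpace.exp (t • Z)) *
      (NormedSpace.exp (t • Z) * x * NormedSpace.exp (t • -Z)) := by
    ext1 t
    rw [conjTranspose_mul, conjTranspose_mul, ← exp_conjTranspose, ← exp_conjTranspose,
      conjTranspose_smul, conjTranspose_smul, conjTranspose_neg, hZ, star_trivial, Matrix.mul_assoc]
    simp only [Matrix.mul_assoc]
  rw [h2]
  have h3 := (((h1 (-Z)).mul_const xᴴ).mul (h1 Z)).mul (((h1 Z).mul_const x).mul (h1 (-Z)))
  refine h3.congr_deriv ?_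
  simp only [Pi.mul_apply, zero_smul, NormedSpace.exp_zero, Matrix.one_mul, Matrix.mul_one,
    two_smul]
  noncomm_ring

/-- The first variation of `logSingularSq` along the one-parameter group `exp (t • Z)` of
conjugations, in terms of the singular value decomposition of `x`: up to a constant it is the trace
of `(log (x * xᴴ) - log (xᴴ * x)) * Z`. -/
theorem trace_unitaryDiagonal_mul_deriv {n : ℕ} {x Z U V : Matrix (Fin n) (Fin n) ℂ}
    {σ : Fin n → ℝ} (hU : Uᴴ * U = 1) (hV : Vᴴ * V = 1) (hσ : ∀ a, 0 < σ a)
    (hx : x = V * diagonal (fun a => (σ a : ℂ)) * Uᴴ) :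
    (unitaryDiagonal U (fun a => 4 * Real.log (σ a) / σ a ^ 2) *
      ((2 : ℂ) • (xᴴ * Z * x) - Z * (xᴴ * x) - xᴴ * x * Z)).trace =
    8 * ((unitaryDiagonal V (fun a => Real.log (σ a)) -
      unitaryDiagonal U (fun a => Real.log (σ a))) * Z).trace := by
  set G := unitaryDiagonal U (fun a => 4 * Real.log (σ a) / σ a ^ 2) with hG
  have hd : (diagonal (fun a => (σ a : ℂ)))ᴴ = diagonal (fun a => (σ a : ℂ)) := by
    rw [diagonal_conjTranspose]
    congr 1
    ext a
    simp
  have hS : xᴴ * x = unitaryDiagonal U (fun a => σ a ^ 2) := by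
    rw [hx, conjTranspose_mul, conjTranspose_mul, conjTranspose_conjTranspose, hd, unitaryDiagonal]
    simp only [Matrix.mul_assoc]
    rw [← Matrix.mul_assoc Vᴴ, hV, Matrix.one_mul, ← Matrix.mul_assoc (diagonal _) (diagonal _),
      diagonal_mul_diagonal]
    simp [sq]
  have hlog : ∀ W : Matrix (Fin n) (Fin n) ℂ, unitaryDiagonal W (fun a => 4 * Real.log (σ a)) =
      (4 : ℂ) • unitaryDiagonal W (fun a => Real.log (σ a)) := by
    intro W
    have h := unitaryDiagonal_smul W 4 (fun a => Real.log (σ a))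
    rw [Complex.ofReal_ofNat] at h
    exact h
  have h1 : G * (xᴴ * x) = (4 : ℂ) • unitaryDiagonal U (fun a => Real.log (σ a)) := by
    rw [hG, hS, unitaryDiagonal_mul_unitaryDiagonal hU, ← hlog]
    congr 1
    ext a
    have := (hσ a).ne'
    simp only [Pi.mul_apply]
    field_simp
  have h2 : xᴴ * x * G = (4 : ℂ) • unitaryDiagonal U (fun a => Real.log (σ a)) := by
    rw [hG, hS, unitaryDiagonal_mul_unitaryDiagonal hU, ← hlog]
    congr 1
    ext a
    have := (hσ a).ne'
    simp only [Pi.mul_apply]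
    field_simp
  have h3 : x * G * xᴴ = (4 : ℂ) • unitaryDiagonal V (fun a => Real.log (σ a)) := by
    rw [← hlog, hG, hx, unitaryDiagonal, unitaryDiagonal, conjTranspose_mul, conjTranspose_mul,
      conjTranspose_conjTranspose, hd]
    simp only [Matrix.mul_assoc]
    rw [← Matrix.mul_assoc Uᴴ, hU, Matrix.one_mul, ← Matrix.mul_assoc Uᴴ U, hU, Matrix.one_mul,
      ← Matrix.mul_assoc (diagonal _) (diagonal _), diagonal_mul_diagonal,
      ← Matrix.mul_assoc (diagonal _) (diagonal _), diagonal_mul_diagonal]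
    congr 3
    ext a
    have : (σ a : ℂ) ≠ 0 := by exact_mod_cast (hσ a).ne'
    push_cast
    field_simp
  have e1 : (G * (xᴴ * Z * x)).trace = ((x * G * xᴴ) * Z).trace := by
    rw [← Matrix.mul_assoc, trace_mul_comm]
    simp only [Matrix.mul_assoc]
  have e2 : (G * (Z * (xᴴ * x))).trace = ((xᴴ * x * G) * Z).trace := by
    rw [← Matrix.mul_assoc, trace_mul_comm]
    simp only [Matrix.mul_assoc]
  rw [mul_sub, mul_sub, trace_sub, trace_sub, Matrix.mul_smul, trace_smul, e1, e2,
    ← Matrix.mul_assoc, h1, h2, h3, sub_mul, trace_sub]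
  simp only [Matrix.smul_mul, trace_smul, smul_eq_mul]
  ring

open scoped ComplexOrder in
/-- At a minimum of the sum of `logSingularSq (x l)` over a simultaneous conjugacy class, the sum of
`log (x l * (x l)ᴴ) - log ((x l)ᴴ * x l)` vanishes. -/
theorem sum_log_eq_zero_of_forall_le {n m : ℕ} (x : Fin m → Matrix (Fin n) (Fin n) ℂ)
    (hx : ∀ l, IsUnit (x l))
    (hmin : ∀ g h : Matrix (Fin n) (Fin n) ℂ, g * h = 1 →
      ∑ l, logSingularSq (x l) ≤ ∑ l, logSingularSq (g * x l * h)) :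
    ∃ (U V : Fin m → Matrix (Fin n) (Fin n) ℂ) (σ : Fin m → Fin n → ℝ),
      (∀ l, (U l)ᴴ * U l = 1) ∧ (∀ l, (V l)ᴴ * V l = 1) ∧ (∀ l a, 0 < σ l a) ∧
      (∀ l, x l = V l * diagonal (fun a => (σ l a : ℂ)) * (U l)ᴴ) ∧
      ∑ l, (unitaryDiagonal (V l) (fun a => Real.log (σ l a)) -
        unitaryDiagonal (U l) (fun a => Real.log (σ l a))) = 0 := by
  choose U V σ hU hV hσ hxl C η hη hest using fun l =>
    exists_svd_abs_logSingularSq_sub_le (x l) (hx l)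
  refine ⟨U, V, σ, hU, hV, hσ, hxl, ?_⟩
  set M := ∑ l, (unitaryDiagonal (V l) (fun a => Real.log (σ l a)) -
        unitaryDiagonal (U l) (fun a => Real.log (σ l a))) with hM
  have hMH : Mᴴ = M := by
    rw [hM, conjTranspose_sum]
    exact Finset.sum_congr rfl fun l _ => by
      rw [conjTranspose_sub, isHermitian_unitaryDiagonal, isHermitian_unitaryDiagonal]
  set G := fun l => unitaryDiagonal (U l) (fun a => 4 * Real.log (σ l a) / σ l a ^ 2) with hG
  -- the first variation in the direction of the Hermitian matrix `M` itself is `8 * tr (M * M)`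
  -- the conjugates of `x` along a one-parameter group in the direction of `M`
  let X : Fin m → ℝ → Matrix (Fin n) (Fin n) ℂ := fun l t =>
    NormedSpace.exp (t • M) * x l * NormedSpace.exp (t • -M)
  let Δ : Fin m → ℝ → Matrix (Fin n) (Fin n) ℂ := fun l t => (X l t)ᴴ * X l t - (x l)ᴴ * x l
  have hX0 : ∀ l, X l 0 = x l := fun l => by simp [X]
  have hΔ0 : ∀ l, Δ l 0 = 0 := fun l => by simp [Δ, hX0]
  let D : Fin m → Matrix (Fin n) (Fin n) ℂ := fun l =>
    (2 : ℂ) • ((x l)ᴴ * M * x l) - M * ((x l)ᴴ * x l) - (x l)ᴴ * x l * M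
  let ψ : ℝ → ℝ := fun t => ∑ l, ((G l * Δ l t).trace.re + C l * (Δ l t * Δ l t).trace.re)
  have hψ : HasDerivAt ψ (∑ l, (G l * D l).trace.re) 0 := by
    open scoped Matrix.Norms.Operator in
    have hΔ : ∀ l, HasDerivAt (Δ l) (D l) 0 := fun l =>
      (hasDerivAt_conj_exp (x l) M hMH).sub_const _
    let L : Matrix (Fin n) (Fin n) ℂ →L[ℝ] ℝ :=
      Complex.reCLM.comp (traceLinearMap (Fin n) ℝ ℂ).toContinuousLinearMap
    refine HasDerivAt.fun_sum fun l _ => ?_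
    have h1 := L.hasFDerivAt.comp_hasDerivAt 0 ((hΔ l).const_mul (G l))
    have h2 := L.hasFDerivAt.comp_hasDerivAt 0 ((hΔ l).mul (hΔ l))
    refine (h1.add (h2.const_mul (C l))).congr_deriv ?_
    rw [hΔ0, mul_zero, zero_mul, add_zero]
    have hL0 : C l * L 0 = 0 := by rw [L.map_zero, mul_zero]
    exact (congrArg ((G l * D l).trace.re + ·) hL0).trans (add_zero _)
  have hΔc : ∀ l, ContinuousAt (Δ l) 0 := by
    open scoped Matrix.Norms.Operator in
    exact fun l => ((hasDerivAt_conj_exp (x l) M hMH).sub_const ((x l)ᴴ * x l)).continuousAt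
  have hmin0 : IsLocalMin ψ 0 := by
    have hev : ∀ᶠ t in nhds (0 : ℝ), ∀ l, (Δ l t * Δ l t).trace.re < η l := by
      rw [Filter.eventually_all]
      intro l
      have hc : ContinuousAt (fun t => (Δ l t * Δ l t).trace.re) 0 := by
        have : Continuous fun A : Matrix (Fin n) (Fin n) ℂ => (A * A).trace.re := by fun_prop
        exact this.continuousAt.comp (hΔc l)
      exact hc.eventually_lt continuousAt_const (by simpa [hΔ0] using hη l)
    filter_upwards [hev] with t ht
    have h0 : ψ 0 = 0 := by simp [ψ, hΔ0]
    -- `ψ` is differentiable and lies above the increment of the sum of `logSingularSq`, so that it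
    -- inherits the minimum without any differentiability of eigenvalues
    have h1 : ∑ l, (logSingularSq (X l t) - logSingularSq (x l)) ≤ ψ t :=
      Finset.sum_le_sum fun l _ => by
        have := (abs_le.1 (hest l (X l t) (ht l))).2
        linarith
    have h2 := hmin (NormedSpace.exp (t • M)) (NormedSpace.exp (t • -M)) (by
      rw [smul_neg, Matrix.exp_neg]
      exact Matrix.mul_nonsing_inv _ ((Matrix.isUnit_iff_isUnit_det _).1 (Matrix.isUnit_exp _)))
    rw [Finset.sum_sub_distrib] at h1
    rw [h0]
    change _ ≤ ∑ l, logSingularSq (X l t) at h2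
    linarith
  have hzero := hmin0.hasDerivAt_eq_zero hψ
  have h8 : ∑ l, (G l * D l).trace = 8 * (M * M).trace := by
    simp_rw [G, D, trace_unitaryDiagonal_mul_deriv (hU _) (hV _) (hσ _) (hxl _)]
    rw [← Finset.mul_sum, ← trace_sum, ← Finset.sum_mul]
  have h9 : (Mᴴ * M).trace = 0 := by
    have hre : (Mᴴ * M).trace.re = 0 := by
      rw [hMH]
      have := congrArg Complex.re h8
      rw [Complex.re_sum, hzero] at this
      simpa using this
    refine Complex.ext hre ?_
    have := trace_conjTranspose (Mᴴ * M)
    rw [conjTranspose_mul, conjTranspose_conjTranspose] at this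
    exact Complex.conj_eq_iff_im.1 this.symm
  exact trace_conjTranspose_mul_self_eq_zero_iff.1 h9

/-! ### Stable complements for conjugation by a critical tuple -/

/-- The entries of a matrix, as a vector of a Hermitian space: the norm on the right is the
Frobenius norm. -/
noncomputable def matrixToEuclidean (n : ℕ) :
    Matrix (Fin n) (Fin n) ℂ ≃ₗ[ℂ] EuclideanSpace ℂ (Fin n × Fin n) :=
  (Matrix.ofLinearEquiv ℂ).symm ≪≫ₗ (LinearEquiv.curry ℂ ℂ (Fin n) (Fin n)).symm ≪≫ₗ
    (WithLp.linearEquiv 2 ℂ (Fin n × Fin n → ℂ)).symm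

theorem inner_matrixToEuclidean {n : ℕ} (A B : Matrix (Fin n) (Fin n) ℂ) :
    inner ℂ (matrixToEuclidean n A) (matrixToEuclidean n B) = (Aᴴ * B).trace := by
  rw [PiLp.inner_apply, Fintype.sum_prod_type, Finset.sum_comm, trace]
  refine Finset.sum_congr rfl fun j _ => ?_
  rw [diag_apply, Matrix.mul_apply]
  refine Finset.sum_congr rfl fun i _ => ?_
  rw [RCLike.inner_apply, mul_comm]
  rfl

/-- For unitary `W`, conjugation by `W` is an isometry of the Frobenius norm, so it takes the matrix
units to an orthonormal basis. -/
theorem exists_orthonormalBasis_conj_single {n : ℕ} (W : Matrix (Fin n) (Fin n) ℂ)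
    (hW : Wᴴ * W = 1) :
    ∃ b : OrthonormalBasis (Fin n × Fin n) ℂ (EuclideanSpace ℂ (Fin n × Fin n)),
      ∀ a c, b (a, c) = matrixToEuclidean n (W * single a c 1 * Wᴴ) := by
  have hin : ∀ p q : Fin n × Fin n, inner ℂ (matrixToEuclidean n (W * single p.1 p.2 1 * Wᴴ))
      (matrixToEuclidean n (W * single q.1 q.2 1 * Wᴴ)) = if p = q then 1 else 0 := by
    rintro ⟨a, b⟩ ⟨c, d⟩
    have h : (W * single a b (1 : ℂ) * Wᴴ)ᴴ * (W * single c d 1 * Wᴴ) =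
        W * (single b a 1 * single c d 1) * Wᴴ := by
      rw [conjTranspose_mul, conjTranspose_mul, conjTranspose_conjTranspose,
        conjTranspose_single, star_one]
      simp only [Matrix.mul_assoc]
      rw [← Matrix.mul_assoc Wᴴ W, hW, Matrix.one_mul]
    rw [inner_matrixToEuclidean, h, trace_mul_comm, ← Matrix.mul_assoc, hW, Matrix.one_mul]
    by_cases hac : a = c
    · subst hac
      rw [single_mul_single_same]
      by_cases hbd : b = d
      · subst hbd
        simp
      · rw [trace_single_eq_of_ne _ _ _ hbd, if_neg (by simpa using hbd)]
    · rw [single_mul_single_of_ne _ _ _ _ hac, trace_zero,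
        if_neg (fun h => hac (congrArg Prod.fst h))]
  have hon : Orthonormal ℂ fun p : Fin n × Fin n =>
      matrixToEuclidean n (W * single p.1 p.2 1 * Wᴴ) := by
    rw [orthonormal_iff_ite]
    exact hin
  obtain ⟨b, hb⟩ := Orthonormal.exists_orthonormalBasis_extension_of_card_eq (s := Set.univ)
    (v := fun p : Fin n × Fin n => matrixToEuclidean n (W * single p.1 p.2 1 * Wᴴ))
    (by simp) (Orthonormal.comp hon _ Subtype.val_injective)
  exact ⟨b, fun a c => hb (a, c) trivial⟩

theorem diagonal_mul_single_one {n : ℕ} (d : Fin n → ℂ) (a c : Fin n) :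
    diagonal d * single a c 1 = d a • single a c 1 := by
  ext i j
  by_cases h : a = i ∧ c = j
  · obtain ⟨rfl, rfl⟩ := h
    simp
  · simp [diagonal_mul, h]

theorem single_one_mul_diagonal {n : ℕ} (d : Fin n → ℂ) (a c : Fin n) :
    single a c 1 * diagonal d = d c • single a c 1 := by
  ext i j
  by_cases h : a = i ∧ c = j
  · obtain ⟨rfl, rfl⟩ := h
    simp
  · simp [mul_diagonal, h]

/-- If the sum of `log (x l * (x l)ᴴ) - log ((x l)ᴴ * x l)` vanishes, then the orthogonal complement
of a subspace of matrices that is stable under conjugation by the `x l` is stable, too. -/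
theorem exists_isCompl_conj_stable_of_sum_log_eq_zero {n m : ℕ}
    (x z U V : Fin m → Matrix (Fin n) (Fin n) ℂ) (σ : Fin m → Fin n → ℝ)
    (hxz : ∀ l, x l * z l = 1)
    (hU : ∀ l, (U l)ᴴ * U l = 1) (hV : ∀ l, (V l)ᴴ * V l = 1) (hσ : ∀ l a, 0 < σ l a)
    (hx : ∀ l, x l = V l * diagonal (fun a => (σ l a : ℂ)) * (U l)ᴴ)
    (hsum : ∑ l, (unitaryDiagonal (V l) (fun a => Real.log (σ l a)) -
      unitaryDiagonal (U l) (fun a => Real.log (σ l a))) = 0)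
    (W : Submodule ℂ (Matrix (Fin n) (Fin n) ℂ))
    (hW : ∀ l, ∀ Y ∈ W, x l * Y * z l ∈ W) :
    ∃ W' : Submodule ℂ (Matrix (Fin n) (Fin n) ℂ), IsCompl W W' ∧
      ∀ l, ∀ Y ∈ W', x l * Y * z l ∈ W' := by
  set ν := matrixToEuclidean n
  set W₁ := W.map ν.toLinearMap with hW₁
  set P := W₁.starProjection with hP
  -- conjugation by `x l`, and its singular value decomposition
  let y : Fin m → EuclideanSpace ℂ (Fin n × Fin n) →ₗ[ℂ] EuclideanSpace ℂ (Fin n × Fin n) :=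
    fun l => ν.toLinearMap ∘ₗ (LinearMap.mulRight ℂ (z l) ∘ₗ LinearMap.mulLeft ℂ (x l)) ∘ₗ
      ν.symm.toLinearMap
  have hy : ∀ l Y, y l (ν Y) = ν (x l * Y * z l) := fun l Y => by simp [y]
  choose e he using fun l => exists_orthonormalBasis_conj_single (U l) (hU l)
  choose f hf using fun l => exists_orthonormalBasis_conj_single (V l) (hV l)
  have hz : ∀ l, z l = U l * diagonal (fun a => ((σ l a)⁻¹ : ℂ)) * (V l)ᴴ := by
    intro l
    have h1 : x l * (U l * diagonal (fun a => ((σ l a)⁻¹ : ℂ)) * (V l)ᴴ) = 1 := by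
      have hd : diagonal (fun a => (σ l a : ℂ)) * diagonal (fun a => ((σ l a)⁻¹ : ℂ)) = 1 := by
        rw [diagonal_mul_diagonal, ← diagonal_one]
        congr 1
        ext a
        exact mul_inv_cancel₀ (by exact_mod_cast (hσ l a).ne')
      rw [hx]
      simp only [Matrix.mul_assoc]
      rw [← Matrix.mul_assoc (U l)ᴴ, hU, Matrix.one_mul, ← Matrix.mul_assoc (diagonal _), hd,
        Matrix.one_mul]
      exact mul_eq_one_comm.1 (hV l)
    have h2 : z l * x l = 1 := mul_eq_one_comm.1 (hxz l)
    calc z l = z l * (x l * (U l * diagonal (fun a => ((σ l a)⁻¹ : ℂ)) * (V l)ᴴ)) := by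
          rw [h1, Matrix.mul_one]
      _ = _ := by rw [← Matrix.mul_assoc, h2, Matrix.one_mul]
  have hsvd : ∀ l p, y l (e l p) = ((σ l p.1 / σ l p.2 : ℝ) : ℂ) • f l p := by
    rintro l ⟨a, c⟩
    have hdd : diagonal (fun a => (σ l a : ℂ)) * single a c 1 *
        diagonal (fun a => ((σ l a)⁻¹ : ℂ)) = ((σ l a / σ l c : ℝ) : ℂ) • single a c 1 := by
      rw [diagonal_mul_single_one, Matrix.smul_mul, single_one_mul_diagonal, smul_smul]
      simp [div_eq_mul_inv]
    rw [he, hf, hy, ← map_smul, ← Matrix.smul_mul, ← Matrix.mul_smul, ← hdd]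
    congr 1
    rw [hz, hx]
    simp only [Matrix.mul_assoc]
    rw [← Matrix.mul_assoc (U l)ᴴ, hU, Matrix.one_mul, ← Matrix.mul_assoc (U l)ᴴ, hU,
      Matrix.one_mul]
  have hst : ∀ l, W₁ ≤ W₁.comap (y l) := by
    rintro l _ ⟨Y, hY, rfl⟩
    exact ⟨_, hW l Y hY, (hy l Y).symm⟩
  -- the trace of the composition of `P` with the commutator with `Y`, which is linear in `Y`
  let τ : Matrix (Fin n) (Fin n) ℂ →ₗ[ℂ] ℂ :=
    LinearMap.trace ℂ (EuclideanSpace ℂ (Fin n × Fin n)) ∘ₗ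
      { toFun := fun Y => P.toLinearMap ∘ₗ ν.toLinearMap ∘ₗ
          (LinearMap.mulLeft ℂ Y - LinearMap.mulRight ℂ Y) ∘ₗ ν.symm.toLinearMap
        map_add' := fun Y Y' => by
          ext1 t
          simp only [LinearMap.comp_apply, LinearMap.sub_apply, LinearMap.mulLeft_apply,
            LinearMap.mulRight_apply, LinearMap.add_apply, add_mul, mul_add, map_add, map_sub]
          abel
        map_smul' := fun r Y => by
          ext1 t
          simp [smul_sub] }
  have hτ : ∀ (Q : Matrix (Fin n) (Fin n) ℂ) (hQ : Qᴴ * Q = 1)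
      (b : OrthonormalBasis (Fin n × Fin n) ℂ (EuclideanSpace ℂ (Fin n × Fin n)))
      (hb : ∀ a c, b (a, c) = ν (Q * single a c 1 * Qᴴ)) (ℓ : Fin n → ℝ),
      τ (unitaryDiagonal Q ℓ) = ((∑ p, (ℓ p.1 - ℓ p.2) * ‖P (b p)‖ ^ 2 : ℝ) : ℂ) := by
    intro Q hQ b hb ℓ
    have h1 : ∀ a c, unitaryDiagonal Q ℓ * (Q * single a c 1 * Qᴴ) -
        (Q * single a c 1 * Qᴴ) * unitaryDiagonal Q ℓ =
        ((ℓ a - ℓ c : ℝ) : ℂ) • (Q * single a c 1 * Qᴴ) := by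
      intro a c
      have hdd : diagonal (fun a => (ℓ a : ℂ)) * single a c 1 -
          single a c 1 * diagonal (fun a => (ℓ a : ℂ)) = ((ℓ a - ℓ c : ℝ) : ℂ) • single a c 1 := by
        rw [diagonal_mul_single_one, single_one_mul_diagonal, ← sub_smul, Complex.ofReal_sub]
      rw [← Matrix.smul_mul, ← Matrix.mul_smul, ← hdd, unitaryDiagonal, mul_sub, sub_mul]
      simp only [Matrix.mul_assoc]
      rw [← Matrix.mul_assoc Qᴴ, hQ, Matrix.one_mul, ← Matrix.mul_assoc Qᴴ Q, hQ, Matrix.one_mul]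
    rw [LinearMap.comp_apply, LinearMap.trace_eq_sum_inner _ b]
    push_cast
    refine Finset.sum_congr rfl ?_
    rintro ⟨a, c⟩ -
    have h2 : ν (unitaryDiagonal Q ℓ * ν.symm (b (a, c)) - ν.symm (b (a, c)) *
        unitaryDiagonal Q ℓ) = ((ℓ a - ℓ c : ℝ) : ℂ) • b (a, c) := by
      rw [hb, LinearEquiv.symm_apply_apply, h1, map_smul]
    have h3 : inner ℂ (b (a, c)) (P (b (a, c))) = ((‖P (b (a, c))‖ ^ 2 : ℝ) : ℂ) := by
      have h4 : P (b (a, c)) = P (P (b (a, c))) :=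
        (Submodule.starProjection_eq_self_iff.2 (Submodule.starProjection_apply_mem _ _)).symm
      conv_lhs => rw [h4]
      rw [← Submodule.inner_starProjection_left_eq_right, inner_self_eq_norm_sq_to_K]
      push_cast
      rfl
    change inner ℂ (b (a, c)) (P (ν (unitaryDiagonal Q ℓ * ν.symm (b (a, c)) -
      ν.symm (b (a, c)) * unitaryDiagonal Q ℓ))) = _
    rw [h2, map_smul, inner_smul_right, h3]
    push_cast
    rfl
  have hkey := fun l => sum_log_mul_normSq_starProjection (e l) (f l)
    (fun p => σ l p.1 / σ l p.2) (fun p => div_pos (hσ l _) (hσ l _)) (y l) (hsvd l) W₁ (hst l)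
  have htot : ∑ l, ∑ p : Fin n × Fin n, Real.log (σ l p.1 / σ l p.2) *
      (‖W₁.starProjection (f l p)‖ ^ 2 - ‖W₁.starProjection (e l p)‖ ^ 2) = 0 := by
    have h5 := congrArg τ hsum
    rw [map_sum, map_zero] at h5
    simp_rw [map_sub, hτ (V _) (hV _) (f _) (hf _), hτ (U _) (hU _) (e _) (he _)] at h5
    have h6 := congrArg Complex.re h5
    simp only [Complex.re_sum, Complex.sub_re, Complex.ofReal_re, Complex.zero_re] at h6
    rw [← h6]
    refine Finset.sum_congr rfl fun l _ => ?_
    rw [← Finset.sum_sub_distrib]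
    refine Finset.sum_congr rfl fun p _ => ?_
    rw [Real.log_div (hσ l _).ne' (hσ l _).ne']
    ring
  have hzero := (Finset.sum_eq_zero_iff_of_nonneg fun l _ => (hkey l).1).1 htot
  refine ⟨W₁ᗮ.comap ν.toLinearMap, ?_, fun l Y hY => ?_⟩
  · have h7 : W = W₁.comap ν.toLinearMap :=
      (Submodule.comap_map_eq_of_injective ν.injective W).symm
    have h8 : IsCompl W₁ W₁ᗮ := Submodule.isCompl_orthogonal W₁
    conv_lhs => rw [h7]
    exact (Submodule.orderIsoMapComap ν).symm.isCompl h8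
  · have h9 := (hkey l).2 (hzero l (Finset.mem_univ _)) hY
    rw [Submodule.mem_comap] at h9
    rw [Submodule.mem_comap]
    exact (hy l Y) ▸ h9

/-! ### Semisimple tuples and separability idempotents -/

/-- A tuple of square matrices is semisimple if every subspace that is stable under all of them has
a complement with this property. -/
def IsSemisimpleTuple {K : Type*} [Field K] {n m : ℕ}
    (x : Fin m → Matrix (Fin n) (Fin n) K) : Prop :=
  ∀ W : Submodule K (Fin n → K), (∀ l, ∀ v ∈ W, x l *ᵥ v ∈ W) →
    ∃ W' : Submodule K (Fin n → K), IsCompl W W' ∧ ∀ l, ∀ v ∈ W', x l *ᵥ v ∈ W'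

/-- The value of a word at a tuple of matrices. -/
def wordEval {R : Type*} [CommRing R] {n m : ℕ} (x : Fin m → Matrix (Fin n) (Fin n) R) :
    FreeMonoid (Fin m) →* Matrix (Fin n) (Fin n) R :=
  FreeMonoid.lift x

/-- The finite sum `∑ c p • p.1 ⊗ p.2` over pairs of words `p` gives a separability idempotent of
the algebra generated by the tuple `x`: its product is `1`, and the two outer multiplications with
an element of the algebra agree on it. -/
structure IsSeparabilityElement {F : Type*} [Field F] {n m : ℕ}
    (x : Fin m → Matrix (Fin n) (Fin n) F)
    (s : Finset (FreeMonoid (Fin m) × FreeMonoid (Fin m)))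
    (c : FreeMonoid (Fin m) × FreeMonoid (Fin m) → F) : Prop where
  sum_mul : ∑ p ∈ s, c p • (wordEval x p.1 * wordEval x p.2) = 1
  mul_sum : ∀ l M, x l * ∑ p ∈ s, c p • (wordEval x p.1 * M * wordEval x p.2) =
    (∑ p ∈ s, c p • (wordEval x p.1 * M * wordEval x p.2)) * x l

open TensorProduct in
/-- A finite product of matrix algebras has a separability idempotent: the sum of the tensors
`E i a 0 ⊗ E i 0 a` of matrix units of the `i`-th factor. -/
theorem exists_separabilityIdempotent {K A : Type*} [Field K] [Ring A] [Algebra K A] {r : ℕ}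
    {d : Fin r → ℕ} [∀ i, NeZero (d i)]
    (φ : A ≃ₐ[K] Π i, Matrix (Fin (d i)) (Fin (d i)) K) :
    ∃ e : A ⊗[K] A, LinearMap.mul' K A e = 1 ∧ ∀ y : A,
      TensorProduct.map (LinearMap.mulLeft K y) LinearMap.id e =
        TensorProduct.map LinearMap.id (LinearMap.mulRight K y) e := by
  let E : ∀ i, Fin (d i) → Fin (d i) → A := fun i a b => φ.symm (Pi.single i (single a b 1))
  have hEE : ∀ i a, E i a 0 * E i 0 a = φ.symm (Pi.single i (single a a 1)) := by
    intro i a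
    rw [← map_mul, ← Pi.single_mul, single_mul_single_same, one_mul]
  have hleft : ∀ y i a, y * E i a 0 = ∑ b, φ y i b a • E i b 0 := by
    intro y i a
    apply φ.injective
    simp_rw [map_mul, map_sum, map_smul, E, AlgEquiv.apply_symm_apply]
    ext j p q
    rw [Finset.sum_apply]
    by_cases hj : j = i
    · subst hj
      simp only [Pi.mul_apply, Pi.single_eq_same, Pi.smul_apply]
      rw [Matrix.sum_apply]
      by_cases hq : q = 0
      · subst hq
        simp [single_apply]
      · rw [mul_single_apply_of_ne _ _ _ _ _ hq, Finset.sum_eq_zero]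
        intro b _
        simp [Ne.symm hq]
    · simp [Pi.single_eq_of_ne hj]
  have hright : ∀ y i a, E i 0 a * y = ∑ b, φ y i a b • E i 0 b := by
    intro y i a
    apply φ.injective
    simp_rw [map_mul, map_sum, map_smul, E, AlgEquiv.apply_symm_apply]
    ext j p q
    rw [Finset.sum_apply]
    by_cases hj : j = i
    · subst hj
      simp only [Pi.mul_apply, Pi.single_eq_same, Pi.smul_apply]
      rw [Matrix.sum_apply]
      by_cases hp : p = 0
      · subst hp
        simp [single_apply]
      · rw [single_mul_apply_of_ne _ _ _ _ _ hp, Finset.sum_eq_zero]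
        intro b _
        simp [Ne.symm hp]
    · simp [Pi.single_eq_of_ne hj]
  refine ⟨∑ i, ∑ a, E i a 0 ⊗ₜ E i 0 a, ?_, fun y => ?_⟩
  · simp_rw [map_sum, LinearMap.mul'_apply, hEE]
    apply φ.injective
    simp_rw [map_sum, AlgEquiv.apply_symm_apply, map_one]
    ext j p q
    rw [Finset.sum_apply, Finset.sum_eq_single j]
    · rw [Finset.sum_apply]
      simp_rw [Pi.single_eq_same]
      rw [Matrix.sum_apply, Pi.one_apply]
      by_cases hpq : p = q
      · subst hpq
        simp [single_apply]
      · rw [one_apply_ne hpq]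
        exact Finset.sum_eq_zero fun a _ => by
          rw [single_apply, if_neg (fun h => hpq (h.1.symm.trans h.2))]
    · intro i _ hi
      rw [Finset.sum_apply]
      exact Finset.sum_eq_zero fun a _ => by rw [Pi.single_eq_of_ne hi.symm]
    · simp
  · simp_rw [map_sum, TensorProduct.map_tmul, LinearMap.mulLeft_apply, LinearMap.mulRight_apply,
      LinearMap.id_apply, hleft, hright, TensorProduct.sum_tmul, TensorProduct.tmul_sum,
      TensorProduct.smul_tmul, TensorProduct.tmul_smul]
    refine Finset.sum_congr rfl fun i _ => ?_
    rw [Finset.sum_comm]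

theorem wordEval_of {R : Type*} [CommRing R] {n m : ℕ} (x : Fin m → Matrix (Fin n) (Fin n) R)
    (l : Fin m) : wordEval x (FreeMonoid.of l) = x l := by
  simp [wordEval]

open TensorProduct in
/-- The algebra generated by a semisimple tuple over an algebraically closed field is a product of
matrix algebras, by Wedderburn's theorem, and it is spanned by the words in the tuple. -/
theorem IsSemisimpleTuple.exists_isSeparabilityElement {K : Type*} [Field K] [IsAlgClosed K]
    {n m : ℕ} {x : Fin m → Matrix (Fin n) (Fin n) K} (hx : IsSemisimpleTuple x) :
    ∃ s c, IsSeparabilityElement x s c := by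
  let S : Set (Module.End K (Fin n → K)) := Set.range fun l => Matrix.toLin' (x l)
  let A : Subalgebra K (Module.End K (Fin n → K)) := Algebra.adjoin K S
  have hss : IsSemisimpleModule A (Fin n → K) := by
    rw [isSemisimpleModule_iff]
    refine ⟨fun N => ?_⟩
    have hmem : ∀ l, Matrix.toLin' (x l) ∈ A := fun l => Algebra.subset_adjoin ⟨l, rfl⟩
    obtain ⟨W', hc, hW'⟩ := hx (N.restrictScalars K) fun l v hv =>
      N.smul_mem (⟨_, hmem l⟩ : A) hv
    have hst : ∀ a ∈ A, ∀ v ∈ W', a v ∈ W' := by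
      intro a ha
      induction ha using Algebra.adjoin_induction with
      | mem a h =>
        obtain ⟨l, rfl⟩ := h
        exact fun v hv => hW' l v hv
      | algebraMap r => exact fun v hv => W'.smul_mem r hv
      | add a b _ _ ha hb => exact fun v hv => W'.add_mem (ha v hv) (hb v hv)
      | mul a b _ _ ha hb => exact fun v hv => ha _ (hb v hv)
    refine ⟨{ W' with smul_mem' := fun a v hv => hst a a.2 v hv }, ?_⟩
    rw [isCompl_iff, disjoint_iff, codisjoint_iff] at hc ⊢
    constructor
    · ext v
      have := SetLike.ext_iff.1 hc.1 v
      simpa using this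
    · ext v
      have := SetLike.ext_iff.1 hc.2 v
      simp only [Submodule.mem_sup, Submodule.mem_top] at this ⊢
      exact this
  -- the algebra embeds in a power of the semisimple module `K ^ n`
  have hring : IsSemisimpleRing A := by
    let ι : A →ₗ[A] (Fin n → (Fin n → K)) :=
      { toFun := fun a i => (a : Module.End K (Fin n → K)) (Pi.single i 1)
        map_add' := fun a b => rfl
        map_smul' := fun a b => rfl }
    refine IsSemisimpleModule.of_injective ι fun a b hab => Subtype.ext ?_
    exact LinearMap.pi_ext' fun i => LinearMap.ext_ring (congrFun hab i)
  obtain ⟨r, d, hd, ⟨φ⟩⟩ := IsSemisimpleRing.exists_algEquiv_pi_matrix_of_isAlgClosed K A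
  obtain ⟨e, he1, he2⟩ := exists_separabilityIdempotent (K := K) (A := A) (d := d) φ
  -- the words in the generators span the algebra
  let toM : A →ₗ[K] Matrix (Fin n) (Fin n) K := LinearMap.toMatrix'.toLinearMap ∘ₗ A.val.toLinearMap
  have hword : ∀ w, Matrix.toLin' (wordEval x w) ∈ A := by
    intro w
    induction w using FreeMonoid.inductionOn' with
    | one => rw [map_one, Matrix.toLin'_one]; exact A.one_mem
    | of_mul l w ih =>
      rw [map_mul, wordEval_of, Matrix.toLin'_mul]
      exact A.mul_mem (Algebra.subset_adjoin ⟨l, rfl⟩) ih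
  let W : FreeMonoid (Fin m) → A := fun w => ⟨_, hword w⟩
  have hWM : ∀ w, toM (W w) = wordEval x w := fun w => LinearMap.toMatrix'_toLin' _
  have hWmul : ∀ v w, W (v * w) = W v * W w := fun v w => Subtype.ext (by
    change Matrix.toLin' (wordEval x (v * w)) = _
    rw [map_mul, Matrix.toLin'_mul]
    rfl)
  have hspan : ∀ a : A, a ∈ Submodule.span K (Set.range W) := by
    rintro ⟨a, ha⟩
    induction ha using Algebra.adjoin_induction with
    | mem a h =>
      obtain ⟨l, rfl⟩ := h
      refine Submodule.subset_span ⟨FreeMonoid.of l, Subtype.ext ?_⟩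
      change Matrix.toLin' (wordEval x _) = _
      rw [wordEval_of]
    | algebraMap r =>
      have h1 : (1 : A) ∈ Submodule.span K (Set.range W) := Submodule.subset_span ⟨1, Subtype.ext
        (by change Matrix.toLin' (wordEval x _) = _; rw [map_one, Matrix.toLin'_one]; rfl)⟩
      have h2 := Submodule.smul_mem _ r h1
      rwa [← Algebra.algebraMap_eq_smul_one] at h2
    | add a b ha hb iha ihb => exact Submodule.add_mem _ iha ihb
    | mul a b ha hb iha ihb =>
      have h3 := Submodule.mul_mem_mul iha ihb
      rw [Submodule.span_mul_span] at h3
      refine Submodule.span_mono ?_ h3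
      rintro _ ⟨_, ⟨v, rfl⟩, _, ⟨w, rfl⟩, rfl⟩
      exact ⟨v * w, hWmul v w⟩
  have hspan2 : e ∈ Submodule.span K (Set.range
      fun p : FreeMonoid (Fin m) × FreeMonoid (Fin m) => W p.1 ⊗ₜ[K] W p.2) := by
    clear he1 he2
    induction e with
    | zero => exact Submodule.zero_mem _
    | add a b ha hb => exact Submodule.add_mem _ ha hb
    | tmul a b =>
      have ha := hspan a
      induction ha using Submodule.span_induction with
      | mem a h =>
        obtain ⟨v, rfl⟩ := h
        have hb := hspan b
        induction hb using Submodule.span_induction with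
        | mem b h =>
          obtain ⟨w, rfl⟩ := h
          exact Submodule.subset_span ⟨(v, w), rfl⟩
        | zero => rw [TensorProduct.tmul_zero]; exact Submodule.zero_mem _
        | add b b' _ _ h h' => rw [TensorProduct.tmul_add]; exact Submodule.add_mem _ h h'
        | smul r b _ h => rw [TensorProduct.tmul_smul]; exact Submodule.smul_mem _ _ h
      | zero => rw [TensorProduct.zero_tmul]; exact Submodule.zero_mem _
      | add b b' _ _ h h' => rw [TensorProduct.add_tmul]; exact Submodule.add_mem _ h h'
      | smul r b _ h => rw [← TensorProduct.smul_tmul']; exact Submodule.smul_mem _ _ h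
  obtain ⟨c, hc⟩ := (Finsupp.mem_span_range_iff_exists_finsupp).1 hspan2
  refine ⟨c.support, c, ?_, fun l M => ?_⟩
  · rw [← hc, Finsupp.sum, map_sum] at he1
    have h4 := congrArg toM he1
    rw [map_sum] at h4
    have h5 : toM 1 = 1 := LinearMap.toMatrix'_one
    rw [h5] at h4
    rw [← h4]
    refine Finset.sum_congr rfl fun p _ => ?_
    rw [map_smul, map_smul, LinearMap.mul'_apply, ← hWmul, hWM, map_mul]
  · have h6 := he2 (W (FreeMonoid.of l))
    rw [← hc, Finsupp.sum, map_sum, map_sum] at h6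
    -- apply the linear map that sends `a ⊗ b` to the matrix `a * M * b`
    let β : A ⊗[K] A →ₗ[K] Matrix (Fin n) (Fin n) K :=
      TensorProduct.lift (((LinearMap.mul K (Matrix (Fin n) (Fin n) K)).compl₁₂
        (LinearMap.mulRight K M ∘ₗ toM) toM))
    have hβ : ∀ a b, β (a ⊗ₜ b) = toM a * M * toM b := fun a b => rfl
    have h7 := congrArg β h6
    simp_rw [map_sum, map_smul, TensorProduct.map_tmul, LinearMap.id_apply,
      LinearMap.mulLeft_apply, LinearMap.mulRight_apply, ← hWmul, hβ, hWM, map_mul,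
      wordEval_of] at h7
    rw [Finset.mul_sum, Finset.sum_mul]
    simp_rw [Matrix.mul_smul, Matrix.smul_mul]
    simp_rw [← Matrix.mul_assoc] at h7 ⊢
    exact h7

/-- A separability element over an extension field can be replaced by one over the ground field. -/
theorem IsSeparabilityElement.descend {F K : Type*} [Field F] [Field K] [Algebra F K] {n m : ℕ}
    {x : Fin m → Matrix (Fin n) (Fin n) F}
    {s : Finset (FreeMonoid (Fin m) × FreeMonoid (Fin m))}
    {c : FreeMonoid (Fin m) × FreeMonoid (Fin m) → K}
    (h : IsSeparabilityElement (fun l => (x l).map (algebraMap F K)) s c)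
    (lam : K →ₗ[F] F) (hlam : lam 1 = 1) : IsSeparabilityElement x s (fun p => lam (c p)) := by
  have hw : ∀ w, wordEval (fun l => (x l).map (algebraMap F K)) w =
      (wordEval x w).map (algebraMap F K) := by
    intro w
    induction w using FreeMonoid.inductionOn' with
    | one => simp
    | of_mul l w ih => rw [map_mul, map_mul, ih, wordEval_of, wordEval_of, Matrix.map_mul]
  have hmul : ∀ (a : K) (r : F), lam (a * algebraMap F K r) = lam a * r := by
    intro a r
    rw [mul_comm, ← Algebra.smul_def, map_smul, smul_eq_mul, mul_comm]
  have happ : ∀ (X : FreeMonoid (Fin m) × FreeMonoid (Fin m) → Matrix (Fin n) (Fin n) F) i j,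
      lam ((∑ p ∈ s, c p • (X p).map (algebraMap F K)) i j) =
      (∑ p ∈ s, lam (c p) • X p) i j := by
    intro X i j
    rw [Matrix.sum_apply, Matrix.sum_apply, map_sum]
    exact Finset.sum_congr rfl fun p _ => hmul _ _
  constructor
  · ext i j
    have h1 := congrArg (fun Y : Matrix (Fin n) (Fin n) K => lam (Y i j)) h.sum_mul
    simp_rw [hw, ← Matrix.map_mul] at h1
    rw [happ] at h1
    rw [h1, one_apply, one_apply]
    split_ifs
    · exact hlam
    · exact map_zero _
  · intro l M
    ext i j
    have h1 := congrArg (fun Y : Matrix (Fin n) (Fin n) K => lam (Y i j))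
      (h.mul_sum l (M.map (algebraMap F K)))
    simp_rw [hw, Finset.mul_sum, Finset.sum_mul, Matrix.mul_smul, Matrix.smul_mul,
      ← Matrix.map_mul] at h1
    rw [happ, happ] at h1
    simp_rw [Finset.mul_sum, Finset.sum_mul, Matrix.mul_smul, Matrix.smul_mul]
    exact h1

/-! ### Conjugacy classes of semisimple tuples are closed -/

/-- The simultaneous conjugacy class of a tuple of matrices. -/
def conjClass {F : Type*} [Field F] {n m : ℕ} (x : Fin m → Matrix (Fin n) (Fin n) F) :
    Set (Fin m → Matrix (Fin n) (Fin n) F) :=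
  {y | ∃ g h : Matrix (Fin n) (Fin n) F, g * h = 1 ∧ ∀ l, y l = g * x l * h}

theorem wordEval_conj {R : Type*} [CommRing R] {n m : ℕ} {x y : Fin m → Matrix (Fin n) (Fin n) R}
    {g h : Matrix (Fin n) (Fin n) R} (hgh : g * h = 1) (hy : ∀ l, y l = g * x l * h)
    (w : FreeMonoid (Fin m)) : wordEval y w = g * wordEval x w * h := by
  have hhg : h * g = 1 := mul_eq_one_comm.1 hgh
  induction w using FreeMonoid.inductionOn' with
  | one => simp [hgh]
  | of_mul l w ih =>
    rw [map_mul, map_mul, ih, wordEval_of, wordEval_of, hy]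
    simp only [Matrix.mul_assoc]
    rw [← Matrix.mul_assoc h g, hhg, Matrix.one_mul]

theorem continuous_wordEval {F : Type*} [Field F] [TopologicalSpace F] [IsTopologicalRing F]
    {n m : ℕ} (w : FreeMonoid (Fin m)) :
    Continuous fun y : Fin m → Matrix (Fin n) (Fin n) F => wordEval y w := by
  induction w using FreeMonoid.inductionOn' with
  | one => simpa using continuous_const
  | of_mul l w ih =>
    simp_rw [map_mul, wordEval_of]
    exact (continuous_apply l).mul ih

/-- If `y` is a limit of conjugates of `x`, and `x` has a separability element, then `y` is
intertwined with the conjugates of `x` by matrices that depend continuously on the conjugate and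
tend to `1` at `y`. -/
theorem IsSeparabilityElement.exists_intertwiner {F : Type*} [Field F] [TopologicalSpace F]
    [IsTopologicalRing F] [T2Space F] {n m : ℕ} {x : Fin m → Matrix (Fin n) (Fin n) F}
    {s : Finset (FreeMonoid (Fin m) × FreeMonoid (Fin m))}
    {c : FreeMonoid (Fin m) × FreeMonoid (Fin m) → F} (hs : IsSeparabilityElement x s c)
    {y : Fin m → Matrix (Fin n) (Fin n) F} (hy : y ∈ closure (conjClass x)) :
    ∃ u : (Fin m → Matrix (Fin n) (Fin n) F) → Matrix (Fin n) (Fin n) F, Continuous u ∧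
      u y = 1 ∧ ∀ y' ∈ conjClass x, ∀ l, y' l * u y' = u y' * y l := by
  -- the identities hold for conjugates in place of the limit `y`, and pass to the closure
  refine ⟨fun y' => ∑ p ∈ s, c p • (wordEval y' p.1 * wordEval y p.2), ?_, ?_, ?_⟩
  · exact continuous_finsetSum _ fun p _ =>
      ((continuous_wordEval p.1).matrix_mul continuous_const).const_smul (c p)
  · have hcl : IsClosed {y : Fin m → Matrix (Fin n) (Fin n) F |
        ∑ p ∈ s, c p • (wordEval y p.1 * wordEval y p.2) = 1} :=
      isClosed_eq (continuous_finsetSum _ fun p _ =>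
        ((continuous_wordEval p.1).matrix_mul (continuous_wordEval p.2)).const_smul (c p))
        continuous_const
    refine closure_minimal ?_ hcl hy
    rintro y' ⟨g, h, hgh, hy'⟩
    have hhg : h * g = 1 := mul_eq_one_comm.1 hgh
    have h1 : ∀ p : FreeMonoid (Fin m) × FreeMonoid (Fin m),
        c p • (wordEval y' p.1 * wordEval y' p.2) =
        g * (c p • (wordEval x p.1 * wordEval x p.2)) * h := by
      intro p
      rw [← map_mul, wordEval_conj hgh hy', map_mul, Matrix.mul_smul, Matrix.smul_mul]
    rw [Set.mem_ofPred_eq]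
    simp_rw [h1]
    rw [← Finset.sum_mul, ← Finset.mul_sum, hs.sum_mul, Matrix.mul_one, hgh]
  · intro y' hy' l
    have hcl : IsClosed {y : Fin m → Matrix (Fin n) (Fin n) F |
        y' l * ∑ p ∈ s, c p • (wordEval y' p.1 * wordEval y p.2) =
          (∑ p ∈ s, c p • (wordEval y' p.1 * wordEval y p.2)) * y l} :=
      isClosed_eq (continuous_const.mul (continuous_finsetSum _ fun p _ =>
        (continuous_const.matrix_mul (continuous_wordEval p.2)).const_smul (c p)))
        ((continuous_finsetSum _ fun p _ =>
        (continuous_const.matrix_mul (continuous_wordEval p.2)).const_smul (c p)).mul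
          (continuous_apply l))
    refine closure_minimal ?_ hcl hy
    obtain ⟨g', h', hgh', hy'⟩ := hy'
    have hhg' : h' * g' = 1 := mul_eq_one_comm.1 hgh'
    rintro y ⟨g, h, hgh, hy⟩
    have hhg : h * g = 1 := mul_eq_one_comm.1 hgh
    have h1 : ∀ p : FreeMonoid (Fin m) × FreeMonoid (Fin m),
        c p • (wordEval y' p.1 * wordEval y p.2) =
        g' * (c p • (wordEval x p.1 * (h' * g) * wordEval x p.2)) * h := by
      intro p
      rw [wordEval_conj hgh hy, wordEval_conj hgh' hy', Matrix.mul_smul, Matrix.smul_mul]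
      simp only [Matrix.mul_assoc]
    rw [Set.mem_ofPred_eq]
    simp_rw [h1]
    rw [← Finset.sum_mul, ← Finset.mul_sum, hy', hy]
    have h2 := hs.mul_sum l (h' * g)
    set T := ∑ p ∈ s, c p • (wordEval x p.1 * (h' * g) * wordEval x p.2)
    calc g' * x l * h' * (g' * T * h) = g' * (x l * ((h' * g') * T)) * h := by
          simp only [Matrix.mul_assoc]
      _ = g' * (T * ((h * g) * x l)) * h := by rw [hhg', hhg, Matrix.one_mul, Matrix.one_mul, h2]
      _ = _ := by simp only [Matrix.mul_assoc]

/-- A limit `y` of conjugates `y'` of `x` is conjugate to those `y'` that are close enough to `y`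
for the intertwiner to be invertible. -/
theorem isClosed_conjClass {F : Type*} [Field F] [TopologicalSpace F]
    [IsTopologicalRing F] [T2Space F] {n m : ℕ} {x : Fin m → Matrix (Fin n) (Fin n) F}
    {s : Finset (FreeMonoid (Fin m) × FreeMonoid (Fin m))}
    {c : FreeMonoid (Fin m) × FreeMonoid (Fin m) → F} (hs : IsSeparabilityElement x s c) :
    IsClosed (conjClass x) := by
  refine isClosed_of_closure_subset fun y hy => ?_
  obtain ⟨u, hu, huy, hint⟩ := hs.exists_intertwiner hy
  have hopen : IsOpen {y' | (u y').det ≠ 0} :=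
    isOpen_compl_singleton.preimage hu.matrix_det
  obtain ⟨y', hy', g, h, hgh, hx⟩ := mem_closure_iff.1 hy _ hopen (by simp [huy])
  have hunit : IsUnit (u y').det := isUnit_iff_ne_zero.2 hy'
  have h1 := Matrix.nonsing_inv_mul _ hunit
  have hhg : h * g = 1 := mul_eq_one_comm.1 hgh
  refine ⟨(u y')⁻¹ * g, h * u y', ?_, fun l => ?_⟩
  · rw [Matrix.mul_assoc, ← Matrix.mul_assoc g, hgh, Matrix.one_mul, h1]
  · have h2 := hint y' ⟨g, h, hgh, hx⟩ l
    rw [hx] at h2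
    calc y l = ((u y')⁻¹ * u y') * y l := by rw [h1, Matrix.one_mul]
      _ = (u y')⁻¹ * (g * x l * h * u y') := by rw [h2, Matrix.mul_assoc]
      _ = _ := by simp only [Matrix.mul_assoc]

/-! ### Complete reducibility of the conjugation action -/

/-- Every subspace of the space of matrices that is stable under conjugation by the matrices `x l`,
with inverses `z l`, has a complement with this property. -/
def HasConjComplements {K : Type*} [Field K] {n m : ℕ}
    (x z : Fin m → Matrix (Fin n) (Fin n) K) : Prop :=
  ∀ W : Submodule K (Matrix (Fin n) (Fin n) K), (∀ l, ∀ Y ∈ W, x l * Y * z l ∈ W) →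
    ∃ W' : Submodule K (Matrix (Fin n) (Fin n) K), IsCompl W W' ∧
      ∀ l, ∀ Y ∈ W', x l * Y * z l ∈ W'

/-- Complete reducibility of the conjugation action only depends on the conjugacy class of the
tuple. -/
theorem HasConjComplements.of_conj {K : Type*} [Field K] {n m : ℕ}
    {x z : Fin m → Matrix (Fin n) (Fin n) K} {g h : Matrix (Fin n) (Fin n) K} (hgh : g * h = 1)
    (hc : HasConjComplements (fun l => g * x l * h) (fun l => g * z l * h)) :
    HasConjComplements x z := by
  intro W hW
  have hhg : h * g = 1 := mul_eq_one_comm.1 hgh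
  let κ : Matrix (Fin n) (Fin n) K ≃ₗ[K] Matrix (Fin n) (Fin n) K :=
    LinearEquiv.ofLinearMap (LinearMap.mulRight K h ∘ₗ LinearMap.mulLeft K g)
      (LinearMap.mulRight K g ∘ₗ LinearMap.mulLeft K h)
      (by
        refine LinearMap.ext fun Y => ?_
        change g * (h * Y * g) * h = Y
        calc g * (h * Y * g) * h = (g * h) * Y * (g * h) := by simp only [Matrix.mul_assoc]
          _ = Y := by rw [hgh, Matrix.one_mul, Matrix.mul_one])
      (by
        refine LinearMap.ext fun Y => ?_
        change h * (g * Y * h) * g = Y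
        calc h * (g * Y * h) * g = (h * g) * Y * (h * g) := by simp only [Matrix.mul_assoc]
          _ = Y := by rw [hhg, Matrix.one_mul, Matrix.mul_one])
  have hκ : ∀ l Y, g * x l * h * κ Y * (g * z l * h) = κ (x l * Y * z l) := by
    intro l Y
    change g * x l * h * (g * Y * h) * (g * z l * h) = g * (x l * Y * z l) * h
    calc _ = g * x l * (h * g) * Y * (h * g) * z l * h := by simp only [Matrix.mul_assoc]
      _ = _ := by rw [hhg, Matrix.mul_one, Matrix.mul_one]; simp only [Matrix.mul_assoc]
  obtain ⟨W', hc, hW'⟩ := hc (W.map κ.toLinearMap) (by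
    rintro l _ ⟨Y, hY, rfl⟩
    exact ⟨_, hW l Y hY, (hκ l Y).symm⟩)
  refine ⟨W'.comap κ.toLinearMap, ?_, fun l Y hY => ?_⟩
  · have h1 : W = (W.map κ.toLinearMap).comap κ.toLinearMap :=
      (Submodule.comap_map_eq_of_injective κ.injective W).symm
    conv_lhs => rw [h1]
    exact (Submodule.orderIsoMapComap κ).symm.isCompl hc
  · have h2 := hW' l _ hY
    rw [Submodule.mem_comap]
    exact (hκ l Y) ▸ h2

/-- The entries of `y` are bounded by the trace of `yᴴ * y`. -/
theorem normSq_apply_le_sum {n : ℕ} {y U : Matrix (Fin n) (Fin n) ℂ} {lam : Fin n → ℝ}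
    (hU : Uᴴ * U = 1) (hy : yᴴ * y = unitaryDiagonal U lam) (i j : Fin n) :
    ‖y i j‖ ^ 2 ≤ ∑ a, lam a := by
  have h1 : (yᴴ * y).trace = ((∑ j, ∑ i, ‖y i j‖ ^ 2 : ℝ) : ℂ) := by
    rw [trace]
    push_cast
    refine Finset.sum_congr rfl fun j _ => ?_
    rw [diag_apply, Matrix.mul_apply]
    refine Finset.sum_congr rfl fun i _ => ?_
    rw [conjTranspose_apply, RCLike.star_def, Complex.conj_mul']
  have h2 : (unitaryDiagonal U lam).trace = ((∑ a, lam a : ℝ) : ℂ) := by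
    rw [unitaryDiagonal, trace_mul_comm, ← Matrix.mul_assoc, hU, Matrix.one_mul, trace_diagonal]
    push_cast
    rfl
  rw [← Complex.ofReal_injective (h1.symm.trans ((congrArg trace hy).trans h2))]
  exact (Finset.single_le_sum (f := fun i => ‖y i j‖ ^ 2) (fun _ _ => sq_nonneg _)
    (Finset.mem_univ i)).trans (Finset.single_le_sum (f := fun j => ∑ i, ‖y i j‖ ^ 2)
    (fun _ _ => Finset.sum_nonneg fun _ _ => sq_nonneg _) (Finset.mem_univ j))

/-- The sets on which `logSingularSq` is bounded are bounded. -/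
theorem lt_logSingularSq_of_lt_norm {n : ℕ} (y : Matrix (Fin n) (Fin n) ℂ) (r : ℝ) (i j : Fin n)
    (h : n * Real.exp (√r) < ‖y i j‖ ^ 2) : r ≤ logSingularSq y := by
  obtain ⟨U, lam, hU, hyU, hlog, -⟩ := exists_logSingularSq_eq y
  have h1 := h.trans_le (normSq_apply_le_sum hU hyU i j)
  obtain ⟨a, ha⟩ : ∃ a, Real.exp (√r) < lam a := by
    by_contra! hcon
    have := Finset.sum_le_sum fun a (_ : a ∈ Finset.univ) => hcon a
    simp only [Finset.sum_const, Finset.card_univ, Fintype.card_fin, nsmul_eq_mul] at this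
    linarith
  have h2 : √r ≤ Real.log (lam a) := by
    rw [Real.le_log_iff_exp_le ((Real.exp_pos _).trans ha)]
    exact ha.le
  rw [hlog]
  refine le_trans ?_ (Finset.single_le_sum (f := fun a => Real.log (lam a) ^ 2)
    (fun _ _ => sq_nonneg _) (Finset.mem_univ a))
  rcases le_total r 0 with hr | hr
  · exact hr.trans (sq_nonneg _)
  · calc r = √r ^ 2 := (Real.sq_sqrt hr).symm
      _ ≤ _ := by gcongr

/-- Complete reducibility of the conjugation action on matrices, over the complex numbers: the sum
of `logSingularSq` attains its minimum on the conjugacy class, which is closed. -/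
theorem IsSemisimpleTuple.hasConjComplements_complex {n m : ℕ}
    {x z : Fin m → Matrix (Fin n) (Fin n) ℂ} (hx : IsSemisimpleTuple x)
    (hxz : ∀ l, x l * z l = 1) : HasConjComplements x z := by
  obtain ⟨s, c, hs⟩ := hx.exists_isSeparabilityElement
  have hclosed := isClosed_conjClass hs
  let f : (Fin m → Matrix (Fin n) (Fin n) ℂ) → ℝ := fun y => ∑ l, logSingularSq (y l)
  have hunit : ∀ y ∈ conjClass x, ∀ l, IsUnit (y l) := by
    rintro y ⟨g, h, hgh, hy⟩ l
    rw [hy]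
    exact ((IsUnit.of_mul_eq_one _ hgh).mul (IsUnit.of_mul_eq_one _ (hxz l))).mul
      (IsUnit.of_mul_eq_one _ (mul_eq_one_comm.1 hgh))
  have hcont : ContinuousOn f (conjClass x) := by
    intro y hy
    refine ContinuousAt.continuousWithinAt ?_
    exact tendsto_finsetSum _ fun l _ =>
      (continuousAt_logSingularSq (y l) (hunit y hy l)).tendsto.comp
        ((continuous_apply l).tendsto y)
  have hx0 : x ∈ conjClass x := ⟨1, 1, Matrix.one_mul 1, fun l => by simp⟩
  have hev : ∀ᶠ y in Filter.cocompact (Fin m → Matrix (Fin n) (Fin n) ℂ) ⊓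
      Filter.principal (conjClass x), f x ≤ f y := by
    refine Filter.Eventually.filter_mono inf_le_left ?_
    have hcomp : IsCompact {y : Fin m → Matrix (Fin n) (Fin n) ℂ | ∀ l i j,
        y l i j ∈ Metric.closedBall (0 : ℂ) (√(n * Real.exp (√(f x))))} := by
      have := isCompact_univ_pi fun _ : Fin m => isCompact_univ_pi fun _ : Fin n =>
        isCompact_univ_pi fun _ : Fin n =>
        isCompact_closedBall (0 : ℂ) (√(n * Real.exp (√(f x))))
      refine this.of_isClosed_subset ?_ fun y hy => ?_
      · simp only [Set.ofPred_forall]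
        exact isClosed_iInter fun l => isClosed_iInter fun i => isClosed_iInter fun j =>
          Metric.isClosed_closedBall.preimage (by fun_prop)
      · exact fun l _ i _ j _ => hy l i j
    filter_upwards [hcomp.compl_mem_cocompact] with y hy
    simp only [Set.mem_compl_iff, Set.mem_ofPred_eq, not_forall, mem_closedBall_zero_iff,
      not_le] at hy
    obtain ⟨l, i, j, hlij⟩ := hy
    rw [Real.sqrt_lt' ((Real.sqrt_nonneg _).trans_lt hlij)] at hlij
    exact (lt_logSingularSq_of_lt_norm _ _ i j hlij).trans
      (Finset.single_le_sum (f := fun l => logSingularSq (y l))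
        (fun l _ => Finset.sum_nonneg fun a _ => sq_nonneg _) (Finset.mem_univ l))
  obtain ⟨y, hy, hmin⟩ := hcont.exists_isMinOn' hclosed hx0 hev
  obtain ⟨U, V, σ, hU, hV, hσ, hsvd, hsum⟩ := sum_log_eq_zero_of_forall_le y (hunit y hy) (by
    intro g' h' hgh'
    obtain ⟨g, h, hgh, hyx⟩ := hy
    refine hmin (a := fun l => g' * y l * h') ⟨g' * g, h * h', ?_, fun l => ?_⟩
    · rw [Matrix.mul_assoc, ← Matrix.mul_assoc g, hgh, Matrix.one_mul, hgh']
    · change g' * y l * h' = _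
      rw [hyx]
      simp only [Matrix.mul_assoc])
  obtain ⟨g, h, hgh, hyx⟩ := hy
  have hhg : h * g = 1 := mul_eq_one_comm.1 hgh
  refine HasConjComplements.of_conj hgh fun W hW => ?_
  obtain rfl : y = fun l => g * x l * h := funext hyx
  refine exists_isCompl_conj_stable_of_sum_log_eq_zero _ (fun l => g * z l * h) U V σ (fun l => ?_)
    hU hV hσ hsvd hsum W hW
  calc g * x l * h * (g * z l * h) = g * (x l * ((h * g) * z l)) * h := by
        simp only [Matrix.mul_assoc]
    _ = 1 := by rw [hhg, Matrix.one_mul, hxz, Matrix.mul_one, hgh]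

/-! ### Change of the ground field -/

/-- Stable complements are transported along semilinear bijections. -/
theorem RingEquiv.exists_pullback_stable {K L V V' : Type*} [Field K] [Field L] (σ : K ≃+* L)
    [AddCommGroup V] [Module K V] [AddCommGroup V'] [Module L V'] (θ : V ≃+ V')
    (hθ : ∀ (r : K) (v : V), θ (r • v) = σ r • θ v) {ι : Type*} (a : ι → V → V) (b : ι → V' → V')
    (hab : ∀ i v, θ (a i v) = b i (θ v))
    (h : ∀ W : Submodule K V, (∀ i, ∀ v ∈ W, a i v ∈ W) →
      ∃ W' : Submodule K V, IsCompl W W' ∧ ∀ i, ∀ v ∈ W', a i v ∈ W')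
    (W : Submodule L V') (hW : ∀ i, ∀ v ∈ W, b i v ∈ W) :
    ∃ W' : Submodule L V', IsCompl W W' ∧ ∀ i, ∀ v ∈ W', b i v ∈ W' := by
  obtain ⟨U, hU, hUst⟩ := h
    { carrier := {v | θ v ∈ W}
      add_mem' := fun {v w} hv hw => by
        change θ (v + w) ∈ W
        rw [map_add]
        exact W.add_mem hv hw
      zero_mem' := by
        change θ 0 ∈ W
        rw [map_zero]
        exact W.zero_mem
      smul_mem' := fun r v hv => by
        change θ (r • v) ∈ W
        rw [hθ]
        exact W.smul_mem _ hv }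
    (fun i v hv => by
      change θ (a i v) ∈ W
      rw [hab]
      exact hW i _ hv)
  refine ⟨{ carrier := {w | θ.symm w ∈ U}
            add_mem' := fun {v w} hv hw => by
              change θ.symm (v + w) ∈ U
              rw [map_add]
              exact U.add_mem hv hw
            zero_mem' := by
              change θ.symm 0 ∈ U
              rw [map_zero]
              exact U.zero_mem
            smul_mem' := fun r v hv => by
              change θ.symm (r • v) ∈ U
              have h1 : θ.symm (r • v) = σ.symm r • θ.symm v := by
                apply θ.injective
                rw [hθ, AddEquiv.apply_symm_apply, AddEquiv.apply_symm_apply,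
                  RingEquiv.apply_symm_apply]
              rw [h1]
              exact U.smul_mem _ hv }, ?_, fun i v hv => ?_⟩
  · rw [isCompl_iff, Submodule.disjoint_def, Submodule.codisjoint_iff_exists_add_eq] at hU ⊢
    refine ⟨fun w hw hw' => ?_, fun w => ?_⟩
    · have h1 : θ.symm w = 0 := hU.1 _ (by
        change θ (θ.symm w) ∈ W
        rwa [AddEquiv.apply_symm_apply]) hw'
      rw [← θ.apply_symm_apply w, h1, map_zero]
    · obtain ⟨y, z, hy, hz, hyz⟩ := hU.2 (θ.symm w)
      refine ⟨θ y, θ z, hy, ?_, ?_⟩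
      · change θ.symm (θ z) ∈ U
        rwa [AddEquiv.symm_apply_apply]
      · rw [← map_add, hyz, AddEquiv.apply_symm_apply]
  · change θ.symm (b i v) ∈ U
    have h1 : θ.symm (b i v) = a i (θ.symm v) := by
      apply θ.injective
      rw [hab, AddEquiv.apply_symm_apply, AddEquiv.apply_symm_apply]
    rw [h1]
    exact hUst i _ hv

/-- Complete reducibility of the conjugation action on matrices of a semisimple tuple, over a field
that is isomorphic to the complex numbers. -/
theorem IsSemisimpleTuple.hasConjComplements {K : Type*} [Field K] (σ : K ≃+* ℂ) {n m : ℕ}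
    {x z : Fin m → Matrix (Fin n) (Fin n) K} (hx : IsSemisimpleTuple x)
    (hxz : ∀ l, x l * z l = 1) : HasConjComplements x z := by
  have h1 : IsSemisimpleTuple fun l => (x l).map σ := by
    refine σ.exists_pullback_stable (AddEquiv.piCongrRight fun _ : Fin n => σ.toAddEquiv)
      (fun r v => ?_) (fun l v => x l *ᵥ v) (fun l v => (x l).map σ *ᵥ v) (fun l v => ?_) hx
    · ext i
      exact map_mul σ _ _
    · ext i
      exact RingHom.map_mulVec (σ : K →+* ℂ) _ _ _
  have h2 := h1.hasConjComplements_complex (z := fun l => (z l).map σ) fun l => by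
    rw [← Matrix.map_mul, hxz]
    simp
  refine σ.symm.exists_pullback_stable (V := Matrix (Fin n) (Fin n) ℂ)
    (V' := Matrix (Fin n) (Fin n) K) σ.symm.mapMatrix.toAddEquiv
    (fun r v => ?_) (fun l Y => (x l).map σ * Y * (z l).map σ) (fun l Y => x l * Y * z l)
    (fun l Y => ?_) h2
  · ext i j
    exact map_mul σ.symm _ _
  · change σ.symm.mapMatrix ((x l).map σ * Y * (z l).map σ) = x l * σ.symm.mapMatrix Y * z l
    rw [map_mul, map_mul]
    congr 2
    · ext i j
      simp
    · ext i j
      simp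

/-- Descent of equivariant projections: if the conjugation action is completely reducible over an
extension field, then every stable subspace over the ground field is the image of an equivariant
projection. An equivariant projection over the extension field is composed with a linear retraction
of the extension field onto the ground field. -/
theorem HasConjComplements.exists_projection {F K : Type*} [Field F] [Field K] [Algebra F K]
    {n m : ℕ} {x z : Fin m → Matrix (Fin n) (Fin n) F}
    (hc : HasConjComplements (fun l => (x l).map (algebraMap F K))
      (fun l => (z l).map (algebraMap F K)))
    (W : Submodule F (Matrix (Fin n) (Fin n) F)) (hW : ∀ l, ∀ Y ∈ W, x l * Y * z l ∈ W) :
    ∃ P : Matrix (Fin n) (Fin n) F →ₗ[F] Matrix (Fin n) (Fin n) F, (∀ Y, P Y ∈ W) ∧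
      (∀ Y ∈ W, P Y = Y) ∧ ∀ l Y, P (x l * Y * z l) = x l * P Y * z l := by
  obtain ⟨lam, hlam⟩ := (Algebra.linearMap F K).exists_leftInverse_of_injective
    (LinearMap.ker_eq_bot.2 (algebraMap F K).injective)
  have hlam' : ∀ r : F, lam (algebraMap F K r) = r := fun r => LinearMap.congr_fun hlam r
  let Lam : Matrix (Fin n) (Fin n) K →ₗ[F] Matrix (Fin n) (Fin n) F := lam.mapMatrix
  let inc : Matrix (Fin n) (Fin n) F →ₗ[F] Matrix (Fin n) (Fin n) K :=
    (Algebra.linearMap F K).mapMatrix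
  have hinc : ∀ Y, inc Y = Y.map (algebraMap F K) := fun Y => rfl
  have hsmul : ∀ (a : K) (Y : Matrix (Fin n) (Fin n) F), Lam (a • inc Y) = lam a • Y := by
    intro a Y
    ext i j
    change lam (a * algebraMap F K (Y i j)) = lam a * Y i j
    rw [mul_comm, ← Algebra.smul_def, map_smul, smul_eq_mul, mul_comm]
  have hLinc : ∀ Y, Lam (inc Y) = Y := by
    intro Y
    ext i j
    exact hlam' _
  have hleft : ∀ (A : Matrix (Fin n) (Fin n) F) (Z : Matrix (Fin n) (Fin n) K),
      Lam (inc A * Z) = A * Lam Z := by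
    intro A Z
    ext i j
    change lam ((inc A * Z) i j) = (A * Lam Z) i j
    rw [Matrix.mul_apply, Matrix.mul_apply, map_sum]
    refine Finset.sum_congr rfl fun k _ => ?_
    change lam (algebraMap F K (A i k) * Z k j) = A i k * lam (Z k j)
    rw [← Algebra.smul_def, map_smul, smul_eq_mul]
  have hright : ∀ (A : Matrix (Fin n) (Fin n) F) (Z : Matrix (Fin n) (Fin n) K),
      Lam (Z * inc A) = Lam Z * A := by
    intro A Z
    ext i j
    change lam ((Z * inc A) i j) = (Lam Z * A) i j
    rw [Matrix.mul_apply, Matrix.mul_apply, map_sum]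
    refine Finset.sum_congr rfl fun k _ => ?_
    change lam (Z i k * algebraMap F K (A k j)) = lam (Z i k) * A k j
    rw [mul_comm, ← Algebra.smul_def, map_smul, smul_eq_mul, mul_comm]
  let WK : Submodule K (Matrix (Fin n) (Fin n) K) := Submodule.span K (inc '' W)
  have hWK : ∀ l, ∀ Z ∈ WK, inc (x l) * Z * inc (z l) ∈ WK := by
    intro l Z hZ
    induction hZ using Submodule.span_induction with
    | mem Z h =>
      obtain ⟨Y, hY, rfl⟩ := h
      refine Submodule.subset_span ⟨_, hW l Y hY, ?_⟩
      rw [hinc, hinc, hinc, hinc, Matrix.map_mul, Matrix.map_mul]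
    | zero => rw [Matrix.mul_zero, Matrix.zero_mul]; exact WK.zero_mem
    | add Z Z' _ _ h h' => rw [Matrix.mul_add, Matrix.add_mul]; exact WK.add_mem h h'
    | smul r Z _ h => rw [Matrix.mul_smul, Matrix.smul_mul]; exact WK.smul_mem r h
  have hLamW : ∀ Z ∈ WK, ∀ a : K, Lam (a • Z) ∈ W := by
    intro Z hZ
    induction hZ using Submodule.span_induction with
    | mem Z h =>
      obtain ⟨Y, hY, rfl⟩ := h
      intro a
      rw [hsmul]
      exact W.smul_mem _ hY
    | zero => intro a; rw [smul_zero, map_zero]; exact W.zero_mem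
    | add Z Z' _ _ h h' => intro a; rw [smul_add, map_add]; exact W.add_mem (h a) (h' a)
    | smul r Z _ h => intro a; rw [smul_smul]; exact h _
  obtain ⟨W', hcompl, hW'⟩ := hc WK hWK
  let p := WK.projection W' hcompl
  have hp : ∀ l Z, p (inc (x l) * Z * inc (z l)) = inc (x l) * p Z * inc (z l) := by
    intro l Z
    have hdec : Z = p Z + (Z - p Z) := by abel
    have hmem : p Z ∈ WK := Submodule.projection_apply_mem hcompl Z
    have hmem' : Z - p Z ∈ W' := Submodule.sub_projection_mem hcompl Z
    conv_lhs => rw [hdec, Matrix.mul_add, Matrix.add_mul, map_add]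
    have hzero : p (inc (x l) * (Z - p Z) * inc (z l)) = 0 :=
      (Submodule.projection_apply_eq_zero_iff hcompl).2 (hW' l _ hmem')
    rw [hzero, add_zero]
    exact (Submodule.projection_eq_self_iff hcompl _).2 (hWK l _ hmem)
  refine ⟨Lam ∘ₗ p.restrictScalars F ∘ₗ inc, fun Y => ?_, fun Y hY => ?_, fun l Y => ?_⟩
  · have := hLamW _ (Submodule.projection_apply_mem hcompl (inc Y)) 1
    rwa [one_smul] at this
  · change Lam (p (inc Y)) = Y
    rw [(Submodule.projection_eq_self_iff hcompl _).2 (Submodule.subset_span ⟨Y, hY, rfl⟩), hLinc]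
  · change Lam (p (inc (x l * Y * z l))) = x l * Lam (p (inc Y)) * z l
    rw [← hleft, ← hright, ← hp]
    congr 2
    rw [hinc, hinc, hinc, hinc, Matrix.map_mul, Matrix.map_mul]

/-! ### The exponential series over normed fields of characteristic zero -/

/-- In a normed field of characteristic zero the inverse factorials grow at most exponentially. By
Ostrowski's theorem it suffices to look at the real and the `p`-adic absolute values of `ℚ`. -/
theorem exists_norm_inv_factorial_le (F : Type*) [NormedField F] [CharZero F] :
    ∃ C : ℝ, 0 < C ∧ ∀ r : ℕ, ‖((r.factorial : F))⁻¹‖ ≤ C ^ r := by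
  let f : AbsoluteValue ℚ ℝ :=
    { toFun := fun q => ‖(q : F)‖
      map_mul' := fun a b => by simp
      nonneg' := fun a => norm_nonneg _
      eq_zero' := fun a => by simp
      add_le' := fun a b => by
        rw [Rat.cast_add]
        exact norm_add_le _ _ }
  have hf : ∀ k : ℕ, f k = ‖(k : F)‖ := fun k => by
    change ‖((k : ℚ) : F)‖ = _
    rw [Rat.cast_natCast]
  have hone : (∀ k : ℕ, k ≠ 0 → 1 ≤ f k) →
      ∃ C : ℝ, 0 < C ∧ ∀ r : ℕ, ‖((r.factorial : F))⁻¹‖ ≤ C ^ r := by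
    refine fun h => ⟨1, one_pos, fun r => ?_⟩
    rw [norm_inv, one_pow, ← hf]
    exact inv_le_one_of_one_le₀ (h _ r.factorial_ne_zero)
  by_cases hnt : f.IsNontrivial
  · rcases Rat.AbsoluteValue.equiv_real_or_padic f hnt with h | ⟨p, ⟨hp, h⟩, -⟩
    · refine hone fun k hk => ?_
      rw [← f.map_one]
      refine (h 1 k).2 ?_
      simp only [map_one, Rat.AbsoluteValue.real_eq_abs, Nat.abs_cast, Rat.cast_natCast]
      exact_mod_cast Nat.one_le_iff_ne_zero.2 hk
    · obtain ⟨c, hc, hcf⟩ := AbsoluteValue.isEquiv_iff_exists_rpow_eq.1 h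
      have hp1 : (1 : ℝ) ≤ p := by exact_mod_cast hp.out.one_le
      have hp0 : (0 : ℝ) < p := by linarith
      refine ⟨(p : ℝ) ^ c⁻¹, by positivity, fun r => ?_⟩
      have h1 : f r.factorial ^ c = ((p : ℝ) ^ padicValNat p r.factorial)⁻¹ := by
        have h2 := congrFun hcf (r.factorial : ℚ)
        rw [h2, Rat.AbsoluteValue.padic_eq_padicNorm, padicNorm.eq_zpow_of_nonzero
          (by exact_mod_cast r.factorial_ne_zero), padicValRat.of_nat]
        simp
      have hv : padicValNat p r.factorial ≤ r := by
        have h3 := sub_one_mul_padicValNat_factorial (p := p) r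
        have h4 : 1 ≤ p - 1 := Nat.le_sub_one_of_lt hp.out.one_lt
        calc padicValNat p r.factorial ≤ (p - 1) * padicValNat p r.factorial :=
              Nat.le_mul_of_pos_left _ h4
          _ ≤ r := by rw [h3]; exact Nat.sub_le _ _
      have hfpos : 0 < f r.factorial := f.pos (by exact_mod_cast r.factorial_ne_zero)
      rw [norm_inv, ← hf]
      have h5 : (f r.factorial)⁻¹ = ((p : ℝ) ^ padicValNat p r.factorial) ^ c⁻¹ := by
        rw [← inv_inv ((p : ℝ) ^ padicValNat p r.factorial), ← h1, ← Real.inv_rpow hfpos.le,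
          Real.rpow_rpow_inv (inv_nonneg.2 hfpos.le) hc.ne']
      rw [h5, ← Real.rpow_natCast ((p : ℝ) ^ c⁻¹), ← Real.rpow_natCast (p : ℝ),
        ← Real.rpow_mul hp0.le, ← Real.rpow_mul hp0.le]
      refine Real.rpow_le_rpow_of_exponent_le hp1 ?_
      rw [mul_comm]
      have : (padicValNat p r.factorial : ℝ) ≤ r := by exact_mod_cast hv
      gcongr
  · exact hone fun k hk => (f.not_isNontrivial_apply hnt (by exact_mod_cast hk)).ge

/-- The exponential series has a positive radius of convergence over every normed field of
characteristic zero, for instance over the `p`-adic numbers. -/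
theorem expSeries_radius_pos_of_charZero (F A : Type*) [NontriviallyNormedField F] [CharZero F]
    [NormedRing A] [NormedAlgebra F A] : 0 < (NormedSpace.expSeries F A).radius := by
  obtain ⟨C, hC, hCr⟩ := exists_norm_inv_factorial_le F
  have hC' : 0 < C⁻¹ := inv_pos.2 hC
  obtain ⟨ρ, hρ⟩ : ∃ ρ : NNReal, (ρ : ℝ) = C⁻¹ := ⟨⟨C⁻¹, hC'.le⟩, rfl⟩
  refine lt_of_lt_of_le (b := (ρ : ENNReal)) ?_
    ((NormedSpace.expSeries F A).le_radius_of_bound (max 1 ‖(1 : A)‖) fun r => ?_)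
  · rw [ENNReal.coe_pos, ← NNReal.coe_pos, hρ]
    exact hC'
  · have h1 : ‖NormedSpace.expSeries F A r‖ ≤ C ^ r * max 1 ‖(1 : A)‖ := by
      change ‖((r.factorial : F))⁻¹ • ContinuousMultilinearMap.mkPiAlgebraFin F r A‖ ≤ _
      refine (norm_smul_le ((r.factorial : F))⁻¹
        (ContinuousMultilinearMap.mkPiAlgebraFin F r A)).trans ?_
      gcongr
      · exact hCr r
      · rcases Nat.eq_zero_or_pos r with rfl | hr
        · rw [ContinuousMultilinearMap.norm_mkPiAlgebraFin_zero]
          exact le_max_right _ _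
        · exact (ContinuousMultilinearMap.norm_mkPiAlgebraFin_le_of_pos hr).trans (le_max_left _ _)
    rw [hρ]
    calc _ ≤ C ^ r * max 1 ‖(1 : A)‖ * C⁻¹ ^ r := by gcongr
      _ = max 1 ‖(1 : A)‖ := by rw [inv_pow]; field_simp

/-! ### Left invariant vector fields and Taylor expansion -/

/-- The value of a polynomial in the matrix entries at a matrix. -/
noncomputable def matEval {F : Type*} [Field F] {n : ℕ} (A : Matrix (Fin n) (Fin n) F) :
    MvPolynomial (Fin n × Fin n) F →ₐ[F] F :=
  aeval fun p => A p.1 p.2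

/-- The derivation of the ring of polynomials in the matrix entries given by the left invariant
vector field `A ↦ A * Y`. -/
noncomputable def invariantDerivation {F : Type*} [Field F] {n : ℕ}
    (Y : Matrix (Fin n) (Fin n) F) :
    Derivation F (MvPolynomial (Fin n × Fin n) F) (MvPolynomial (Fin n × Fin n) F) :=
  mkDerivation F fun p => ∑ k, C (Y k p.2) * X (p.1, k)

theorem invariantDerivation_iterate_X {F : Type*} [Field F] {n : ℕ}
    (Y : Matrix (Fin n) (Fin n) F) (p : Fin n × Fin n) (r : ℕ) :
    (invariantDerivation Y)^[r] (X p) = ∑ k, C ((Y ^ r) k p.2) * X (p.1, k) := by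
  induction r with
  | zero =>
    rw [Function.iterate_zero, id, pow_zero, Finset.sum_eq_single p.2]
    · simp
    · intro k _ hk
      rw [one_apply_ne hk, C_0, zero_mul]
    · simp
  | succ r ih =>
    rw [Function.iterate_succ_apply', ih, map_sum, pow_succ']
    simp_rw [Matrix.mul_apply, map_sum, Finset.sum_mul]
    rw [Finset.sum_comm]
    refine Finset.sum_congr rfl fun k _ => ?_
    rw [← smul_eq_C_mul, Derivation.map_smul, invariantDerivation, mkDerivation_X, Finset.smul_sum]
    refine Finset.sum_congr rfl fun j _ => ?_
    rw [smul_eq_C_mul, ← mul_assoc, ← C_mul, mul_comm (Y j k)]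

/-- The Leibniz rule for iterated derivations. -/
theorem invariantDerivation_iterate_mul {F : Type*} [Field F] {n : ℕ}
    (Y : Matrix (Fin n) (Fin n) F) (f g : MvPolynomial (Fin n × Fin n) F) (r : ℕ) :
    (invariantDerivation Y)^[r] (f * g) = ∑ ij ∈ Finset.HasAntidiagonal.antidiagonal r,
      r.choose ij.1 • ((invariantDerivation Y)^[ij.1] f * (invariantDerivation Y)^[ij.2] g) := by
  induction r with
  | zero => simp
  | succ r ih =>
    rw [Finset.sum_antidiagonal_choose_succ_nsmul (M := MvPolynomial (Fin n × Fin n) F)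
      (fun i j => (invariantDerivation Y)^[i] f * (invariantDerivation Y)^[j] g) r,
      Function.iterate_succ_apply', ih, map_sum, ← Finset.sum_add_distrib]
    refine Finset.sum_congr rfl fun ij hij => ?_
    rw [map_nsmul, Derivation.leibniz, smul_eq_mul, smul_eq_mul, nsmul_add,
      Function.iterate_succ_apply', Function.iterate_succ_apply',
      Nat.choose_symm_of_eq_add (Finset.HasAntidiagonal.mem_antidiagonal.1 hij).symm]
    congr 2
    ring

section Exponential

variable {F : Type*} [NontriviallyNormedField F] [CompleteSpace F] [CharZero F] {n : ℕ}

open scoped Matrix.Norms.Operator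

/-- Taylor's formula: the values of a polynomial along the integral curves of a left invariant
vector field. -/
theorem hasSum_matEval_mul_exp (Y A : Matrix (Fin n) (Fin n) F)
    (hY : Y ∈ Metric.eball (0 : Matrix (Fin n) (Fin n) F)
      (NormedSpace.expSeries F (Matrix (Fin n) (Fin n) F)).radius)
    (f : MvPolynomial (Fin n × Fin n) F) :
    Summable (fun r : ℕ => ‖((r.factorial : F))⁻¹ * matEval A ((invariantDerivation Y)^[r] f)‖) ∧
      HasSum (fun r : ℕ => ((r.factorial : F))⁻¹ * matEval A ((invariantDerivation Y)^[r] f))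
        (matEval (A * NormedSpace.exp Y) f) := by
  have hentry : ∀ (B : Matrix (Fin n) (Fin n) F) i j, ‖B i j‖ ≤ ‖B‖ := by
    intro B i j
    have h1 := norm_entry_le_entrywise_sup_norm B (i := i) (j := j)
    have h2 : ‖B i j‖₊ ≤ ‖B‖₊ := by
      rw [linfty_opNNNorm_def]
      exact (Finset.single_le_sum (f := fun j => ‖B i j‖₊) (fun _ _ => zero_le)
        (Finset.mem_univ j)).trans
        (Finset.le_sup (f := fun i => ∑ j, ‖B i j‖₊) (Finset.mem_univ i))
    exact h2
  induction f using MvPolynomial.induction_on with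
  | C a =>
    have h0 : ∀ r : ℕ, r ≠ 0 → (invariantDerivation Y)^[r] (C a) = 0 := by
      intro r hr
      obtain ⟨r, rfl⟩ := Nat.exists_eq_succ_of_ne_zero hr
      rw [Function.iterate_succ_apply, derivation_C]
      exact Function.iterate_fixed (map_zero _) r
    constructor
    · refine summable_of_ne_finset_zero (s := {0}) fun r hr => ?_
      rw [h0 r (by simpa using hr)]
      simp
    · have h1 := hasSum_single (f := fun r : ℕ => ((r.factorial : F))⁻¹ *
        matEval A ((invariantDerivation Y)^[r] (C a))) 0 fun r hr => by rw [h0 r hr]; simp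
      simpa [matEval] using h1
  | add f g hf hg =>
    have h1 : ∀ r : ℕ, ((r.factorial : F))⁻¹ * matEval A ((invariantDerivation Y)^[r] (f + g)) =
        ((r.factorial : F))⁻¹ * matEval A ((invariantDerivation Y)^[r] f) +
        ((r.factorial : F))⁻¹ * matEval A ((invariantDerivation Y)^[r] g) := by
      intro r
      rw [iterate_map_add, map_add, mul_add]
    simp_rw [h1, map_add]
    exact ⟨(hf.1.add hg.1).of_nonneg_of_le (fun _ => norm_nonneg _) fun _ => norm_add_le _ _,
      hf.2.add hg.2⟩
  | mul_X f p hf =>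
    have hX : Summable (fun r : ℕ => ‖((r.factorial : F))⁻¹ *
        matEval A ((invariantDerivation Y)^[r] (X p))‖) ∧
        HasSum (fun r : ℕ => ((r.factorial : F))⁻¹ *
          matEval A ((invariantDerivation Y)^[r] (X p)))
        (matEval (A * NormedSpace.exp Y) (X p)) := by
      have h1 : ∀ r : ℕ, ((r.factorial : F))⁻¹ * matEval A ((invariantDerivation Y)^[r] (X p)) =
          (A * ((r.factorial : F)⁻¹ • Y ^ r)) p.1 p.2 := by
        intro r
        rw [invariantDerivation_iterate_X Y, map_sum, Matrix.mul_apply, Finset.mul_sum]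
        refine Finset.sum_congr rfl fun k _ => ?_
        simp only [matEval, map_mul, aeval_C, aeval_X, Algebra.algebraMap_self, RingHom.id_apply,
          Matrix.smul_apply, smul_eq_mul]
        ring
      simp_rw [h1]
      have : @CompleteSpace (Matrix (Fin n) (Fin n) F) PseudoMetricSpace.toUniformSpace :=
        FiniteDimensional.complete F _
      have hs := NormedSpace.norm_expSeries_summable_of_mem_ball' (𝕂 := F) Y hY
      have hs' := NormedSpace.expSeries_hasSum_exp_of_mem_ball' (𝕂 := F) Y hY
      constructor
      · refine (hs.mul_left ‖A‖).of_nonneg_of_le (fun _ => norm_nonneg _) fun r =>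
          (hentry _ _ _).trans (norm_mul_le _ _)
      · have h2 := hs'.mul_left A
        have h4 := h2.map (Matrix.entryAddMonoidHom F p.1 p.2)
          (continuous_apply_apply (ρ := fun _ _ => F) p.1 p.2)
        have h5 : matEval (A * NormedSpace.exp Y) (X p) = (A * NormedSpace.exp Y) p.1 p.2 := by
          simp [matEval]
        rw [h5]
        exact h4
    obtain ⟨a, ha⟩ : ∃ a : ℕ → F, ∀ r, a r =
      ((r.factorial : F))⁻¹ * matEval A ((invariantDerivation Y)^[r] f) := ⟨_, fun _ => rfl⟩
    obtain ⟨b, hb⟩ : ∃ b : ℕ → F, ∀ r, b r =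
      ((r.factorial : F))⁻¹ * matEval A ((invariantDerivation Y)^[r] (X p)) := ⟨_, fun _ => rfl⟩
    have h1 : ∀ r : ℕ, ((r.factorial : F))⁻¹ *
        matEval A ((invariantDerivation Y)^[r] (f * X p)) =
        ∑ ij ∈ Finset.HasAntidiagonal.antidiagonal r, a ij.1 * b ij.2 := by
      intro r
      rw [invariantDerivation_iterate_mul, map_sum, Finset.mul_sum]
      refine Finset.sum_congr rfl fun ij hij => ?_
      obtain rfl := Finset.HasAntidiagonal.mem_antidiagonal.1 hij
      rw [map_nsmul, map_mul, nsmul_eq_mul, Nat.cast_add_choose, ha, hb]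
      have h2 : ((ij.1 + ij.2).factorial : F) ≠ 0 := by
        exact_mod_cast Nat.factorial_ne_zero _
      field_simp
    simp_rw [h1]
    simp_rw [← ha] at hf
    simp_rw [← hb] at hX
    have h2 := summable_norm_sum_mul_antidiagonal_of_summable_norm hf.1 hX.1
    refine ⟨h2, ?_⟩
    have h3 := h2.of_norm.hasSum
    rw [← tsum_mul_tsum_eq_tsum_sum_antidiagonal_of_summable_norm hf.1 hX.1, hf.2.tsum_eq,
      hX.2.tsum_eq, ← map_mul] at h3
    exact h3

end Exponential

theorem matEval_X {F : Type*} [Field F] {n : ℕ} (A : Matrix (Fin n) (Fin n) F)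
    (p : Fin n × Fin n) : matEval A (X p) = A p.1 p.2 := by
  simp [matEval]

theorem matEval_C {F : Type*} [Field F] {n : ℕ} (A : Matrix (Fin n) (Fin n) F) (a : F) :
    matEval A (C a) = a := by
  simp [matEval]

theorem matEval_invariantDerivation_X {F : Type*} [Field F] {n : ℕ}
    (Y A : Matrix (Fin n) (Fin n) F) (p : Fin n × Fin n) :
    matEval A (invariantDerivation Y (X p)) = (A * Y) p.1 p.2 := by
  rw [invariantDerivation, mkDerivation_X, map_sum, Matrix.mul_apply]
  refine Finset.sum_congr rfl fun k _ => ?_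
  rw [map_mul, matEval_C, matEval_X, mul_comm]

/-! ### The Lie algebra of an algebraic group -/

/-- The substitution `A ↦ a * A * b` in a polynomial in the matrix entries. -/
noncomputable def matTranslate {F : Type*} [Field F] {n : ℕ} (a b : Matrix (Fin n) (Fin n) F) :
    MvPolynomial (Fin n × Fin n) F →ₐ[F] MvPolynomial (Fin n × Fin n) F :=
  aeval fun p => ∑ l, ∑ k, C (b l p.2) * (C (a p.1 k) * X (k, l))

theorem matEval_matTranslate {F : Type*} [Field F] {n : ℕ} (a b A : Matrix (Fin n) (Fin n) F)
    (f : MvPolynomial (Fin n × Fin n) F) :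
    matEval A (matTranslate a b f) = matEval (a * A * b) f := by
  have h : (matEval A).comp (matTranslate a b) = matEval (a * A * b) := by
    refine algHom_ext fun p => ?_
    rw [AlgHom.comp_apply, matTranslate, aeval_X, matEval_X, map_sum, Matrix.mul_apply]
    refine Finset.sum_congr rfl fun l _ => ?_
    rw [map_sum, Matrix.mul_apply, Finset.sum_mul]
    refine Finset.sum_congr rfl fun k _ => ?_
    rw [map_mul, map_mul, matEval_C, matEval_C, matEval_X]
    ring
  rw [← h, AlgHom.comp_apply]

/-- Translations of the matrix group permute the left invariant vector fields. -/
theorem matEval_invariantDerivation_matTranslate {F : Type*} [Field F] {n : ℕ}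
    {a b c Y A : Matrix (Fin n) (Fin n) F} (hbc : b * c = 1)
    (f : MvPolynomial (Fin n × Fin n) F) :
    matEval A (invariantDerivation Y (matTranslate a b f)) =
      matEval (a * A * b) (invariantDerivation (c * Y * b) f) := by
  induction f using MvPolynomial.induction_on with
  | C r =>
    rw [matTranslate, aeval_C, algebraMap_eq, derivation_C, derivation_C, map_zero, map_zero]
  | add f g hf hg => rw [map_add, map_add, map_add, hf, hg, map_add, map_add]
  | mul_X f p hf =>
    have hX : matEval A (invariantDerivation Y (matTranslate a b (X p))) =
        matEval (a * A * b) (invariantDerivation (c * Y * b) (X p)) := by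
      have h1 : a * A * b * (c * Y * b) = a * (A * Y) * b := by
        calc a * A * b * (c * Y * b) = a * A * (b * c) * Y * b := by noncomm_ring
          _ = _ := by rw [hbc]; noncomm_ring
      rw [matEval_invariantDerivation_X, h1, matTranslate, aeval_X, map_sum, map_sum,
        Matrix.mul_apply]
      refine Finset.sum_congr rfl fun l _ => ?_
      rw [map_sum, map_sum, Matrix.mul_apply, Finset.sum_mul]
      refine Finset.sum_congr rfl fun k _ => ?_
      rw [← smul_eq_C_mul, ← smul_eq_C_mul, Derivation.map_smul, Derivation.map_smul, map_smul,
        map_smul, matEval_invariantDerivation_X, smul_eq_mul, smul_eq_mul]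
      ring
    rw [map_mul, Derivation.leibniz, Derivation.leibniz]
    simp only [smul_eq_mul, map_add, map_mul, matEval_matTranslate, hf, hX]

/-- The ideal of the polynomials in the matrix entries that vanish on `Γ`. -/
noncomputable def matVanishingIdeal {F : Type*} [Field F] {n : ℕ}
    (Γ : Subgroup (GL (Fin n) F)) : Ideal (MvPolynomial (Fin n × Fin n) F) :=
  ⨅ γ ∈ Γ, RingHom.ker (matEval (γ : Matrix (Fin n) (Fin n) F))

theorem mem_matVanishingIdeal {F : Type*} [Field F] {n : ℕ} {Γ : Subgroup (GL (Fin n) F)}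
    {f : MvPolynomial (Fin n × Fin n) F} :
    f ∈ matVanishingIdeal Γ ↔ ∀ γ ∈ Γ, matEval (γ : Matrix (Fin n) (Fin n) F) f = 0 := by
  simp only [matVanishingIdeal, Submodule.mem_iInf, RingHom.mem_ker]

/-- An algebraic group contains every matrix that satisfies all equations of the group. -/
theorem mem_of_forall_matVanishingIdeal {F : Type*} [Field F] {n : ℕ}
    {Γ : Subgroup (GL (Fin n) F)} (hΓ : IsAlgebraicOver F Γ) {γ : GL (Fin n) F}
    (h : ∀ f ∈ matVanishingIdeal Γ, matEval (γ : Matrix (Fin n) (Fin n) F) f = 0) : γ ∈ Γ := by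
  obtain ⟨I, hI⟩ := hΓ
  refine (hI γ).2 fun f hf => h f (mem_matVanishingIdeal.2 fun γ' hγ' => ?_)
  exact (hI γ').1 hγ' f hf

theorem matTranslate_mem_matVanishingIdeal {F : Type*} [Field F] {n : ℕ}
    {Γ : Subgroup (GL (Fin n) F)} {a b : GL (Fin n) F} (ha : a ∈ Γ) (hb : b ∈ Γ)
    {f : MvPolynomial (Fin n × Fin n) F} (hf : f ∈ matVanishingIdeal Γ) :
    matTranslate (a : Matrix (Fin n) (Fin n) F) (b : Matrix (Fin n) (Fin n) F) f ∈
      matVanishingIdeal Γ := by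
  refine mem_matVanishingIdeal.2 fun γ hγ => ?_
  rw [matEval_matTranslate]
  exact mem_matVanishingIdeal.1 hf (a * γ * b) (mul_mem (mul_mem ha hγ) hb)

theorem matEval_invariantDerivation_add {F : Type*} [Field F] {n : ℕ}
    (Y Z A : Matrix (Fin n) (Fin n) F) (f : MvPolynomial (Fin n × Fin n) F) :
    matEval A (invariantDerivation (Y + Z) f) =
      matEval A (invariantDerivation Y f) + matEval A (invariantDerivation Z f) := by
  have h : invariantDerivation (Y + Z) = invariantDerivation Y + invariantDerivation Z := by
    refine derivation_ext fun p => ?_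
    rw [Derivation.add_apply, invariantDerivation, invariantDerivation, invariantDerivation,
      mkDerivation_X, mkDerivation_X, mkDerivation_X, ← Finset.sum_add_distrib]
    exact Finset.sum_congr rfl fun k _ => by rw [Matrix.add_apply, C_add, add_mul]
  rw [h, Derivation.add_apply, map_add]

theorem matEval_invariantDerivation_smul {F : Type*} [Field F] {n : ℕ} (r : F)
    (Y A : Matrix (Fin n) (Fin n) F) (f : MvPolynomial (Fin n × Fin n) F) :
    matEval A (invariantDerivation (r • Y) f) = r * matEval A (invariantDerivation Y f) := by
  have h : invariantDerivation (r • Y) = r • invariantDerivation Y := by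
    refine derivation_ext fun p => ?_
    rw [Derivation.smul_apply, invariantDerivation, invariantDerivation,
      mkDerivation_X, mkDerivation_X, Finset.smul_sum]
    exact Finset.sum_congr rfl fun k _ => by
      rw [Matrix.smul_apply, smul_eq_mul, C_mul, mul_assoc, smul_eq_C_mul]
  rw [h, Derivation.smul_apply, map_smul, smul_eq_mul]

/-- The differential at the identity matrix of a polynomial in the matrix entries. -/
noncomputable def matDifferential {F : Type*} [Field F] {n : ℕ}
    (f : MvPolynomial (Fin n × Fin n) F) : Matrix (Fin n) (Fin n) F →ₗ[F] F where
  toFun Y := matEval 1 (invariantDerivation Y f)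
  map_add' Y Z := matEval_invariantDerivation_add Y Z 1 f
  map_smul' r Y := matEval_invariantDerivation_smul r Y 1 f

/-- The Lie algebra of `Γ`, as the Zariski tangent space at the identity. -/
noncomputable def tangentSpaceOne {F : Type*} [Field F] {n : ℕ} (Γ : Subgroup (GL (Fin n) F)) :
    Submodule F (Matrix (Fin n) (Fin n) F) :=
  ⨅ f ∈ matVanishingIdeal Γ, (matDifferential f).ker

theorem mem_tangentSpaceOne {F : Type*} [Field F] {n : ℕ} {Γ : Subgroup (GL (Fin n) F)}
    {Y : Matrix (Fin n) (Fin n) F} :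
    Y ∈ tangentSpaceOne Γ ↔
      ∀ f ∈ matVanishingIdeal Γ, matEval 1 (invariantDerivation Y f) = 0 := by
  simp only [tangentSpaceOne, Submodule.mem_iInf, LinearMap.mem_ker]
  rfl

/-- The Lie algebra is stable under the adjoint action of the group. -/
theorem conj_mem_tangentSpaceOne {F : Type*} [Field F] {n : ℕ} {Γ : Subgroup (GL (Fin n) F)}
    {γ : GL (Fin n) F} (hγ : γ ∈ Γ) {Y : Matrix (Fin n) (Fin n) F} (hY : Y ∈ tangentSpaceOne Γ) :
    (γ : Matrix (Fin n) (Fin n) F) * Y * ((γ⁻¹ : GL (Fin n) F) : Matrix (Fin n) (Fin n) F) ∈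
      tangentSpaceOne Γ := by
  refine mem_tangentSpaceOne.2 fun f hf => ?_
  have h := matEval_invariantDerivation_matTranslate (a := (γ : Matrix (Fin n) (Fin n) F)) (Y := Y)
    (A := 1) (γ.inv_mul) f
  rw [mul_one, Units.mul_inv] at h
  rw [← h]
  exact mem_tangentSpaceOne.1 hY _ (matTranslate_mem_matVanishingIdeal hγ (inv_mem hγ) hf)

/-- The left invariant vector fields given by the Lie algebra are tangent to the group at all of its
points, by translation from the identity. -/
theorem invariantDerivation_mem_matVanishingIdeal {F : Type*} [Field F] {n : ℕ}
    {Γ : Subgroup (GL (Fin n) F)} {Y : Matrix (Fin n) (Fin n) F} (hY : Y ∈ tangentSpaceOne Γ)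
    {f : MvPolynomial (Fin n × Fin n) F} (hf : f ∈ matVanishingIdeal Γ) :
    invariantDerivation Y f ∈ matVanishingIdeal Γ := by
  refine mem_matVanishingIdeal.2 fun γ hγ => ?_
  have h := matEval_invariantDerivation_matTranslate (a := (γ : Matrix (Fin n) (Fin n) F)) (Y := Y)
    (A := 1) (one_mul (1 : Matrix (Fin n) (Fin n) F)) f
  rw [mul_one, mul_one, mul_one, one_mul] at h
  rw [← h]
  exact mem_tangentSpaceOne.1 hY _ (matTranslate_mem_matVanishingIdeal hγ (one_mem Γ) hf)

section LocalTheory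

variable {F : Type*} [NontriviallyNormedField F] [CompleteSpace F] {n : ℕ}

open scoped Matrix.Norms.Operator

/-- One parameter subgroups in the direction of the Lie algebra stay in the group: all Taylor
coefficients of the defining equations along them vanish. -/
theorem exists_mem_coe_eq_exp [CharZero F] {Γ : Subgroup (GL (Fin n) F)} (hΓ : IsAlgebraicOver F Γ)
    {Y : Matrix (Fin n) (Fin n) F} (hY : Y ∈ tangentSpaceOne Γ)
    (hYr : Y ∈ Metric.eball (0 : Matrix (Fin n) (Fin n) F)
      (NormedSpace.expSeries F (Matrix (Fin n) (Fin n) F)).radius) :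
    ∃ γ ∈ Γ, (γ : Matrix (Fin n) (Fin n) F) = NormedSpace.exp Y := by
  have : @CompleteSpace (Matrix (Fin n) (Fin n) F) PseudoMetricSpace.toUniformSpace :=
    FiniteDimensional.complete F _
  obtain ⟨γ, hγ⟩ := NormedSpace.isUnit_exp_of_mem_ball (𝕂 := F) hYr
  refine ⟨γ, mem_of_forall_matVanishingIdeal hΓ fun f hf => ?_, hγ⟩
  have h0 : (γ : Matrix (Fin n) (Fin n) F) = 1 * NormedSpace.exp Y := by
    rw [hγ]
    exact (one_mul _).symm
  rw [h0]
  refine (hasSum_matEval_mul_exp Y 1 hYr f).2.unique ?_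
  have h1 : ∀ r : ℕ, (invariantDerivation Y)^[r] f ∈ matVanishingIdeal Γ := by
    intro r
    induction r with
    | zero => exact hf
    | succ r ih =>
      rw [Function.iterate_succ_apply']
      exact invariantDerivation_mem_matVanishingIdeal hY ih
  have h2 : ∀ r : ℕ, ((r.factorial : F))⁻¹ * matEval 1 ((invariantDerivation Y)^[r] f) = 0 := by
    intro r
    have h3 := mem_matVanishingIdeal.1 (h1 r) 1 (one_mem Γ)
    rw [Units.val_one] at h3
    rw [h3, mul_zero]
  simp_rw [h2]
  exact hasSum_zero

/-! ### Transversals to the cosets of an algebraic group -/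

theorem hasFDerivAt_matEval (f : MvPolynomial (Fin n × Fin n) F) :
    HasFDerivAt (fun A : Matrix (Fin n) (Fin n) F => matEval A f)
      (matDifferential f).toContinuousLinearMap 1 := by
  induction f using MvPolynomial.induction_on with
  | C a =>
    have h : (matDifferential (n := n) (C a)).toContinuousLinearMap = 0 := by
      ext Y
      change matEval 1 (invariantDerivation Y (C a)) = 0
      rw [derivation_C, map_zero]
    rw [h]
    simp_rw [matEval_C]
    exact hasFDerivAt_const a _
  | add f g hf hg =>
    have h : (matDifferential (f + g)).toContinuousLinearMap =
        (matDifferential f).toContinuousLinearMap + (matDifferential g).toContinuousLinearMap := by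
      ext Y
      change matEval 1 (invariantDerivation Y (f + g)) = matEval 1 (invariantDerivation Y f) +
        matEval 1 (invariantDerivation Y g)
      rw [map_add, map_add]
    rw [h]
    simp_rw [map_add]
    exact hf.add hg
  | mul_X f p hf =>
    have hX : HasFDerivAt (fun A : Matrix (Fin n) (Fin n) F => matEval A (X p))
        (matDifferential (X p)).toContinuousLinearMap 1 := by
      have h : (fun A : Matrix (Fin n) (Fin n) F => matEval A (X p)) =
          (matDifferential (X p)).toContinuousLinearMap := by
        ext Y
        change matEval Y (X p) = matEval 1 (invariantDerivation Y (X p))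
        rw [matEval_X, matEval_invariantDerivation_X, one_mul]
      rw [h]
      exact ContinuousLinearMap.hasFDerivAt _
    have h : (matDifferential (f * X p)).toContinuousLinearMap =
        matEval (1 : Matrix (Fin n) (Fin n) F) f • (matDifferential (X p)).toContinuousLinearMap +
        matEval (1 : Matrix (Fin n) (Fin n) F) (X p) •
          (matDifferential f).toContinuousLinearMap := by
      ext Y
      change matEval 1 (invariantDerivation Y (f * X p)) =
        matEval 1 f * matEval 1 (invariantDerivation Y (X p)) +
        matEval 1 (X p) * matEval 1 (invariantDerivation Y f)
      rw [Derivation.leibniz, map_add, smul_eq_mul, smul_eq_mul, map_mul, map_mul]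
    rw [h]
    simp_rw [map_mul]
    exact hf.mul hX

end LocalTheory

section LocalTheory

variable {F : Type*} [NontriviallyNormedField F] {n : ℕ}

open scoped Matrix.Norms.Operator

/-- A finite set of equations of `Γ`, together with a projection onto the Lie algebra, gives an
injective linear map. -/
theorem exists_finset_matDifferential_injective (Γ : Subgroup (GL (Fin n) F))
    (P : Matrix (Fin n) (Fin n) F →ₗ[F] Matrix (Fin n) (Fin n) F)
    (hP : ∀ Y ∈ tangentSpaceOne Γ, P Y = Y) :
    ∃ t : Finset (matVanishingIdeal Γ), ∀ Y, P Y = 0 →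
      (∀ f ∈ t, matDifferential f.1 Y = 0) → Y = 0 := by
  obtain ⟨t, ht⟩ := Finset.exists_inf_le fun f : matVanishingIdeal Γ => (matDifferential f.1).ker
  refine ⟨t, fun Y hY h => ?_⟩
  rw [← hY]
  refine (hP Y (mem_tangentSpaceOne.2 fun f hf => ?_)).symm
  exact ht ⟨f, hf⟩ (Submodule.mem_finsetInf.2 fun g hg => h g hg)

/-- The complement `ker P` of the Lie algebra is transversal to the cosets of `Γ`: two small
elements `1 + Z` and `1 + Z'` with `Z, Z' ∈ ker P` lie in the same coset only if they are
equal. -/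
theorem exists_pos_transversal [CompleteSpace F] (Γ : Subgroup (GL (Fin n) F))
    (P : Matrix (Fin n) (Fin n) F →ₗ[F] Matrix (Fin n) (Fin n) F)
    (hP : ∀ Y ∈ tangentSpaceOne Γ, P Y = Y) :
    ∃ δ : ℝ, 0 < δ ∧ ∀ Z Z' E : Matrix (Fin n) (Fin n) F, ‖Z‖ < δ → ‖Z'‖ < δ →
      P Z = 0 → P Z' = 0 → E * (1 + Z') = Z - Z' →
      (∃ γ ∈ Γ, (γ : Matrix (Fin n) (Fin n) F) = 1 + E) → E = 0 := by
  obtain ⟨t, ht⟩ := exists_finset_matDifferential_injective Γ P hP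
  let L : Matrix (Fin n) (Fin n) F →ₗ[F] (t → F) × Matrix (Fin n) (Fin n) F :=
    (LinearMap.pi fun f : t => matDifferential f.1.1).prod P
  have hL : L.ker = ⊥ := by
    refine LinearMap.ker_eq_bot'.2 fun Y hY => ?_
    have h1 := congrArg Prod.fst hY
    exact ht Y (congrArg Prod.snd hY) fun f hf => congrFun h1 ⟨f, hf⟩
  obtain ⟨C, hC, hanti⟩ := L.exists_antilipschitzWith hL
  have hCpos : (0 : ℝ) < C := hC
  have hbound : ∀ E, ‖E‖ ≤ C * ‖L E‖ := fun E => by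
    have := hanti.le_mul_dist E 0
    rwa [dist_zero_right, map_zero, dist_zero_right] at this
  obtain ⟨CP, hCP, hPb⟩ : ∃ CP : ℝ, 0 < CP ∧ ∀ E, ‖P E‖ ≤ CP * ‖E‖ :=
    (P.toContinuousLinearMap).isBoundedLinearMap.bound
  obtain ⟨η, hη, hη2⟩ : ∃ η : ℝ, 0 < η ∧ C * η < 1 :=
    ⟨(2 * C)⁻¹, by positivity, by
      rw [mul_inv, mul_left_comm, mul_inv_cancel₀ hCpos.ne']; norm_num⟩
  -- the equations in `t` vanish at `1` and at `1 + E`, so that their differentials at `E` are small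
  -- compared to `E`
  have hdiff : ∀ f : t, ∀ᶠ A in nhds (1 : Matrix (Fin n) (Fin n) F),
      ‖matEval A f.1.1 - matEval 1 f.1.1 - matDifferential f.1.1 (A - 1)‖ ≤ η * ‖A - 1‖ :=
    fun f => ((hasFDerivAt_matEval f.1.1).isLittleO.def hη)
  obtain ⟨δ₁, hδ₁, hball⟩ := Metric.eventually_nhds_iff.1 (Filter.eventually_all.2 hdiff)
  refine ⟨min (min (1 / 2) (δ₁ / 4)) (η / CP), by positivity,
    fun Z Z' E hZ hZ' hPZ hPZ' hE hγ => ?_⟩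
  obtain ⟨γ, hγ, hγE⟩ := hγ
  have hZ'1 : ‖Z'‖ < 1 / 2 := hZ'.trans_le ((min_le_left _ _).trans (min_le_left _ _))
  have hZ1 : ‖Z‖ < δ₁ / 4 := hZ.trans_le ((min_le_left _ _).trans (min_le_right _ _))
  have hZ'2 : ‖Z'‖ < δ₁ / 4 := hZ'.trans_le ((min_le_left _ _).trans (min_le_right _ _))
  have hZ'3 : ‖Z'‖ < η / CP := hZ'.trans_le (min_le_right _ _)
  -- hence `P E = -P (E * Z')` is small compared to `E` as well
  have hEeq : E = (Z - Z') - E * Z' := by rw [← hE]; noncomm_ring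
  have hEsmall : ‖E‖ < δ₁ := by
    have h1 : ‖E‖ ≤ (‖Z‖ + ‖Z'‖) + ‖E‖ * ‖Z'‖ := by
      conv_lhs => rw [hEeq]
      exact (norm_sub_le _ _).trans (add_le_add (norm_sub_le _ _) (norm_mul_le _ _))
    have h2 : ‖E‖ * ‖Z'‖ ≤ ‖E‖ * (1 / 2) := by gcongr
    linarith
  have h1 : ∀ f : t, ‖matDifferential f.1.1 E‖ ≤ η * ‖E‖ := by
    intro f
    have h2 := hball (y := 1 + E) (by rwa [dist_eq_norm, add_sub_cancel_left]) f
    have h3 := mem_matVanishingIdeal.1 f.1.2 γ hγ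
    have h4 := mem_matVanishingIdeal.1 f.1.2 1 (one_mem Γ)
    rw [hγE] at h3
    rw [Units.val_one] at h4
    rwa [h3, h4, sub_zero, zero_sub, norm_neg, add_sub_cancel_left] at h2
  have h2 : ‖P E‖ ≤ η * ‖E‖ := by
    have h3 : P E = - P (E * Z') := by
      conv_lhs => rw [hEeq]
      rw [map_sub, map_sub, hPZ, hPZ', sub_zero, zero_sub]
    rw [h3, norm_neg]
    calc ‖P (E * Z')‖ ≤ CP * ‖E * Z'‖ := hPb _
      _ ≤ CP * (‖E‖ * (η / CP)) := by
        gcongr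
        exact (norm_mul_le _ _).trans (by gcongr)
      _ = η * ‖E‖ := by field_simp
  have h3 : ‖L E‖ ≤ η * ‖E‖ := by
    refine max_le ((pi_norm_le_iff_of_nonneg (by positivity)).2 h1) h2
  have h4 : ‖E‖ ≤ C * η * ‖E‖ := (hbound E).trans (by rw [mul_assoc]; gcongr)
  -- `C * η < 1`
  by_contra hne
  have h5 : 0 < ‖E‖ := norm_pos_iff.2 hne
  nlinarith

/-- Near the identity every matrix is the product of the exponential of an element of the range
of a projection and of `1 + Z` with `Z` in its kernel. -/
theorem map_nhds_zero_exp_mul_one_add [CompleteSpace F] [CharZero F]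
    (P : Matrix (Fin n) (Fin n) F →ₗ[F] Matrix (Fin n) (Fin n) F) :
    Filter.map (fun Z => NormedSpace.exp (P Z) * (1 + (Z - P Z)))
      (nhds (0 : Matrix (Fin n) (Fin n) F)) = nhds 1 := by
  have : @CompleteSpace (Matrix (Fin n) (Fin n) F) PseudoMetricSpace.toUniformSpace :=
    FiniteDimensional.complete F _
  let Pc : Matrix (Fin n) (Fin n) F →L[F] Matrix (Fin n) (Fin n) F := P.toContinuousLinearMap
  have h1 : HasStrictFDerivAt (fun Z => NormedSpace.exp (Pc Z))
      ((1 : Matrix (Fin n) (Fin n) F →L[F] Matrix (Fin n) (Fin n) F).comp Pc) 0 := by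
    refine HasStrictFDerivAt.comp (0 : Matrix (Fin n) (Fin n) F) ?_ Pc.hasStrictFDerivAt
    rw [map_zero]
    exact hasStrictFDerivAt_exp_zero_of_radius_pos (expSeries_radius_pos_of_charZero F _)
  have h2 : HasStrictFDerivAt (fun Z => 1 + (Z - Pc Z))
      (ContinuousLinearMap.id F (Matrix (Fin n) (Fin n) F) - Pc) 0 :=
    ((hasStrictFDerivAt_id _).sub Pc.hasStrictFDerivAt).const_add 1
  have h3 := (h1.mul' h2).congr_fderiv (g' := ((ContinuousLinearEquiv.refl F
    (Matrix (Fin n) (Fin n) F) : Matrix (Fin n) (Fin n) F ≃L[F] Matrix (Fin n) (Fin n) F) :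
      Matrix (Fin n) (Fin n) F →L[F] Matrix (Fin n) (Fin n) F)) (by
    ext1 Z
    change NormedSpace.exp (Pc 0) * (Z - Pc Z) + Pc Z * (1 + (0 - Pc 0)) = Z
    rw [map_zero, NormedSpace.exp_zero, sub_zero, add_zero]
    noncomm_ring)
  have h5 := h3.map_nhds_eq_of_equiv
  have h6 : (((fun Z => NormedSpace.exp (Pc Z)) * fun Z => 1 + (Z - Pc Z)) :
      Matrix (Fin n) (Fin n) F → Matrix (Fin n) (Fin n) F) 0 = 1 := by
    simp
  rw [h6] at h5
  exact h5

end LocalTheory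

/-! ### Orbits are closed in the topology of the field -/

/-- If a tuple of elements of an algebraic group `Γ` is such that the subspaces of the matrix space
stable under conjugation by the tuple are ranges of equivariant projections, then two elements of
`Γ ^ m` that are conjugate by a matrix close to the identity are conjugate under `Γ`. -/
theorem eventually_exists_mem_conj {F : Type*} [NontriviallyNormedField F] [CompleteSpace F]
    [CharZero F] {n m : ℕ} {Γ : Subgroup (GL (Fin n) F)} (hΓ : IsAlgebraicOver F Γ)
    (ρ : Fin m → GL (Fin n) F) (hρ : ∀ l, ρ l ∈ Γ)
    (hP : ∀ W : Submodule F (Matrix (Fin n) (Fin n) F),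
      (∀ l, ∀ Y ∈ W, (ρ l : Matrix (Fin n) (Fin n) F) * Y *
        ((ρ l)⁻¹ : GL (Fin n) F).val ∈ W) →
      ∃ P : Matrix (Fin n) (Fin n) F →ₗ[F] Matrix (Fin n) (Fin n) F,
        (∀ Y, P Y ∈ W) ∧ (∀ Y ∈ W, P Y = Y) ∧
        ∀ l Y, P ((ρ l : Matrix (Fin n) (Fin n) F) * Y * ((ρ l)⁻¹ : GL (Fin n) F).val) =
          (ρ l : Matrix (Fin n) (Fin n) F) * P Y * ((ρ l)⁻¹ : GL (Fin n) F).val) :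
    ∀ᶠ u in nhds (1 : Matrix (Fin n) (Fin n) F), ∀ g : GL (Fin n) F,
      (g : Matrix (Fin n) (Fin n) F) = u → (∀ l, g * ρ l * g⁻¹ ∈ Γ) →
      ∃ a ∈ Γ, ∀ l, g * ρ l * g⁻¹ = a * ρ l * a⁻¹ := by
  open scoped Matrix.Norms.Operator in
  obtain ⟨P, hPmem, hPid, hPeq⟩ := hP (tangentSpaceOne Γ)
    fun l Y hY => conj_mem_tangentSpaceOne (hρ l) hY
  obtain ⟨δ, hδ, htrans⟩ := exists_pos_transversal Γ P hPid
  have hcP : Continuous P := P.continuous_of_finiteDimensional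
  have hcQ : Continuous fun Z => Z - P Z := continuous_id.sub hcP
  have hsmall : ∀ φ : Matrix (Fin n) (Fin n) F → Matrix (Fin n) (Fin n) F, Continuous φ →
      φ 0 = 0 → ∀ᶠ Z in nhds 0, ‖φ Z‖ < δ := by
    intro φ hφ hφ0
    have h := (hφ.norm).tendsto 0
    rw [hφ0, norm_zero] at h
    exact h.eventually (gt_mem_nhds hδ)
  have hev : ∀ᶠ Z in nhds (0 : Matrix (Fin n) (Fin n) F),
      P Z ∈ Metric.eball (0 : Matrix (Fin n) (Fin n) F)
        (NormedSpace.expSeries F (Matrix (Fin n) (Fin n) F)).radius ∧ ‖Z - P Z‖ < δ ∧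
      ∀ l, ‖(ρ l : Matrix (Fin n) (Fin n) F) * (Z - P Z) *
        ((ρ l)⁻¹ : GL (Fin n) F).val‖ < δ := by
    refine Filter.Eventually.and ?_ (Filter.Eventually.and ?_ (Filter.eventually_all.2 fun l => ?_))
    · have h := hcP.tendsto 0
      rw [map_zero] at h
      exact h.eventually (Metric.eball_mem_nhds _ (expSeries_radius_pos_of_charZero F _))
    · exact hsmall _ hcQ (by simp)
    · exact hsmall _ ((continuous_const.mul hcQ).mul continuous_const) (by simp)
  have hmem := Filter.image_mem_map (m := fun Z => NormedSpace.exp (P Z) * (1 + (Z - P Z))) hev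
  rw [map_nhds_zero_exp_mul_one_add P] at hmem
  refine Filter.mem_of_superset hmem ?_
  rintro _ ⟨Z₀, ⟨hr, hZ, hZ'⟩, rfl⟩ g hg hgΓ
  obtain ⟨a, ha, haexp⟩ := exists_mem_coe_eq_exp hΓ (hPmem Z₀) hr
  refine ⟨a, ha, fun l => ?_⟩
  set Z := Z₀ - P Z₀ with hZdef
  have hPZ : P Z = 0 := by rw [hZdef, map_sub, hPid _ (hPmem _), sub_self]
  -- `g = a * b` with `a = exp Y ∈ Γ`; both `b` and its conjugate by `ρ l` lie in the transversal
  -- `1 + ker P`, and they lie in the same coset because `b * ρ l * b⁻¹ ∈ Γ`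
  set b : GL (Fin n) F := a⁻¹ * g with hb
  have hbZ : (b : Matrix (Fin n) (Fin n) F) = 1 + Z := by
    have h1 : (g : Matrix (Fin n) (Fin n) F) = a * (1 + Z) := hg.trans (by rw [haexp])
    rw [hb, Units.val_mul, h1]
    exact Units.inv_mul_cancel_left a _
  set Z' := (ρ l : Matrix (Fin n) (Fin n) F) * Z * ((ρ l)⁻¹ : GL (Fin n) F).val with hZ'def
  have hconj : ((ρ l * b * (ρ l)⁻¹ : GL (Fin n) F) : Matrix (Fin n) (Fin n) F) = 1 + Z' := by
    rw [Units.val_mul, Units.val_mul, hbZ, mul_add, add_mul, mul_one, Units.mul_inv]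
  have hE := htrans Z Z' ((b * (ρ l * b * (ρ l)⁻¹)⁻¹ : GL (Fin n) F).val - 1) hZ (hZ' l) hPZ
    (by rw [hZ'def, hPeq, hPZ, mul_zero, zero_mul])
    (by
      rw [← hconj, sub_mul, ← Units.val_mul, inv_mul_cancel_right, hbZ, one_mul, hconj]
      abel)
    ⟨b * (ρ l * b * (ρ l)⁻¹)⁻¹, by
      have h1 : b * (ρ l * b * (ρ l)⁻¹)⁻¹ = a⁻¹ * (g * ρ l * g⁻¹) * a * (ρ l)⁻¹ := by
        rw [hb]; group
      rw [h1]
      exact mul_mem (mul_mem (mul_mem (inv_mem ha) (hgΓ l)) ha) (inv_mem (hρ l)), by abel⟩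
  have h1 : b * (ρ l * b * (ρ l)⁻¹)⁻¹ = 1 := Units.ext (sub_eq_zero.1 hE)
  have h2 : b * ρ l = ρ l * b := by
    rw [mul_inv_eq_one] at h1
    calc b * ρ l = ρ l * b * (ρ l)⁻¹ * ρ l := by rw [← h1]
      _ = ρ l * b := by group
  have h3 : g = a * b := by rw [hb]; group
  calc g * ρ l * g⁻¹ = a * (b * ρ l) * b⁻¹ * a⁻¹ := by rw [h3]; group
    _ = a * ρ l * a⁻¹ := by rw [h2]; group

/-- The orbit of a semisimple tuple under simultaneous conjugation by an algebraic group `Γ` is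
closed in `Γ ^ m` for the topology of the ground field. Semisimplicity is tested over an extension
field `K` isomorphic to the complex numbers. -/
theorem exists_mem_conj_of_mem_closure {F K : Type*} [NontriviallyNormedField F] [CompleteSpace F]
    [CharZero F] [Field K] [IsAlgClosed K] [Algebra F K] (σ : K ≃+* ℂ) {n m : ℕ}
    {Γ : Subgroup (GL (Fin n) F)} (hΓ : IsAlgebraicOver F Γ) {ρ : Fin m → GL (Fin n) F}
    (hρ : ∀ l, ρ l ∈ Γ)
    (hss : IsSemisimpleTuple fun l =>
      ((ρ l : Matrix (Fin n) (Fin n) F)).map (algebraMap F K))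
    {τ : Fin m → GL (Fin n) F} (hτ : ∀ l, τ l ∈ Γ)
    (hcl : (fun l => (τ l : Matrix (Fin n) (Fin n) F)) ∈
      closure {y : Fin m → Matrix (Fin n) (Fin n) F |
        ∃ a ∈ Γ, ∀ l, y l = (a * ρ l * a⁻¹ : GL (Fin n) F).val}) :
    ∃ a ∈ Γ, ∀ l, τ l = a * ρ l * a⁻¹ := by
  set x : Fin m → Matrix (Fin n) (Fin n) F := fun l => (ρ l : Matrix (Fin n) (Fin n) F) with hx
  set y : Fin m → Matrix (Fin n) (Fin n) F := fun l => (τ l : Matrix (Fin n) (Fin n) F) with hy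
  have hsub : {y : Fin m → Matrix (Fin n) (Fin n) F |
      ∃ a ∈ Γ, ∀ l, y l = (a * ρ l * a⁻¹ : GL (Fin n) F).val} ⊆ conjClass x := by
    rintro y' ⟨a, -, hy'⟩
    exact ⟨a, (a⁻¹ : GL (Fin n) F).val, a.mul_inv, hy'⟩
  -- an `F`-linear retraction of `K` onto `F`
  obtain ⟨lam, hlam⟩ := (Algebra.linearMap F K).exists_leftInverse_of_injective
    (LinearMap.ker_eq_bot.2 (algebraMap F K).injective)
  have hlam1 : lam 1 = 1 := by
    have h := LinearMap.congr_fun hlam 1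
    simpa using h
  obtain ⟨s, c, hs⟩ := hss.exists_isSeparabilityElement
  have hsF := hs.descend lam hlam1
  have hycl : y ∈ closure (conjClass x) := closure_mono hsub hcl
  obtain ⟨u, hu, huy, hint⟩ := hsF.exists_intertwiner hycl
  -- the tuple `τ` is conjugate to `ρ` in `GL n F`, so the complements needed for the local
  -- statement are transported from `ρ` to `τ`
  obtain ⟨g, h, hgh, hgy⟩ := (isClosed_conjClass hsF).closure_subset hycl
  have hhg : h * g = 1 := mul_eq_one_comm.1 hgh
  have hback : ∀ l, x l = h * y l * g := fun l => by
    calc x l = (h * g) * x l * (h * g) := by rw [hhg, Matrix.one_mul, Matrix.mul_one]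
      _ = h * (g * x l * h) * g := by noncomm_ring
      _ = h * y l * g := by rw [hgy]
  have hcompl : HasConjComplements (fun l => (y l).map (algebraMap F K))
      (fun l => ((τ l)⁻¹ : GL (Fin n) F).val.map (algebraMap F K)) := by
    refine HasConjComplements.of_conj (g := h.map (algebraMap F K)) (h := g.map (algebraMap F K))
      (by rw [← Matrix.map_mul, hhg]; simp) ?_
    have h1 : (fun l => h.map (algebraMap F K) * (y l).map (algebraMap F K) *
        g.map (algebraMap F K)) = fun l => (x l).map (algebraMap F K) := by
      funext l
      rw [hback, Matrix.map_mul, Matrix.map_mul]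
    rw [h1]
    refine hss.hasConjComplements σ fun l => ?_
    rw [← Matrix.map_mul, ← Matrix.map_mul, ← Matrix.map_mul]
    have h2 : x l * (h * ((τ l)⁻¹ : GL (Fin n) F).val * g) = 1 := by
      rw [hback]
      calc h * y l * g * (h * ((τ l)⁻¹ : GL (Fin n) F).val * g)
          = h * (y l * (g * h) * ((τ l)⁻¹ : GL (Fin n) F).val) * g := by noncomm_ring
        _ = 1 := by rw [hgh, Matrix.mul_one, Units.mul_inv, Matrix.mul_one, hhg]
    rw [h2]
    simp
  have hlocal := eventually_exists_mem_conj hΓ τ hτ hcompl.exists_projection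
  have hut : Filter.Tendsto u (nhds y) (nhds 1) := huy ▸ hu.tendsto y
  have hdet : ∀ᶠ y' in nhds y, (u y').det ≠ 0 :=
    (isOpen_compl_singleton.preimage hu.matrix_det).mem_nhds (by simp [huy])
  obtain ⟨y', ⟨hy'1, hy'2⟩, a, ha, hay⟩ :=
    mem_closure_iff_nhds.1 hcl _ ((hut.eventually hlocal).and hdet)
  obtain ⟨v, hv⟩ : ∃ v : GL (Fin n) F, (v : Matrix (Fin n) (Fin n) F) = u y' :=
    ⟨GeneralLinearGroup.mkOfDetNeZero _ hy'2, rfl⟩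
  have hconj : ∀ l, v * τ l * v⁻¹ = a * ρ l * a⁻¹ := by
    intro l
    rw [mul_inv_eq_iff_eq_mul]
    refine Units.ext ?_
    have h1 := hint y' (hsub ⟨a, ha, hay⟩) l
    rw [hay, ← hv] at h1
    exact h1.symm
  obtain ⟨b, hb, hbτ⟩ := hy'1 v hv fun l => by
    rw [hconj]
    exact mul_mem (mul_mem ha (hρ l)) (inv_mem ha)
  refine ⟨b⁻¹ * a, mul_mem (inv_mem hb) ha, fun l => ?_⟩
  calc τ l = b⁻¹ * (b * τ l * b⁻¹) * b := by group
    _ = b⁻¹ * a * ρ l * (b⁻¹ * a)⁻¹ := by rw [← hbτ, hconj]; group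

/-! ### Lifting points of affine varieties -/

/-- Over an algebraically closed field, prime ideals with integral residue ring are the kernels of
points. -/
theorem Ideal.exists_algHom_ker_eq_of_isIntegral {K B : Type*} [Field K] [IsAlgClosed K]
    [CommRing B] [Algebra K B] (Q : Ideal B) [Q.IsPrime] [Algebra.IsIntegral K (B ⧸ Q)] :
    ∃ χ : B →ₐ[K] K, ∀ b, χ b = 0 ↔ b ∈ Q := by
  let e : K ≃ₐ[K] B ⧸ Q := AlgEquiv.ofBijective (Algebra.ofId K (B ⧸ Q))
    IsAlgClosed.algebraMap_bijective_of_isIntegral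
  refine ⟨(e.symm : (B ⧸ Q) →ₐ[K] K).comp (Ideal.Quotient.mkₐ K Q), fun b => ?_⟩
  change e.symm (Ideal.Quotient.mk Q b) = 0 ↔ _
  rw [EmbeddingLike.map_eq_zero_iff, Ideal.Quotient.eq_zero_iff_mem]

/-- A point is determined by its kernel. -/
theorem AlgHom.eq_of_forall_eq_zero {K B : Type*} [Field K] [CommRing B] [Algebra K B]
    {χ χ' : B →ₐ[K] K} (h : ∀ b, χ b = 0 → χ' b = 0) : χ' = χ := by
  ext b
  have h1 := h (b - algebraMap K B (χ b)) (by simp)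
  rw [map_sub, AlgHom.commutes, sub_eq_zero] at h1
  exact h1

/-- Points lift along integral ring extensions. -/
theorem AlgHom.exists_extension_of_isIntegral {K C B : Type*} [Field K] [IsAlgClosed K]
    [CommRing C] [CommRing B] [Algebra K C] [Algebra K B] (g : C →ₐ[K] B)
    (hg : g.toRingHom.IsIntegral) (χ : C →ₐ[K] K) (hker : ∀ c, g c = 0 → χ c = 0) :
    ∃ χ' : B →ₐ[K] K, ∀ c, χ' (g c) = χ c := by
  let : Algebra C B := g.toRingHom.toAlgebra
  have : Algebra.IsIntegral C B := ⟨hg⟩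
  have hp : (RingHom.ker χ).IsPrime := RingHom.ker_isPrime χ
  obtain ⟨Q, -, hQ, hQχ⟩ := Ideal.exists_ideal_over_prime_of_isIntegral (RingHom.ker χ)
    (⊥ : Ideal B) (fun c hc => hker c hc)
  have hmem : ∀ c, g c ∈ Q ↔ χ c = 0 := fun c => by
    rw [← RingHom.mem_ker (f := χ), ← hQχ]
    rfl
  have hconst : ∀ c, Ideal.Quotient.mk Q (g c) = algebraMap K (B ⧸ Q) (χ c) := by
    intro c
    have h1 : g (c - algebraMap K C (χ c)) ∈ Q := (hmem _).2 (by simp)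
    rw [map_sub, AlgHom.commutes, ← Ideal.Quotient.eq_zero_iff_mem, map_sub, sub_eq_zero] at h1
    exact h1
  have : Algebra.IsIntegral K (B ⧸ Q) := by
    refine ⟨fun b => ?_⟩
    obtain ⟨b, rfl⟩ := Ideal.Quotient.mk_surjective b
    obtain ⟨p, hp, hpb⟩ := hg b
    refine ⟨p.map (χ : C →+* K), hp.map _, ?_⟩
    rw [Polynomial.eval₂_map]
    have h1 : (algebraMap K (B ⧸ Q)).comp (χ : C →+* K) =
        (Ideal.Quotient.mk Q).comp g.toRingHom := RingHom.ext fun c => (hconst c).symm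
    rw [h1, ← Polynomial.hom_eval₂, hpb, map_zero]
  obtain ⟨χ', hχ'⟩ := Ideal.exists_algHom_ker_eq_of_isIntegral (K := K) Q
  refine ⟨χ', fun c => ?_⟩
  exact DFunLike.congr_fun (AlgHom.eq_of_forall_eq_zero (χ := χ) (χ' := χ'.comp g)
    fun c hc => (hχ' _).2 ((hmem c).2 hc)) c

/-- A constructible subset of an irreducible spectrum contains a neighbourhood of the generic point
or is disjoint from one. -/
theorem Topology.IsConstructible.exists_isOpen_bot_mem {B : Type*} [CommRing B] [IsDomain B]
    {s : Set (PrimeSpectrum B)} (hs : Topology.IsConstructible s) :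
    ∃ V : Set (PrimeSpectrum B), IsOpen V ∧ ⊥ ∈ V ∧ (V ⊆ s ∨ V ⊆ sᶜ) := by
  induction hs using Topology.IsConstructible.empty_union_induction with
  | open_retrocompact U hU _ =>
    by_cases h : ⊥ ∈ U
    · exact ⟨U, hU, h, Or.inl subset_rfl⟩
    · refine ⟨Set.univ, isOpen_univ, Set.mem_univ _, Or.inr fun p _ hp => h ?_⟩
      exact ((PrimeSpectrum.le_iff_specializes ⊥ p).1 bot_le).mem_open hU hp
  | union s hs t ht h1 h2 =>
    obtain ⟨V, hV, hbV, hVs⟩ := h1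
    obtain ⟨W, hW, hbW, hWt⟩ := h2
    refine ⟨V ∩ W, hV.inter hW, ⟨hbV, hbW⟩, ?_⟩
    rcases hVs with h | h
    · exact Or.inl fun p hp => Or.inl (h hp.1)
    · rcases hWt with h' | h'
      · exact Or.inl fun p hp => Or.inr (h' hp.2)
      · exact Or.inr fun p hp hp' => hp'.elim (h hp.1) (h' hp.2)
  | compl s hs h1 =>
    obtain ⟨V, hV, hbV, hVs⟩ := h1
    refine ⟨V, hV, hbV, hVs.symm.imp id fun h => ?_⟩
    rwa [compl_compl]

/-- Points lift generically along an injective homomorphism between algebras of finite type over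
an algebraically closed field, by Chevalley's theorem on images. -/
theorem AlgHom.exists_generic_extension {K B R : Type*} [Field K] [IsAlgClosed K] [CommRing B]
    [IsDomain B] [CommRing R] [IsDomain R] [Algebra K B] [Algebra K R] [Algebra.FiniteType K B]
    [Algebra.FiniteType K R] (g : B →ₐ[K] R) (hg : Function.Injective g) :
    ∃ f : B, f ≠ 0 ∧ ∀ χ : B →ₐ[K] K, χ f ≠ 0 → ∃ χ' : R →ₐ[K] K, ∀ b, χ' (g b) = χ b := by
  have : IsNoetherianRing B := Algebra.FiniteType.isNoetherianRing K B
  have hft : (g : B →+* R).FiniteType := by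
    refine RingHom.FiniteType.of_comp_finiteType (f := algebraMap K B) ?_
    rw [AlgHom.comp_algebraMap]
    exact RingHom.finiteType_algebraMap.2 inferInstance
  have hc := PrimeSpectrum.isConstructible_range_comap
    (RingHom.FinitePresentation.of_finiteType.1 hft)
  obtain ⟨V, hV, hbV, hVs⟩ := hc.exists_isOpen_bot_mem
  have hbot : (⊥ : PrimeSpectrum B) ∈ Set.range (PrimeSpectrum.comap (g : B →+* R)) := by
    refine ⟨⊥, PrimeSpectrum.ext ?_⟩
    ext b
    change g b = 0 ↔ b = 0
    exact map_eq_zero_iff g hg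
  -- the generic point is in the image, so that the image contains an open set
  have hVr := hVs.resolve_right fun h => h hbV hbot
  obtain ⟨_, ⟨f, rfl⟩, hbf, hfV⟩ :=
    PrimeSpectrum.isTopologicalBasis_basic_opens.exists_subset_of_mem_open hbV hV
  refine ⟨f, fun h0 => hbf (by simp [h0]), fun χ hχ => ?_⟩
  obtain ⟨p, hp⟩ := hVr (hfV (show (⟨RingHom.ker χ, RingHom.ker_isPrime χ⟩ : PrimeSpectrum B) ∈
    (PrimeSpectrum.basicOpen f : Set (PrimeSpectrum B)) from hχ))
  obtain ⟨M, hM, hpM⟩ := Ideal.exists_le_maximal p.asIdeal p.2.ne_top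
  let := Ideal.Quotient.field M
  have : Module.Finite K (R ⧸ M) := finite_of_finite_type_of_isJacobsonRing K (R ⧸ M)
  obtain ⟨χ', hχ'⟩ := Ideal.exists_algHom_ker_eq_of_isIntegral (K := K) M
  refine ⟨χ', fun b => ?_⟩
  refine DFunLike.congr_fun (AlgHom.eq_of_forall_eq_zero (χ := χ) (χ' := χ'.comp g)
    fun c hc => (hχ' _).2 (hpM ?_)) b
  have h1 : c ∈ (PrimeSpectrum.comap (g : B →+* R) p).asIdeal := by
    rw [hp]
    exact hc
  exact h1

/-! ### Zariski closure and topological closure -/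

/-- Pointwise bounded families of points have limits along ultrafilters. -/
theorem AlgHom.exists_tendsto_of_bounded {K B J : Type*} [NormedField K] [ProperSpace K]
    [CommRing B] [Algebra K B] (𝒰 : Ultrafilter J) (χ : J → B →ₐ[K] K)
    (hχ : ∀ b, ∃ C : ℝ, ∀ᶠ j in (𝒰 : Filter J), ‖χ j b‖ ≤ C) :
    ∃ χ' : B →ₐ[K] K, ∀ b, Filter.Tendsto (fun j => χ j b) 𝒰 (nhds (χ' b)) := by
  have hlim : ∀ b, ∃ a, Filter.Tendsto (fun j => χ j b) 𝒰 (nhds a) := by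
    intro b
    obtain ⟨C, hC⟩ := hχ b
    obtain ⟨a, -, ha⟩ := (isCompact_closedBall (0 : K) C).ultrafilter_le_nhds
      (𝒰.map fun j => χ j b) (by
        rw [Ultrafilter.coe_map, Filter.le_principal_iff, Filter.mem_map]
        filter_upwards [hC] with j hj
        simpa using hj)
    exact ⟨a, ha⟩
  choose a ha using hlim
  refine ⟨AlgHom.ofLinearMap
    { toFun := a
      map_add' := fun b c => tendsto_nhds_unique (ha _) (by simpa using (ha b).add (ha c))
      map_smul' := fun r b => tendsto_nhds_unique (ha _) (by simpa using (ha b).const_mul r) }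
    (tendsto_nhds_unique (ha _) (by simp))
    (fun b c => tendsto_nhds_unique (ha _) (by simpa using (ha b).mul (ha c))), ha⟩

/-- The product of the roots of a monic polynomial is its constant term up to sign, so one of the
roots is small when the constant term is. -/
theorem Polynomial.Monic.exists_root_norm_pow_le {K : Type*} [NormedField K] [IsAlgClosed K]
    {p : Polynomial K} (hp : p.Monic) (hd : p.natDegree ≠ 0) :
    ∃ β, p.IsRoot β ∧ ‖β‖ ^ p.natDegree ≤ ‖p.coeff 0‖ := by
  by_contra! hcon
  have hs := IsAlgClosed.splits p
  have h1 : ∀ s : Multiset K, s ≤ p.roots → s ≠ 0 →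
      ‖p.coeff 0‖ ^ s.card < ‖s.prod‖ ^ p.natDegree := by
    intro s
    induction s using Multiset.induction_on with
    | empty => intro _ h; exact absurd rfl h
    | cons β s ih =>
      intro hle _
      have hβ : p.IsRoot β := (Polynomial.mem_roots'.1
        (Multiset.mem_of_le hle (Multiset.mem_cons_self β s))).2
      have h2 := hcon β hβ
      rw [Multiset.card_cons, Multiset.prod_cons, norm_mul, mul_pow, pow_succ']
      by_cases hs0 : s = 0
      · subst hs0
        simpa using h2
      · exact mul_lt_mul'' h2 (ih ((Multiset.le_cons_self s β).trans hle) hs0) (norm_nonneg _)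
          (by positivity)
  have hcard : p.roots.card = p.natDegree := hs.natDegree_eq_card_roots.symm
  have h3 := h1 p.roots le_rfl (by
    intro h0
    rw [h0] at hcard
    exact hd hcard.symm)
  have h4 := hs.coeff_zero_eq_prod_roots_of_monic hp
  rw [hcard] at h3
  refine h3.ne ?_
  rw [h4, norm_mul, norm_pow, norm_neg, norm_one, one_pow, one_mul]

/-- The set where a nonzero polynomial does not vanish is dense. -/
theorem MvPolynomial.nhdsWithin_eval_ne_zero_neBot {K ι : Type*} [NontriviallyNormedField K]
    [Finite ι] {q : MvPolynomial ι K} (hq : q ≠ 0) (t₀ : ι → K) :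
    (nhdsWithin t₀ {t | eval t q ≠ 0}).NeBot := by
  obtain ⟨v, hv⟩ : ∃ v, eval v q ≠ 0 := by
    by_contra! h
    exact hq (MvPolynomial.funext fun v => by rw [h, map_zero])
  let line : K → ι → K := fun s i => t₀ i + s * (v i - t₀ i)
  let P : Polynomial K := aeval (fun i => Polynomial.C (t₀ i) + Polynomial.X *
    Polynomial.C (v i - t₀ i)) q
  have hP : ∀ s, P.eval s = eval (line s) q := by
    intro s
    have h : (Polynomial.aeval s).comp (aeval (fun i => Polynomial.C (t₀ i) + Polynomial.X *
        Polynomial.C (v i - t₀ i)) : MvPolynomial ι K →ₐ[K] Polynomial K) = aeval (line s) := by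
      refine algHom_ext fun i => ?_
      simp [line]
    have h2 := DFunLike.congr_fun h q
    simpa [P, aeval_eq_eval] using h2
  have hP0 : P ≠ 0 := by
    intro h0
    have h := hP 1
    rw [h0, Polynomial.eval_zero] at h
    refine hv (h.symm ▸ ?_)
    congr 1
    congr 1
    funext i
    simp [line]
  have hline : Continuous line := continuous_pi fun i => by fun_prop
  have h0 : line 0 = t₀ := by
    funext i
    simp [line]
  rw [← mem_closure_iff_nhdsWithin_neBot, ← h0]
  refine mem_closure_of_tendsto (b := nhdsWithin 0 {0}ᶜ)
    ((hline.tendsto 0).mono_left nhdsWithin_le_nhds) ?_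
  have hfin : ({s | P.IsRoot s} \ {0}).Finite :=
    (Polynomial.finite_setOfPred_isRoot hP0).subset Set.sdiff_subset
  filter_upwards [self_mem_nhdsWithin, mem_nhdsWithin_of_mem_nhds
    (hfin.isClosed.isOpen_compl.mem_nhds (x := 0) fun h => h.2 rfl)] with s hs hs'
  rw [← hP]
  exact fun h => hs' ⟨h, hs⟩

/-- The roots of a monic polynomial are bounded as long as the coefficients are. -/
theorem Polynomial.norm_le_of_isRoot_of_monic {K : Type*} [NormedField K] {p : Polynomial K}
    (hp : p.Monic) {M : NNReal} (hM : ∀ i < p.natDegree, ‖p.coeff i‖₊ ≤ M) {z : K}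
    (hz : p.IsRoot z) : ‖z‖ ≤ M + 1 := by
  have h1 := hz.norm_lt_cauchyBound hp.ne_zero
  have h2 : p.cauchyBound ≤ M + 1 := by
    rw [Polynomial.cauchyBound, hp.leadingCoeff, nnnorm_one, div_one]
    gcongr
    exact Finset.sup_le fun i hi => hM i (Finset.mem_range.1 hi)
  exact_mod_cast h1.le.trans h2

/-- On an irreducible affine variety over a locally compact algebraically closed field, the points
where a nonzero function `f` does not vanish are dense for the topology of the field. By Noether
normalization the variety is finite over an affine space `A`. A function `γ` that vanishes at the
point `χ₀` but not at the other points of its fibre has a minimal polynomial over `A` whose constant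
term vanishes below `χ₀`. Thus over nearby points of `A` there are points of the variety where `γ`
is small, and by compactness of the fibres these converge to `χ₀`. -/
theorem AlgHom.exists_mem_of_ne_zero {K B ι : Type*} [NontriviallyNormedField K] [ProperSpace K]
    [IsAlgClosed K] [CommRing B] [IsDomain B] [Algebra K B] [_root_.Finite ι] (b : ι → B)
    (hb : Algebra.adjoin K (Set.range b) = ⊤) {f : B} (hf : f ≠ 0) (χ₀ : B →ₐ[K] K)
    {U : Set (ι → K)} (hU : U ∈ nhds fun i => χ₀ (b i)) :
    ∃ χ : B →ₐ[K] K, χ f ≠ 0 ∧ (fun i => χ (b i)) ∈ U := by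
  classical
  have hft : Algebra.FiniteType K B := ⟨Subalgebra.fg_def.2 ⟨_, Set.finite_range b, hb⟩⟩
  obtain ⟨d, g, ginj, gint⟩ := exists_integral_inj_algHom_of_fg K B
  let : Algebra (MvPolynomial (Fin d) K) B := g.toRingHom.toAlgebra
  have halg : ∀ a, algebraMap (MvPolynomial (Fin d) K) B a = g a := fun _ => rfl
  have : IsScalarTower K (MvPolynomial (Fin d) K) B :=
    IsScalarTower.of_algebraMap_eq fun r => (g.commutes r).symm
  have : Algebra.IsIntegral (MvPolynomial (Fin d) K) B := ⟨gint⟩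
  have : FaithfulSMul (MvPolynomial (Fin d) K) B :=
    (faithfulSMul_iff_algebraMap_injective _ _).2 ginj
  let t₀ : Fin d → K := fun i => χ₀ (g (X i))
  have ht₀ : ∀ a, χ₀ (g a) = eval t₀ a := by
    intro a
    rw [← aeval_eq_eval]
    exact DFunLike.congr_fun (algHom_ext (f := χ₀.comp g) (g := aeval t₀)
      fun i => by simp [t₀]) a
  -- a function `q ≠ 0` on the affine space that is divisible by `f`: if `q` does not vanish below a
  -- point, then `f` does not vanish at this point
  obtain ⟨q, hq, c, hqc⟩ : ∃ q : MvPolynomial (Fin d) K, q ≠ 0 ∧ ∃ c, g q = f * c := by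
    have h1 := Ideal.comap_ne_bot_of_integral_mem (R := MvPolynomial (Fin d) K) hf
      (Ideal.mem_span_singleton_self f) (Algebra.IsIntegral.isIntegral f)
    obtain ⟨q, hq, hq0⟩ := Submodule.exists_mem_ne_zero_of_ne_bot h1
    exact ⟨q, hq0, Ideal.mem_span_singleton.1 hq⟩
  -- the fibre of `χ₀` is finite, since every `b i` is a root of a monic polynomial
  have hfib : {χ : B →ₐ[K] K | ∀ a, χ (g a) = χ₀ (g a)}.Finite := by
    choose P hPm hP using fun i => gint (b i)
    refine Set.Finite.of_injOn (f := fun (χ : B →ₐ[K] K) i => χ (b i))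
      (t := {w | ∀ i, w i ∈ {z | ((P i).map ((χ₀.comp g : _ →ₐ[K] K) : _ →+* K)).IsRoot z}})
      (fun χ hχ i => ?_) (fun χ _ χ' _ h => ?_)
      (Set.Finite.pi' fun i => Polynomial.finite_setOfPred_isRoot ((hPm i).map _).ne_zero)
    · change Polynomial.eval _ _ = 0
      have h1 : ((χ₀.comp g : _ →ₐ[K] K) : MvPolynomial (Fin d) K →+* K) =
          (χ : B →+* K).comp g.toRingHom := RingHom.ext fun a => (hχ a).symm
      rw [Polynomial.eval_map, h1]
      change Polynomial.eval₂ _ ((χ : B →+* K) (b i)) _ = 0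
      rw [← Polynomial.hom_eval₂, hP, map_zero]
    · refine AlgHom.ext_of_adjoin_eq_top hb ?_
      rintro _ ⟨i, rfl⟩
      exact congrFun h i
  -- prime avoidance gives `γ` in the kernel of `χ₀` but in no other kernel of the fibre
  obtain ⟨γ, hγ0, hγ⟩ : ∃ γ : B, χ₀ γ = 0 ∧
      ∀ χ : B →ₐ[K] K, (∀ a, χ (g a) = χ₀ (g a)) → χ γ = 0 → χ = χ₀ := by
    by_contra! hcon
    obtain ⟨χ, hχ, hle⟩ := (Ideal.subset_union_prime (I := RingHom.ker χ₀)
      (f := fun χ : B →ₐ[K] K => RingHom.ker χ) (s := hfib.toFinset.erase χ₀) χ₀ χ₀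
      fun χ _ _ _ => RingHom.ker_isPrime χ).1 (by
        intro γ hγ
        obtain ⟨χ, hχ, hχγ, hne⟩ := hcon γ hγ
        exact Set.mem_biUnion (Finset.mem_coe.2 (Finset.mem_erase.2
          ⟨hne, hfib.mem_toFinset.2 hχ⟩)) hχγ)
    exact (Finset.mem_erase.1 hχ).1 (AlgHom.eq_of_forall_eq_zero fun x hx => hle hx)
  have hγi : IsIntegral (MvPolynomial (Fin d) K) γ := Algebra.IsIntegral.isIntegral γ
  set p := minpoly (MvPolynomial (Fin d) K) γ with hp
  have hpm : p.Monic := minpoly.monic hγi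
  have hpd : p.natDegree ≠ 0 := (minpoly.natDegree_pos hγi).ne'
  have hroot : ∀ t : Fin d → K, ∃ β, (p.map (eval t)).IsRoot β ∧
      ‖β‖ ^ p.natDegree ≤ ‖eval t (p.coeff 0)‖ := by
    intro t
    have hd : (p.map (eval t)).natDegree = p.natDegree := hpm.natDegree_map _
    obtain ⟨β, hβ, hle⟩ := (hpm.map (eval t)).exists_root_norm_pow_le (by rwa [hd])
    rw [hd, Polynomial.coeff_map] at hle
    exact ⟨β, hβ, hle⟩
  choose β hβ hβle using hroot
  -- as affine space is normal, the subalgebra generated by `γ` is the quotient of a polynomial ring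
  -- by the minimal polynomial, so that the root `β t` defines a point, which lifts to `B`
  have hpt : ∀ t : Fin d → K, ∃ χ : B →ₐ[K] K, (∀ a, χ (g a) = eval t a) ∧ χ γ = β t := by
    intro t
    let g' : Polynomial (MvPolynomial (Fin d) K) →ₐ[K] B := (Polynomial.aeval γ).restrictScalars K
    have hg' : g'.toRingHom.IsIntegral := by
      refine RingHom.IsIntegral.tower_top (Polynomial.C) g'.toRingHom ?_
      have h1 : g'.toRingHom.comp Polynomial.C = g.toRingHom :=
        RingHom.ext fun a => Polynomial.aeval_C γ a
      rw [h1]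
      exact gint
    let χt : Polynomial (MvPolynomial (Fin d) K) →ₐ[K] K :=
      Polynomial.eval₂AlgHom (aeval t) (β t) fun a => Commute.all _ _
    have hχt : ∀ c, χt c = Polynomial.eval₂ (aeval t : MvPolynomial (Fin d) K →ₐ[K] K).toRingHom
      (β t) c := fun c => rfl
    have hev : (aeval t : MvPolynomial (Fin d) K →ₐ[K] K).toRingHom = eval t :=
      RingHom.ext fun a => by
        change aeval t a = _
        rw [aeval_eq_eval]
    obtain ⟨χ, hχ⟩ := AlgHom.exists_extension_of_isIntegral g' hg' χt fun c hc => by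
      obtain ⟨e, rfl⟩ := minpoly.isIntegrallyClosed_dvd hγi (p := c) hc
      have h1 : χt p = 0 := by
        rw [hχt, hev, ← Polynomial.eval_map]
        exact hβ t
      rw [map_mul, h1, zero_mul]
    refine ⟨χ, fun a => ?_, ?_⟩
    · have h1 := hχ (Polynomial.C a)
      rw [hχt, Polynomial.eval₂_C, hev] at h1
      rw [← h1]
      congr 1
      exact (Polynomial.aeval_C γ a).symm
    · have h1 := hχ Polynomial.X
      rw [hχt, Polynomial.eval₂_X] at h1
      rw [← h1]
      congr 1
      exact (Polynomial.aeval_X γ).symm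
  choose χ hχg hχγ using hpt
  have := nhdsWithin_eval_ne_zero_neBot hq t₀
  let 𝒰 := Ultrafilter.of (nhdsWithin t₀ {t | eval t q ≠ 0})
  have h𝒰 : (𝒰 : Filter (Fin d → K)) ≤ nhdsWithin t₀ {t | eval t q ≠ 0} := Ultrafilter.of_le _
  have hlim : ∀ a : MvPolynomial (Fin d) K,
      Filter.Tendsto (fun t => eval t a) 𝒰 (nhds (eval t₀ a)) := fun a =>
    ((MvPolynomial.continuous_eval a).tendsto t₀).mono_left (h𝒰.trans nhdsWithin_le_nhds)
  -- the points `χ t` are bounded as `t` tends to `t₀`, by integrality, so that they have a limit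
  obtain ⟨χ', hχ'⟩ := AlgHom.exists_tendsto_of_bounded 𝒰 χ fun x => by
    obtain ⟨P, hPm, hP⟩ := gint x
    obtain ⟨M, hM⟩ : ∃ M : NNReal, ∀ i ∈ Finset.range P.natDegree, ‖eval t₀ (P.coeff i)‖₊ < M :=
      ⟨(Finset.range P.natDegree).sup (fun i => ‖eval t₀ (P.coeff i)‖₊) + 1, fun i hi =>
        (Finset.le_sup (f := fun i => ‖eval t₀ (P.coeff i)‖₊) hi).trans_lt (lt_add_one _)⟩
    refine ⟨M + 1, ?_⟩
    have h1 : ∀ᶠ t in (𝒰 : Filter (Fin d → K)), ∀ i ∈ Finset.range P.natDegree,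
        ‖eval t (P.coeff i)‖₊ < M := (Finset.eventually_all _).2 fun i hi =>
      ((hlim (P.coeff i)).nnnorm).eventually (gt_mem_nhds (hM i hi))
    filter_upwards [h1] with t ht
    refine Polynomial.norm_le_of_isRoot_of_monic (hPm.map (eval t)) (fun i hi => ?_) ?_
    · rw [hPm.natDegree_map] at hi
      rw [Polynomial.coeff_map]
      exact (ht i (Finset.mem_range.2 hi)).le
    · change Polynomial.eval _ _ = 0
      have h2 : (eval t : MvPolynomial (Fin d) K →+* K) =
          (χ t : B →+* K).comp g.toRingHom := RingHom.ext fun a => (hχg t a).symm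
      rw [Polynomial.eval_map, h2]
      change Polynomial.eval₂ _ ((χ t : B →+* K) x) _ = 0
      rw [← Polynomial.hom_eval₂, hP, map_zero]
  have hχ'0 : χ' = χ₀ := by
    refine hγ χ' (fun a => ?_) ?_
    · rw [ht₀]
      refine tendsto_nhds_unique (hχ' (g a)) ?_
      simp_rw [hχg]
      exact hlim a
    · have h0 : eval t₀ (p.coeff 0) = 0 := by
        have h1 : (χ₀ : B →+* K) (Polynomial.eval₂ g.toRingHom γ p) = 0 := by
          have h2 : Polynomial.eval₂ g.toRingHom γ p = 0 := minpoly.aeval _ γ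
          rw [h2, map_zero]
        have h3 : (χ₀ : B →+* K) γ = 0 := hγ0
        rw [Polynomial.hom_eval₂, h3, Polynomial.eval₂_at_zero] at h1
        rw [← ht₀]
        exact h1
      have h1 : ‖χ' γ‖ ^ p.natDegree ≤ ‖eval t₀ (p.coeff 0)‖ := by
        refine le_of_tendsto_of_tendsto ((hχ' γ).norm.pow _) (hlim (p.coeff 0)).norm
          (Filter.Eventually.of_forall fun t => ?_)
        change ‖χ t γ‖ ^ _ ≤ _
        rw [hχγ]
        exact hβle t
      rw [h0, norm_zero] at h1
      exact norm_eq_zero.1 (eq_zero_of_pow_eq_zero (h1.antisymm (by positivity)))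
  rw [hχ'0] at hχ'
  have h1 : ∀ᶠ t in (𝒰 : Filter (Fin d → K)), (fun i => χ t (b i)) ∈ U :=
    (tendsto_pi_nhds.2 fun i => hχ' (b i)).eventually hU
  obtain ⟨t, htU, htq⟩ := (h1.and (h𝒰 self_mem_nhdsWithin)).exists
  refine ⟨χ t, fun h0 => htq ?_, htU⟩
  rw [← hχg, hqc, map_mul, h0, zero_mul]

/-- The Zariski closure of the image of an affine variety under a polynomial map is contained in
the closure for the topology of a locally compact algebraically closed field. -/
theorem MvPolynomial.mem_closure_image_zeroLocus {K r s : Type*} [NontriviallyNormedField K]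
    [ProperSpace K] [IsAlgClosed K] [Finite r] [Finite s] (I : Ideal (MvPolynomial r K))
    (φ : s → MvPolynomial r K) (t₀ : s → K)
    (h : ∀ f : MvPolynomial s K, (∀ z ∈ zeroLocus K I, eval (fun j => eval z (φ j)) f = 0) →
      eval t₀ f = 0) :
    t₀ ∈ closure ((fun z j => eval z (φ j)) '' zeroLocus K I) := by
  let ψ : MvPolynomial s K →ₐ[K] MvPolynomial r K ⧸ I :=
    aeval fun j => Ideal.Quotient.mkₐ K I (φ j)
  have hψ : ∀ f, ψ f = Ideal.Quotient.mkₐ K I (aeval φ f) := by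
    intro f
    exact DFunLike.congr_fun (algHom_ext (f := ψ)
      (g := (Ideal.Quotient.mkₐ K I).comp (aeval φ)) fun j => by simp [ψ]) f
  have hle : Ideal.comap (ψ : MvPolynomial s K →+* MvPolynomial r K ⧸ I) ⊥ ≤
      RingHom.ker (aeval t₀ : MvPolynomial s K →ₐ[K] K) := by
    intro f hf
    rw [RingHom.mem_ker, aeval_eq_eval]
    refine h f fun z hz => ?_
    have h1 : aeval φ f ∈ I := by
      have h2 : ψ f = 0 := hf
      rw [hψ] at h2
      exact Ideal.Quotient.eq_zero_iff_mem.1 h2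
    have h2 : aeval z (aeval φ f) = 0 := hz _ h1
    have h3 := DFunLike.congr_fun (algHom_ext
      (f := (aeval z : MvPolynomial r K →ₐ[K] K).comp (aeval φ))
      (g := aeval fun j => eval z (φ j)) fun j => by simp [aeval_eq_eval]) f
    rw [AlgHom.comp_apply, h2, aeval_eq_eval] at h3
    exact h3.symm
  have hprime : (RingHom.ker (aeval t₀ : MvPolynomial s K →ₐ[K] K)).IsPrime :=
    RingHom.ker_isPrime _
  -- a component of the closure of the image through `t₀`, and a component of the variety that
  -- dominates it: a minimal prime over the kernel of `ψ` is the contraction of a prime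
  obtain ⟨Q, hQ, hQle⟩ := Ideal.exists_minimalPrimes_le hle
  have hQp : Q.IsPrime := hQ.1.1
  obtain ⟨P, hP, -, hPQ⟩ := Ideal.exists_comap_eq_of_mem_minimalPrimes
    (ψ : MvPolynomial s K →+* MvPolynomial r K ⧸ I) Q hQ
  let g : (MvPolynomial s K ⧸ Q) →ₐ[K] (MvPolynomial r K ⧸ I) ⧸ P :=
    Ideal.quotientMapₐ P ψ hPQ.ge
  have hg : Function.Injective g := Ideal.quotientMap_injective'
    (f := (ψ : MvPolynomial s K →+* MvPolynomial r K ⧸ I)) (H := hPQ.ge) hPQ.le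
  obtain ⟨f, hf, hlift⟩ := AlgHom.exists_generic_extension (K := K)
    (B := MvPolynomial s K ⧸ Q) (R := (MvPolynomial r K ⧸ I) ⧸ P) g hg
  let χ₀ : (MvPolynomial s K ⧸ Q) →ₐ[K] K := Ideal.Quotient.liftₐ Q (aeval t₀) fun a ha => hQle ha
  refine mem_closure_iff_nhds.2 fun U hU => ?_
  let b : s → MvPolynomial s K ⧸ Q := fun j => Ideal.Quotient.mkₐ K Q (X j)
  have hb : Algebra.adjoin K (Set.range b) = ⊤ := by
    have h1 : Set.range b = Ideal.Quotient.mkₐ K Q '' Set.range X := (Set.range_comp _ _)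
    rw [h1, ← AlgHom.map_adjoin, MvPolynomial.adjoin_range_X, Algebra.map_top]
    exact (AlgHom.range_eq_top _).2 (Ideal.Quotient.mkₐ_surjective K Q)
  have hχ₀ : (fun j => χ₀ (b j)) = t₀ := by
    funext j
    change aeval t₀ (X j) = _
    rw [aeval_X]
  obtain ⟨χ, hχf, hχU⟩ := AlgHom.exists_mem_of_ne_zero b hb hf χ₀ (U := U) (by rwa [hχ₀])
  obtain ⟨χ', hχ'⟩ := hlift χ hχf
  -- a point of the variety above `χ`
  let θ : MvPolynomial r K →ₐ[K] K :=
    (χ'.comp (Ideal.Quotient.mkₐ K P)).comp (Ideal.Quotient.mkₐ K I)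
  have hθ : ∀ a, θ a = eval (fun i => θ (X i)) a := by
    intro a
    rw [← aeval_eq_eval]
    exact DFunLike.congr_fun (algHom_ext (f := θ) (g := aeval fun i => θ (X i))
      fun i => by simp) a
  refine ⟨fun j => eval (fun i => θ (X i)) (φ j), ?_, fun i => θ (X i), fun a ha => ?_, rfl⟩
  · have h1 : (fun j => eval (fun i => θ (X i)) (φ j)) = fun j => χ (b j) := by
      funext j
      rw [← hθ, ← hχ']
      change χ' (Ideal.Quotient.mk P (Ideal.Quotient.mk I (φ j))) =
        χ' (Ideal.Quotient.mk P (ψ (X j)))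
      rw [hψ, aeval_X]
      rfl
    rw [h1]
    exact hχU
  · rw [aeval_eq_eval, ← hθ]
    change χ' (Ideal.Quotient.mk P (Ideal.Quotient.mk I a)) = 0
    rw [Ideal.Quotient.eq_zero_iff_mem.2 ha, map_zero, map_zero]

/-! ### Orbits of homomorphisms over local fields -/

/-- An algebraic closure of a local field of characteristic zero is isomorphic to `ℂ` as a field:
both are algebraically closed of characteristic zero with the cardinality of the continuum. -/
theorem nonempty_ringEquiv_complex (k K : Type*) [NontriviallyNormedField k]
    [LocallyCompactSpace k] [CharZero k] [Field K] [Algebra k K] [IsAlgClosure k K] :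
    Nonempty (K ≃+* ℂ) := by
  have : ProperSpace k := ProperSpace.of_locallyCompactSpace k
  have : IsAlgClosed K := IsAlgClosure.isAlgClosed k
  have : Algebra.IsAlgebraic k K := IsAlgClosure.isAlgebraic
  have : CharZero K := charZero_of_injective_algebraMap (algebraMap k K).injective
  have hk1 : Cardinal.continuum ≤ Cardinal.mk k :=
    continuum_le_cardinal_of_nontriviallyNormedField k
  have hk2 : Cardinal.mk k ≤ Cardinal.continuum := by
    obtain ⟨f, -, hf⟩ := exists_nat_nat_continuous_surjective_of_completeSpace k
    have h1 := Cardinal.mk_le_of_surjective (f := fun x : ULift (ℕ → ℕ) => f x.down)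
      (hf.comp ULift.down_surjective)
    refine h1.trans ?_
    rw [Cardinal.mk_uLift, Cardinal.lift_le_continuum]
    simp
  have hK : Cardinal.lift.{0} (Cardinal.mk K) = Cardinal.lift (Cardinal.mk ℂ) := by
    rw [Cardinal.mk_complex, Cardinal.lift_continuum, Cardinal.lift_id']
    refine le_antisymm ?_ ?_
    · have h1 := Algebra.IsAlgebraic.lift_cardinalMk_le_max k K
      rw [le_antisymm hk2 hk1, Cardinal.lift_continuum,
        max_eq_left Cardinal.aleph0_le_continuum] at h1
      exact Cardinal.lift_le_continuum.1 h1
    · have h1 := Cardinal.lift_mk_le_lift_mk_of_injective (algebraMap k K).injective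
      rw [le_antisymm hk2 hk1, Cardinal.lift_continuum] at h1
      exact Cardinal.continuum_le_lift.1 h1
  have hK' : Cardinal.aleph0 < Cardinal.mk K := by
    rw [Cardinal.mk_complex, Cardinal.lift_continuum, Cardinal.lift_id'] at hK
    rw [hK]
    exact Cardinal.aleph0_lt_continuum
  exact IsAlgClosed.ringEquiv_of_equiv_of_charZero hK' (Cardinal.lift_mk_eq'.1 hK)

/-- Subspaces stable under the generators are stable under the whole group. -/
theorem IsCompletelyReducible.isSemisimpleTuple {D K : Type*} [Group D] [Field K] {n m : ℕ}
    {H : Subgroup (GL (Fin n) K)} {ρ : D →* H} (hρ : IsCompletelyReducible ρ) {g : Fin m → D}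
    (hg : Subgroup.closure (Set.range g) = ⊤) :
    IsSemisimpleTuple fun l => (ρ (g l) : GL (Fin n) K).val := by
  intro W hW
  have hrep : ∀ d v, linearRep ρ d v = (ρ d : GL (Fin n) K).val *ᵥ v := fun d v => by
    rw [linearRep]
    rfl
  have hstab : ∀ d : D, ∀ v ∈ W, linearRep ρ d v ∈ W := by
    intro d
    induction (hg ▸ Subgroup.mem_top d : d ∈ Subgroup.closure (Set.range g)) using
      Subgroup.closure_induction with
    | mem d hd =>
      obtain ⟨l, rfl⟩ := hd
      intro v hv
      rw [hrep]
      exact hW l v hv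
    | one =>
      intro v hv
      rw [map_one]
      exact hv
    | mul a b _ _ ha hb =>
      intro v hv
      rw [map_mul]
      exact ha _ (hb _ hv)
    | inv a _ ha =>
      -- an injective endomorphism of a finite dimensional space that preserves `W` maps it onto `W`
      have hinj : Function.Injective (linearRep ρ a) := by
        refine Function.LeftInverse.injective (g := linearRep ρ a⁻¹) fun v => ?_
        rw [← Module.End.mul_apply, ← map_mul, inv_mul_cancel, map_one]
        rfl
      have hmap : W.map (linearRep ρ a) = W := by
        refine Submodule.eq_of_le_of_finrank_eq (Submodule.map_le_iff_le_comap.2 ha) ?_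
        exact (Submodule.equivMapOfInjective _ hinj W).symm.finrank_eq
      intro v hv
      rw [← hmap] at hv
      obtain ⟨w, hw, rfl⟩ := hv
      rw [← Module.End.mul_apply, ← map_mul, inv_mul_cancel, map_one]
      exact hw
  have hρ' : ComplementedLattice (Subrepresentation (linearRep ρ)) := hρ
  obtain ⟨W', hW'⟩ := exists_isCompl (⟨W, hstab⟩ : Subrepresentation (linearRep ρ))
  refine ⟨W'.toSubmodule, ⟨?_, ?_⟩, fun l v hv => ?_⟩
  · have h := congrArg Subrepresentation.toSubmodule hW'.inf_eq_bot
    exact disjoint_iff.2 h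
  · have h := congrArg Subrepresentation.toSubmodule hW'.sup_eq_top
    exact codisjoint_iff.2 h
  · rw [← hrep]
    exact W'.apply_mem_toSubmodule (g l) hv

/-- Conjugacy of homomorphisms can be checked on generators. -/
theorem mem_conjOrbit_iff {D F : Type*} [Group D] [Field F] {n m : ℕ}
    {H : Subgroup (GL (Fin n) F)} {π τ : D →* H} {g : Fin m → D}
    (hg : Subgroup.closure (Set.range g) = ⊤) :
    τ ∈ conjOrbit π ↔
      ∃ a ∈ H, ∀ l, (τ (g l) : GL (Fin n) F) = a * (π (g l) : GL (Fin n) F) * a⁻¹ := by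
  constructor
  · rintro ⟨a, rfl⟩
    exact ⟨a, a.2, fun l => rfl⟩
  · rintro ⟨a, ha, h⟩
    refine ⟨⟨a, ha⟩, MonoidHom.eq_of_eqOn_dense hg ?_⟩
    rintro _ ⟨l, rfl⟩
    exact Subtype.ext (h l).symm

/-- Equations over `k` are equations over `K`. -/
theorem IsAlgebraicOver.baseChange {k K : Type*} [Field k] [Field K] [Algebra k K] {n : ℕ}
    {H : Subgroup (GL (Fin n) K)} (hH : IsAlgebraicOver k H) : IsAlgebraicOver K H := by
  obtain ⟨I, hI⟩ := hH
  refine ⟨Ideal.span (MvPolynomial.map (algebraMap k K) '' (I : Set (MvPolynomial _ k))),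
    fun x => ?_⟩
  rw [hI, zeroLocus_span]
  constructor
  · rintro h _ ⟨p, hp, rfl⟩
    rw [aeval_map_algebraMap]
    exact h p hp
  · intro h p hp
    have h1 := h _ ⟨p, hp, rfl⟩
    rwa [aeval_map_algebraMap] at h1

/-- The equations of an algebraic group over `k` also define its group of `k`-points. -/
theorem IsAlgebraicOver.kPoints {k K : Type*} [Field k] [Field K] [Algebra k K] {n : ℕ}
    {H : Subgroup (GL (Fin n) K)} (hH : IsAlgebraicOver k H) :
    IsAlgebraicOver k (kPoints k H) := by
  obtain ⟨I, hI⟩ := hH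
  refine ⟨I, fun x => ?_⟩
  have h1 : glCoords (GeneralLinearGroup.map (algebraMap k K) x) = algebraMap k K ∘ glCoords x :=
    rfl
  change GeneralLinearGroup.map (algebraMap k K) x ∈ H ↔ _
  rw [hI, h1]
  refine forall₂_congr fun p _ => ?_
  rw [aeval_algebraMap_apply, map_eq_zero]

/-- The orbit of a completely reducible homomorphism under an algebraic group over a locally compact
algebraically closed field is Zariski closed: the Zariski closure of the orbit lies in its closure
for the topology of the field, and the orbit is closed for that topology. -/
theorem isZariskiClosed_conjOrbit {K : Type*} [NontriviallyNormedField K] [ProperSpace K]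
    [IsAlgClosed K] [CharZero K] (σ : K ≃+* ℂ) {n m : ℕ} {H : Subgroup (GL (Fin n) K)}
    (hH : IsAlgebraicOver K H) {D : Type*} [Group D] {π : D →* H} (hπ : IsCompletelyReducible π)
    {g : Fin m → D} (hg : Subgroup.closure (Set.range g) = ⊤) :
    IsZariskiClosed g (conjOrbit π) := by
  let coords : (D →* H) → Fin m × Fin n × Fin n → K :=
    fun ρ q => glCoords (ρ (g q.1) : GL (Fin n) K) q.2
  -- the equations are all those that hold on the orbit
  refine ⟨vanishingIdeal K (coords '' conjOrbit π), fun τ => ⟨fun hτ p hp => ?_, fun hτ => ?_⟩⟩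
  · exact hp _ ⟨τ, hτ, rfl⟩
  obtain ⟨I, hI⟩ := hH
  -- the variety of the pairs of mutually inverse matrices `A`, `B` with `A ∈ H`
  let S : Set (MvPolynomial ((Fin n × Fin n) ⊕ (Fin n × Fin n)) K) :=
    (rename Sum.inl '' (I : Set (MvPolynomial (Fin n × Fin n) K))) ∪
    Set.range fun p : Fin n × Fin n =>
      (∑ a, X (Sum.inl (p.1, a)) * X (Sum.inr (a, p.2))) -
        C ((1 : Matrix (Fin n) (Fin n) K) p.1 p.2)
  let φ : Fin m × Fin n × Fin n → MvPolynomial ((Fin n × Fin n) ⊕ (Fin n × Fin n)) K := fun q =>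
    ∑ b, (∑ a, X (Sum.inl (q.2.1, a)) * C ((π (g q.1) : GL (Fin n) K).val a b)) *
      X (Sum.inr (b, q.2.2))
  have hpt : ∀ z ∈ zeroLocus K (Ideal.span S), ∃ a ∈ H, ∀ l i j,
      eval z (φ (l, i, j)) = (a * (π (g l) : GL (Fin n) K) * a⁻¹ : GL (Fin n) K).val i j := by
    intro z hz
    rw [zeroLocus_span] at hz
    let A : Matrix (Fin n) (Fin n) K := fun i j => z (Sum.inl (i, j))
    let B : Matrix (Fin n) (Fin n) K := fun i j => z (Sum.inr (i, j))
    have hAB : A * B = 1 := by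
      ext i j
      have h1 := hz _ (Or.inr ⟨(i, j), rfl⟩)
      rw [map_sub, map_sum, aeval_C, sub_eq_zero] at h1
      rw [Matrix.mul_apply]
      simpa using h1
    refine ⟨⟨A, B, hAB, mul_eq_one_comm.1 hAB⟩, (hI _).2 fun p hp => ?_, fun l i j => ?_⟩
    · have h1 := hz _ (Or.inl ⟨p, hp, rfl⟩)
      rw [aeval_rename] at h1
      exact h1
    · change _ = (A * (π (g l) : GL (Fin n) K).val * B) i j
      rw [Matrix.mul_apply]
      simp only [Matrix.mul_apply]
      simp [φ, A, B]
  have hcl := mem_closure_image_zeroLocus (Ideal.span S) φ (coords τ) fun f hf => by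
    rw [← aeval_eq_eval]
    refine hτ f ?_
    rintro _ ⟨_, ⟨a, rfl⟩, rfl⟩
    let A : Matrix (Fin n) (Fin n) K := (a : GL (Fin n) K).val
    let B : Matrix (Fin n) (Fin n) K := ((a : GL (Fin n) K)⁻¹ : GL (Fin n) K).val
    let z : (Fin n × Fin n) ⊕ (Fin n × Fin n) → K :=
      Sum.elim (fun p => A p.1 p.2) (fun p => B p.1 p.2)
    have hz : z ∈ zeroLocus K (Ideal.span S) := by
      rw [zeroLocus_span]
      rintro _ (⟨p, hp, rfl⟩ | ⟨p, rfl⟩)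
      · rw [aeval_rename]
        exact (hI a).1 a.2 p hp
      · have h1 : (A * B) p.1 p.2 = (1 : Matrix (Fin n) (Fin n) K) p.1 p.2 := by
          rw [Units.mul_inv]
        rw [Matrix.mul_apply] at h1
        rw [map_sub, map_sum, aeval_C, sub_eq_zero]
        simpa [z] using h1
    have h1 := hf z hz
    rw [← aeval_eq_eval] at h1
    convert h1 using 2
    congr 1
    funext q
    change (A * (π (g q.1) : GL (Fin n) K).val * B) q.2.1 q.2.2 = _
    rw [Matrix.mul_apply]
    simp only [Matrix.mul_apply]
    simp [φ, z]
  have hss := hπ.isSemisimpleTuple hg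
  rw [mem_conjOrbit_iff hg]
  refine exists_mem_conj_of_mem_closure (K := K) σ ⟨I, hI⟩ (fun l => (π (g l)).2)
    (by simpa using hss) (fun l => (τ (g l)).2) ?_
  have hcont : Continuous fun (w : Fin m × Fin n × Fin n → K) (l : Fin m) =>
      (Matrix.of fun i j => w (l, i, j) : Matrix (Fin n) (Fin n) K) :=
    continuous_pi fun l => continuous_matrix fun i j => continuous_apply _
  refine map_mem_closure hcont hcl ?_
  rintro _ ⟨z, hz, rfl⟩
  obtain ⟨a, ha, h⟩ := hpt z hz
  exact ⟨a, ha, fun l => Matrix.ext fun i j => h l i j⟩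

/-- The orbit of a completely reducible homomorphism under the group of rational points is closed in
the topology of the ground field. -/
theorem isClosed_conjOrbit {k K : Type*} [NontriviallyNormedField k] [CompleteSpace k] [CharZero k]
    [Field K] [Algebra k K] [IsAlgClosed K] (σ : K ≃+* ℂ) {n m : ℕ} {H : Subgroup (GL (Fin n) K)}
    (hH : IsAlgebraicOver k H) {D : Type*} [Group D] {π : D →* kPoints k H}
    (hπ : IsCompletelyReducible ((kPointsIncl k H).comp π)) {g : Fin m → D}
    (hg : Subgroup.closure (Set.range g) = ⊤) :
    @IsClosed _ (homTopology (kPoints k H) g) (conjOrbit π) := by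
  let : TopologicalSpace (D →* kPoints k H) := homTopology (kPoints k H) g
  refine isClosed_of_closure_subset fun τ hτ => ?_
  rw [mem_conjOrbit_iff hg]
  refine exists_mem_conj_of_mem_closure (K := K) σ hH.kPoints (fun l => (π (g l)).2)
    (hπ.isSemisimpleTuple hg) (fun l => (τ (g l)).2) ?_
  have hcont : Continuous fun (ρ : D →* kPoints k H) (l : Fin m) =>
      (ρ (g l) : GL (Fin n) k).val := by
    have h1 : Continuous fun (w : Fin m → kPoints k H) (l : Fin m) => (w l : GL (Fin n) k).val :=
      continuous_pi fun l =>
        Units.continuous_val.comp (continuous_subtype_val.comp (continuous_apply l))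
    exact h1.comp continuous_induced_dom
  refine map_mem_closure hcont hτ fun ρ hρ => ?_
  obtain ⟨a, ha, h⟩ := (mem_conjOrbit_iff hg).1 hρ
  exact ⟨a, ha, fun l => congrArg Units.val (h l)⟩

theorem mainTheorem10
    {k : Type*} [NontriviallyNormedField k] [LocallyCompactSpace k] [CharZero k]
    {K : Type*} [Field K] [Algebra k K] [IsAlgClosure k K]
    {n : ℕ} (H : Subgroup (GL (Fin n) K)) (hH : IsAlgebraicOver k H)
    {D : Type*} [Group D] [Group.IsFinitelyPresented D]
    (π : D →* kPoints k H) (hπ : IsCompletelyReducible ((kPointsIncl k H).comp π)) :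
    ∀ (m : ℕ) (g : Fin m → D), Subgroup.closure (Set.range g) = ⊤ →
      IsZariskiClosed g (conjOrbit ((kPointsIncl k H).comp π)) ∧
      @IsClosed _ (homTopology (kPoints k H) g) (conjOrbit π) := by
  intro m g hg
  have : ProperSpace k := ProperSpace.of_locallyCompactSpace k
  have : IsAlgClosed K := IsAlgClosure.isAlgClosed k
  have : CharZero K := charZero_of_injective_algebraMap (algebraMap k K).injective
  obtain ⟨σ⟩ := nonempty_ringEquiv_complex k K
  refine ⟨?_, isClosed_conjOrbit σ hH hπ hg⟩
  -- `K` is topologized through the isomorphism with the complex numbers; this topology is unrelated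
  -- to the one of `k`
  let : NormedField K := NormedField.induced K ℂ σ σ.injective
  let : NontriviallyNormedField K :=
    { (inferInstance : NormedField K) with
      non_trivial := ⟨σ.symm 2, by
        change 1 < ‖σ (σ.symm 2)‖
        simp⟩ }
  have hiso : Isometry (σ.symm : ℂ → K) := Isometry.of_dist_eq fun a b => by
    change dist (σ (σ.symm a)) (σ (σ.symm b)) = _
    simp
  have : ProperSpace K := hiso.antilipschitz.properSpace hiso.continuous σ.symm.surjective
  exact isZariskiClosed_conjOrbit σ hH.baseChange hπ hg
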